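/- Let $A$ be a finite totally ordered alphabet. Terms of rank at most $1$ are formal products of letters of $A$ and of limit terms $x^{\omega+q}$ with $x\in A^+$, $q\in\mathbb Z$; words are the terms of rank $0$. Consider terms of rank $2$ of the form $$\alpha=\rho_0\pi_1^{\omega-1}\rho_1\cdots\pi_m^{\omega-1}\rho_m\qquad(m\ge 1),$$ where the $\rho_j$ are terms of rank at most $1$ (possibly empty) and the $\pi_j$ are terms of rank $1$; $m$ is the $2$-length of $\alpha$. Equality of terms is syntactic. *Semi-canonical forms.* A term $u_0x_1^{\omega+q_1}u_1\cdots x_n^{\omega+q_n}u_n$ of rank at most $1$ ($u_j\in A^*$) is a canonical form if every $x_j$ is a Lyndon word, no $x_j$ is a suffix of $u_{j-1}$, and no $x_j$ is a prefix of a word $u_jx_{j+1}^{\ell}$ with $\ell\ge0$ (of $u_n$, if $j=n$). Its initial and final $\omega$-portions are $u_0x_1^\omega$ and $x_n^\omega u_n$ (if $n\geq 1$). The term $\alpha$ is semi-canonical if $\rho_0\pi_1\pi_1\rho_1\cdots\pi_m\pi_m\rho_m$ is a canonical form. *Reduction algorithm.* A rank $2$ shift right replaces $(xy)^{\omega-1}x$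 by $x(yx)^{\omega-1}$, where $xy$ is a base $\pi_i$; its inverse is a shift left. Below $x,z$ denote bases in $A^+$, $u\in A^*$, and $w_j,\sigma,\tau$ denote terms of rank at most $1$; the rules apply to the subterms $\rho_{i-1}\pi_i^{\omega-1}\rho_i$ or $\rho_{i-1}\pi_i^{\omega-1}\rho_i\pi_{i+1}^{\omega-1}\rho_{i+1}$. Starting from a semi-canonical term, carry out the following steps in this order, each one until it does not modify the term any more. 1. If rank $2$ shifts transform the subterm into the left-hand side, replace it by the right-hand side: - $w_0x^{\omega+p}w_1(x^{\omega+q}w_1)^{\omega-1}x^{\omega+r}w_2\to w_0x^{\omega+p-q+r}w_2$; - $w_0(x^{\omega+p}w_1)^{\omega-1}x^{\omega+q}(w_2x^{\omega+r})^{\omega-1}w_3\to w_0(x^\omega w_2x^{\omega+p-q+r}w_1)^{\omega-1}x^\omega w_3$; - $w_0\mu^{\omega-1}\nu^{\omega-1}w_3\to w_0(\nu\nu\mu)^{\omega-1}\nu w_3$, where $\mu=ux^{\omega+p}w_1$ and $\nu=ux^{\omega+q}w_2$; - $w_0\mu^{\omega-1}\nu^{\omega-1}w_3\to w_0\mu(\nu\mu\mu)^{\omega-1}w_3$,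 where $\mu=w_1x^{\omega+p}u$ and $\nu=w_2x^{\omega+q}u$. 2. Apply rank $2$ shifts right; moreover, if $\pi_{i+1}=u'\tau$ with $u'\in A^+$ and $\rho_iu'=(xy)^kx$ for some $k\geq 0$ and some terms $x,y$ with $\pi_i=xy$, replace $\pi_i^{\omega-1}\rho_i\pi_{i+1}^{\omega-1}$ by $\rho_iu'(yx)^{\omega-1}\tau(u'\tau u'\tau)^{\omega-1}$. 3. Apply the following shortenings: - (type 1) $w_0\sigma(\tau\sigma)^{\omega-1}w_1\to w_0\tau^{\omega-1}w_1$ if $\sigma,\tau$ have rank $1$ and the same initial and final $\omega$-portions; - (type 2) if rank $2$ shifts transform the subterm into $w_0x^{\omega+p_1}w_1(z^{\omega+q_1}w_2x^{\omega+p_2}w_1)^{\omega-1}z^{\omega+q_2}w_3$, put $p=p_1-p_2$, $q=q_2-q_1$ and replace it by $w_0x^{\omega+p}(w_2x^\omega)^{\omega-1}w_3$ if $x=z$ and $q=0$, by $w_0(x^\omega w_2)^{\omega-1}x^{\omega+q}w_3$ if $x=z$ and $q\ne p=0$, and by $w_0x^{\omega+p}u_{x,z}(z^\omega w_2x^\omega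 u_{x,z})^{\omega-1}z^{\omega+q}w_3$ otherwise; then make rank $2$ shifts right in the result as long as possible. Here $u_{x,x}$ is the least letter different from the first letter of $x$, and, for $x\ne z$, $u_{x,z}$ is the word for which some $x^{\omega+k}u_{x,z}z^{\omega-l}$ with $k,l\ge 0$ and $x^ku_{x,z}=z^l$ is a canonical form; - (type 3) for $u\in A^*$, $w_0(ux^{\omega+q}w_1)^{\omega-1}ux^{\omega+p}w_2\to w_0(ux^\omega w_1)^{\omega-1}ux^{\omega+p-q}w_2$ and $w_0x^{\omega+p}u(w_1x^{\omega+q}u)^{\omega-1}w_2\to w_0x^{\omega+p-q}u(w_1x^\omega u)^{\omega-1}w_2$. The terms of rank $2$ that result from some run of this procedure are called rank $2$ $\mathbf{LG}$ canonical forms. *Roots.* Let $\mathsf V$ be the alphabet of symbols $\mathsf i_{u,x},\mathsf t_{y,v},\mathsf c_{y,v,x},\mathsf b_x$ ($u,v,x,y$ words), let $q_\alpha=1+\max\{|p|:\omega+p\text{ occurs in }\alpha\}$ and $q\ge q_\alpha$. The $q$-outline of a term of positive rank is a word over $\mathsf V\cup\mathsf V^{-1}$ of the form $\mathsf i_{u,x}\,\overline{\mathsf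 w}\,\mathsf t_{y,v}$, computed recursively as follows. The outline of $x^{\omega+p}$ is $\mathsf i_{\epsilon,x}\mathsf b_x^{q+p}\mathsf t_{x,\epsilon}$. Products with words change $\mathsf i_{u,x}$ into $\mathsf i_{wu,x}$ (left factor $w$) or $\mathsf t_{y,v}$ into $\mathsf t_{y,vw}$ (right factor $w$). The product of terms with outlines $\mathsf i_{u_1,x_1}\overline{\mathsf w}_1\mathsf t_{y_1,v_1}$ and $\mathsf i_{u_2,x_2}\overline{\mathsf w}_2\mathsf t_{y_2,v_2}$ has outline $\mathsf i_{u_1,x_1}\overline{\mathsf w}_1\mathsf c_{y_1,v_1u_2,x_2}\overline{\mathsf w}_2\mathsf t_{y_2,v_2}$. If $\pi$ has rank $1$ and outline $\mathsf i_{u,x}\overline{\mathsf w}\mathsf t_{y,v}$, then $\pi^{\omega-1}$ has outline $\mathsf i_{u,x}\mathsf c^{-1}\,\overline{\mathsf w}^{-1}\mathsf c^{-1}\mathsf t_{y,v}$ with $\mathsf c=\mathsf c_{y,vu,x}$. The $q$-root $\widetilde{\mathsf w}_q(\alpha)$ is the reduced form of the $q$-outline of $\alpha$ in the free group on $\mathsf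 V$. **Proposition.** Let $\alpha$ and $\beta$ be rank $2$ $\mathbf{LG}$ canonical forms with the same $2$-length, and let $q\ge\max\{q_\alpha,q_\beta\}$ be an integer. If $\widetilde{\mathsf w}_q(\alpha)=\widetilde{\mathsf w}_q(\beta)$, then $\alpha=\beta$. -/

import Mathlib

namespace KappaLG

universe u

/-! ### Terms -/

/-- A factor of a term of rank at most one: a letter, or a rank one limit term `x^{ω+q}` whose base
`x` is a finite word. -/
inductive Atom (A : Type u) : Type u
  | letter (a : A) : Atom A
  | pow (x : List A) (q : ℤ) : Atom A

/-- Terms of rank at most one, i.e. formal products of letters and of limit terms `x^{ω+q}`. -/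
abbrev Term1 (A : Type u) : Type u := List (Atom A)

/-- The term
`ρ₀ π₁^{ω-1} ρ₁ π₂^{ω-1} ρ₂ ⋯ π_m^{ω-1} ρ_m`, where all `ρ_j` and `π_j` have rank at most one; it is
stored by `head = ρ₀` and `tail = [(π₁, ρ₁), …, (π_m, ρ_m)]`. When every `π_j` has rank
exactly one and `m ≥ 1`, this is the rank configuration of a term of rank two in which all
the limit terms of rank two have exponent `ω-1`. -/
@[ext]
structure Term2 (A : Type u) : Type u where
  head : Term1 A
  tail : List (Term1 A × Term1 A)

/-- A finite word, seen as a term of rank zero. -/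
def word {A : Type u} (w : List A) : Term1 A := w.map Atom.letter

/-- The `n`-th power of a list. -/
def npow {X : Type u} (x : List X) (n : ℕ) : List X := (List.replicate n x).flatten

/-- The term has rank one, i.e. it is not a finite word. -/
def HasRankOne {A : Type u} (t : Term1 A) : Prop := ∃ x q, Atom.pow x q ∈ t

/-- The `2`-length: the number of limit terms of rank two. -/
def Term2.twoLength {A : Type u} (α : Term2 A) : ℕ := α.tail.length

/-- The `2`-expansion `ρ₀ π₁² ρ₁ ⋯ π_m² ρ_m`. -/
def Term2.twoExpansion {A : Type u} (α : Term2 A) : Term1 A :=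
  α.head ++ (α.tail.map fun s => s.1 ++ s.1 ++ s.2).flatten

/-! ### Lyndon words, canonical forms of rank at most one, semi-canonical forms -/

/-- The word is not of the form `u ^ n` with `n > 1`. -/
def IsPrimitive {A : Type u} (w : List A) : Prop :=
  ∀ (u : List A) (n : ℕ), 1 < n → w ≠ npow u n

/-- A Lyndon word: primitive, and minimal in its conjugacy class for the lexicographic order. -/
def IsLyndon {A : Type u} [LinearOrder A] (w : List A) : Prop :=
  IsPrimitive w ∧ ∀ u v : List A, w = u ++ v → w ≤ v ++ u

/-- Canonical forms of rank at most one. For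
`u₀ x₁^{ω+q₁} u₁ ⋯ x_n^{ω+q_n} u_n` with words `u_j`, the conditions are: each `x_j` is a Lyndon
word; no `x_j` is a suffix of `u_{j-1}`; no `x_j` is a prefix of a word `u_j x_{j+1}^ℓ` with
`ℓ ≥ 0` (of `u_n`, if `j = n`). -/
structure IsCanonical1 {A : Type u} [LinearOrder A] (t : Term1 A) : Prop where
  lyndon : ∀ x q, Atom.pow x q ∈ t → IsLyndon x
  not_suffix : ∀ L x q R, t ≠ L ++ word x ++ Atom.pow x q :: R
  not_prefix : ∀ L x q R, t ≠ L ++ Atom.pow x q :: (word x ++ R)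
  not_prefix_next : ∀ L x q u y r R,
    t = L ++ Atom.pow x q :: (word u ++ Atom.pow y r :: R) → ∀ l : ℕ, ¬ x <+: u ++ npow y l

/-- Semi-canonical forms of rank two (all exponents of rank two being `ω-1`): terms of rank two
whose `2`-expansion is a canonical form. -/
structure Term2.IsSemiCanonical {A : Type u} [LinearOrder A] (α : Term2 A) : Prop where
  tail_ne : α.tail ≠ []
  base_rank : ∀ s ∈ α.tail, HasRankOne s.1
  expansion : IsCanonical1 α.twoExpansion

/-- `u x^ω` is the initial `ω`-portion of the term `t` of rank one. -/
def IsInitialPortion {A : Type u} (t : Term1 A) (u x : List A) : Prop :=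
  ∃ q R, t = word u ++ Atom.pow x q :: R

/-- `y^ω v` is the final `ω`-portion of the term `t` of rank one. -/
def IsFinalPortion {A : Type u} (t : Term1 A) (y v : List A) : Prop :=
  ∃ q L, t = L ++ Atom.pow y q :: word v

/-- `σ` and `τ` have rank one, the same initial `ω`-portion and the same final `ω`-portion. For
canonical forms this is equality over the pseudovariety of finite locally trivial semigroups. -/
def SameOmegaPortions {A : Type u} (σ τ : Term1 A) : Prop :=
  ∃ u x y v, IsInitialPortion σ u x ∧ IsInitialPortion τ u x ∧
    IsFinalPortion σ y v ∧ IsFinalPortion τ y v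

/-! ### Rewriting -/

/-- Application of a rule to a subterm `ρ_{i-1} π_i^{ω-1} ρ_i ⋯ π_k^{ω-1} ρ_k` of a term, where the
`ρ_j` are the whole factors between consecutive limit terms of rank two. -/
inductive InContext {A : Type u} (R : Term2 A → Term2 A → Prop) : Term2 A → Term2 A → Prop
  | here (r r₁ : Term1 A) (s s₁ rest : List (Term1 A × Term1 A)) (h : R ⟨r, s⟩ ⟨r₁, s₁⟩) :
      InContext R ⟨r, s ++ rest⟩ ⟨r₁, s₁ ++ rest⟩
  | skip (ρ π r r₁ : Term1 A) (s s₁ : List (Term1 A × Term1 A))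
      (h : InContext R ⟨r, s⟩ ⟨r₁, s₁⟩) :
      InContext R ⟨ρ, (π, r) :: s⟩ ⟨ρ, (π, r₁) :: s₁⟩

/-- No application of the rewriting relation `R` modifies `α`. -/
def IsNormal {A : Type u} (R : Term2 A → Term2 A → Prop) (α : Term2 A) : Prop :=
  ∀ β, R α β → β = α

/-- `β` is obtained from `α` by applying `R` as long as this is possible. -/
def ReducesTo {A : Type u} (R : Term2 A → Term2 A → Prop) (α β : Term2 A) : Prop :=
  Relation.ReflTransGen R α β ∧ IsNormal R β

/-- The shift right `(xy)^{ω-1} x → x (yx)^{ω-1}` on a subterm `ρ_{i-1} π_i^{ω-1} ρ_i`. -/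
inductive ShiftRule {A : Type u} : Term2 A → Term2 A → Prop
  | mk (r x y s : Term1 A) (hx : x ≠ []) (hy : y ≠ []) :
      ShiftRule ⟨r, [(x ++ y, x ++ s)]⟩ ⟨r ++ x, [(y ++ x, s)]⟩

/-- A shift right of rank two in a term. -/
def ShiftRight {A : Type u} : Term2 A → Term2 A → Prop := InContext ShiftRule

/-- Transformability by rank two shifts (right and left) only. -/
def ShiftEquiv {A : Type u} : Term2 A → Term2 A → Prop := Relation.EqvGen ShiftRight

/-! ### Step (1): eliminations and agglutinations -/

/-- Limit term elimination:
`w₀ x^{ω+p} w₁ (x^{ω+q} w₁)^{ω-1} x^{ω+r} w₂` becomes `w₀ x^{ω+p-q+r} w₂`. -/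
inductive EliminationRule {A : Type u} : Term2 A → Term2 A → Prop
  | mk (δ : Term2 A) (w₀ w₁ w₂ : Term1 A) (x : List A) (p q r : ℤ)
      (h : ShiftEquiv δ ⟨w₀ ++ Atom.pow x p :: w₁, [(Atom.pow x q :: w₁, Atom.pow x r :: w₂)]⟩) :
      EliminationRule δ ⟨w₀ ++ Atom.pow x (p - q + r) :: w₂, []⟩

/-- Limit terms agglutination, in its three variants:
* `w₀ (x^{ω+p} w₁)^{ω-1} x^{ω+q} (w₂ x^{ω+r})^{ω-1} w₃` becomes
  `w₀ (x^ω w₂ x^{ω+p-q+r} w₁)^{ω-1} x^ω w₃`;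
* `w₀ (u x^{ω+p} w₁)^{ω-1} (u x^{ω+q} w₂)^{ω-1} w₃` becomes
  `w₀ (u x^{ω+q} w₂ u x^{ω+q} w₂ u x^{ω+p} w₁)^{ω-1} u x^{ω+q} w₂ w₃`;
* `w₀ (w₁ x^{ω+p} u)^{ω-1} (w₂ x^{ω+q} u)^{ω-1} w₃` becomes
  `w₀ w₁ x^{ω+p} u (w₂ x^{ω+q} u w₁ x^{ω+p} u w₁ x^{ω+p} u)^{ω-1} w₃`. -/
inductive AgglutinationRule {A : Type u} : Term2 A → Term2 A → Prop
  | inner (δ : Term2 A) (w₀ w₁ w₂ w₃ : Term1 A) (x : List A) (p q r : ℤ)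
      (h : ShiftEquiv δ
        ⟨w₀, [(Atom.pow x p :: w₁, [Atom.pow x q]), (w₂ ++ [Atom.pow x r], w₃)]⟩) :
      AgglutinationRule δ
        ⟨w₀, [(Atom.pow x 0 :: w₂ ++ Atom.pow x (p - q + r) :: w₁, Atom.pow x 0 :: w₃)]⟩
  | initial (δ : Term2 A) (w₀ w₁ w₂ w₃ : Term1 A) (u x : List A) (p q : ℤ)
      (h : ShiftEquiv δ
        ⟨w₀, [(word u ++ Atom.pow x p :: w₁, []), (word u ++ Atom.pow x q :: w₂, w₃)]⟩) :
      AgglutinationRule δ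
        ⟨w₀, [((word u ++ Atom.pow x q :: w₂) ++ (word u ++ Atom.pow x q :: w₂)
            ++ (word u ++ Atom.pow x p :: w₁), (word u ++ Atom.pow x q :: w₂) ++ w₃)]⟩
  | final (δ : Term2 A) (w₀ w₁ w₂ w₃ : Term1 A) (u x : List A) (p q : ℤ)
      (h : ShiftEquiv δ
        ⟨w₀, [(w₁ ++ Atom.pow x p :: word u, []), (w₂ ++ Atom.pow x q :: word u, w₃)]⟩) :
      AgglutinationRule δ
        ⟨w₀ ++ (w₁ ++ Atom.pow x p :: word u), [((w₂ ++ Atom.pow x q :: word u)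
            ++ (w₁ ++ Atom.pow x p :: word u) ++ (w₁ ++ Atom.pow x p :: word u), w₃)]⟩

/-- A limit term elimination or a limit terms agglutination. -/
def Step1 {A : Type u} : Term2 A → Term2 A → Prop :=
  InContext fun δ ε => EliminationRule δ ε ∨ AgglutinationRule δ ε

/-! ### Step (2): extended shifts right -/

/-- Extended shift right: a rank two shift right of `π_i^{ω-1}`, possibly preceded by the left
expansion `π_{i+1}^{ω-1} → π_{i+1} (π_{i+1} π_{i+1})^{ω-1}`. The expansion is made if `ρ_i u` is
a prefix of a power of `π_i` for a non-empty finite word `u` that is a prefix of `π_{i+1}`; then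
the whole of `ρ_i u` is passed to the left. In the second rule, `π_i = xy`, `π_{i+1} = uτ` and
`ρ_i u = (xy)^k x`. -/
inductive ExtendedShiftRule {A : Type u} : Term2 A → Term2 A → Prop
  | plain (δ ε : Term2 A) (h : ShiftRule δ ε) : ExtendedShiftRule δ ε
  | expand (r x y s τ t : Term1 A) (u : List A) (k : ℕ) (hu : u ≠ [])
      (h : s ++ word u = npow (x ++ y) k ++ x) :
      ExtendedShiftRule ⟨r, [(x ++ y, s), (word u ++ τ, t)]⟩
        ⟨r ++ s ++ word u, [(y ++ x, τ), ((word u ++ τ) ++ (word u ++ τ), t)]⟩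

/-- An extended shift right in a term. -/
def Step2 {A : Type u} : Term2 A → Term2 A → Prop := InContext ExtendedShiftRule

/-! ### Step (3): shortenings -/

/-- `u` is the word `u_{x,z}`: for `x = z` it is the least letter of the alphabet that differs from
the first letter of `x`; for `x ≠ z` it is the word such that `x^{ω+k} u z^{ω-l}` is the canonical
form of `x^ω z^ω = x^ω z^l z^{ω-l}` for some `k, l`. -/
def IsConnector {A : Type u} [LinearOrder A] (x z u : List A) : Prop :=
  (x = z ∧ ∃ a, u = [a] ∧ IsLeast {b : A | x.head? ≠ some b} a) ∨
  (x ≠ z ∧ ∃ k l : ℕ, npow x k ++ u = npow z l ∧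
    IsCanonical1 (Atom.pow x (k : ℤ) :: (word u ++ [Atom.pow z (-(l : ℤ))])))

/-- Shortening of type 1: `w σ (τσ)^{ω-1} s` becomes `w τ^{ω-1} s`, for terms `σ`, `τ` of rank one
with the same initial and the same final `ω`-portion. -/
inductive Shortening1 {A : Type u} : Term2 A → Term2 A → Prop
  | mk (w σ τ s : Term1 A) (h : SameOmegaPortions σ τ) :
      Shortening1 ⟨w ++ σ, [(τ ++ σ, s)]⟩ ⟨w, [(τ, s)]⟩

/-- The replacement in a shortening of type 2. A subterm that can be transformed by rank two shifts
into `w₀ x^{ω+p₁} w₁ (z^{ω+q₁} w₂ x^{ω+p₂} w₁)^{ω-1} z^{ω+q₂} w₃` is replaced, with `p = p₁ - p₂` and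
`q = q₂ - q₁`, by
* `w₀ x^{ω+p} (w₂ x^ω)^{ω-1} w₃` if `x = z` and `q = 0`;
* `w₀ (x^ω w₂)^{ω-1} x^{ω+q} w₃` if `x = z` and `q ≠ p = 0`;
* `w₀ x^{ω+p} u_{x,z} (z^ω w₂ x^ω u_{x,z})^{ω-1} z^{ω+q} w₃` otherwise. -/
inductive Shortening2Core {A : Type u} [LinearOrder A] : Term2 A → Term2 A → Prop
  | left (δ : Term2 A) (w₀ w₁ w₂ w₃ : Term1 A) (x : List A) (p₁ p₂ q₁ q₂ : ℤ)
      (h : ShiftEquiv δ ⟨w₀ ++ Atom.pow x p₁ :: w₁,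
        [(Atom.pow x q₁ :: w₂ ++ Atom.pow x p₂ :: w₁, Atom.pow x q₂ :: w₃)]⟩)
      (hq : q₂ - q₁ = 0) :
      Shortening2Core δ ⟨w₀ ++ [Atom.pow x (p₁ - p₂)], [(w₂ ++ [Atom.pow x 0], w₃)]⟩
  | right (δ : Term2 A) (w₀ w₁ w₂ w₃ : Term1 A) (x : List A) (p₁ p₂ q₁ q₂ : ℤ)
      (h : ShiftEquiv δ ⟨w₀ ++ Atom.pow x p₁ :: w₁,
        [(Atom.pow x q₁ :: w₂ ++ Atom.pow x p₂ :: w₁, Atom.pow x q₂ :: w₃)]⟩)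
      (hq : q₂ - q₁ ≠ 0) (hp : p₁ - p₂ = 0) :
      Shortening2Core δ ⟨w₀, [(Atom.pow x 0 :: w₂, Atom.pow x (q₂ - q₁) :: w₃)]⟩
  | generic (δ : Term2 A) (w₀ w₁ w₂ w₃ : Term1 A) (x z u : List A) (p₁ p₂ q₁ q₂ : ℤ)
      (h : ShiftEquiv δ ⟨w₀ ++ Atom.pow x p₁ :: w₁,
        [(Atom.pow z q₁ :: w₂ ++ Atom.pow x p₂ :: w₁, Atom.pow z q₂ :: w₃)]⟩)
      (hxz : x ≠ z ∨ (q₂ - q₁ ≠ 0 ∧ p₁ - p₂ ≠ 0)) (hu : IsConnector x z u) :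
      Shortening2Core δ ⟨w₀ ++ Atom.pow x (p₁ - p₂) :: word u,
        [(Atom.pow z 0 :: w₂ ++ Atom.pow x 0 :: word u, Atom.pow z (q₂ - q₁) :: w₃)]⟩

/-- Shortening of type 2: the replacement above, followed by rank two shifts right as long as they
are possible in the new subterm. -/
def Shortening2 {A : Type u} [LinearOrder A] (δ ε : Term2 A) : Prop :=
  ∃ γ, Shortening2Core δ γ ∧ Relation.ReflTransGen ShiftRight γ ε ∧ ∀ ζ, ¬ ShiftRight ε ζ

/-- Shortening of type 3, for a finite word `w`:
`r (w x^{ω+q} v)^{ω-1} w x^{ω+p} s` becomes `r (w x^ω v)^{ω-1} w x^{ω+p-q} s`, and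
`r x^{ω+p} w (v x^{ω+q} w)^{ω-1} s` becomes `r x^{ω+p-q} w (v x^ω w)^{ω-1} s`. -/
inductive Shortening3 {A : Type u} : Term2 A → Term2 A → Prop
  | right (r v s : Term1 A) (w x : List A) (p q : ℤ) :
      Shortening3
        ⟨r, [(word w ++ Atom.pow x q :: v, word w ++ Atom.pow x p :: s)]⟩
        ⟨r, [(word w ++ Atom.pow x 0 :: v, word w ++ Atom.pow x (p - q) :: s)]⟩
  | left (r v s : Term1 A) (w x : List A) (p q : ℤ) :
      Shortening3
        ⟨r ++ Atom.pow x p :: word w, [(v ++ Atom.pow x q :: word w, s)]⟩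
        ⟨r ++ Atom.pow x (p - q) :: word w, [(v ++ Atom.pow x 0 :: word w, s)]⟩

/-- A limit term shortening. -/
def Step3 {A : Type u} [LinearOrder A] : Term2 A → Term2 A → Prop :=
  InContext fun δ ε => Shortening1 δ ε ∨ Shortening2 δ ε ∨ Shortening3 δ ε

/-- Rank two `LG` canonical forms: the terms of rank two that are produced by the reduction
algorithm from some semi-canonical form of rank two. -/
def Term2.IsLGCanonical {A : Type u} [LinearOrder A] (γ : Term2 A) : Prop :=
  γ.tail ≠ [] ∧ ∃ α α₁ α₂ : Term2 A, α.IsSemiCanonical ∧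
    ReducesTo Step1 α α₁ ∧ ReducesTo Step2 α₁ α₂ ∧ ReducesTo Step3 α₂ γ

/-! ### Outlines and roots -/

/-- The alphabet of variables: initial variables `i_{u,x}`, final variables `t_{y,v}`, crucial
variables `c_{y,v,x}` and base variables `b_x`. -/
inductive Var (A : Type u) : Type u
  | ini (u x : List A) : Var A
  | fin (y v : List A) : Var A
  | cru (y v x : List A) : Var A
  | base (x : List A) : Var A
  deriving DecidableEq

/-- What is recorded of a term when outlines are computed recursively: a finite word for a term of
rank zero; for other terms, `inf u x w y v` stands for the outline `i_{u,x} w t_{y,v}`, where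
`w` is a word over the variables and their formal inverses (marked by `true` and `false`). -/
inductive Outline (A : Type u) : Type u
  | fin (w : List A) : Outline A
  | inf (u x : List A) (w : List (Var A × Bool)) (y v : List A) : Outline A

/-- The outline of a product. -/
def Outline.mul {A : Type u} : Outline A → Outline A → Outline A
  | .fin w₁, .fin w₂ => .fin (w₁ ++ w₂)
  | .fin w₁, .inf u x w y v => .inf (w₁ ++ u) x w y v
  | .inf u x w y v, .fin w₂ => .inf u x w y (v ++ w₂)
  | .inf u₁ x₁ w₁ y₁ v₁, .inf u₂ x₂ w₂ y₂ v₂ =>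
      .inf u₁ x₁ (w₁ ++ (Var.cru y₁ (v₁ ++ u₂) x₂, true) :: w₂) y₂ v₂

/-- The outline of `π^{ω-1}` for `π` of rank one: if that of `π` is
`i_{u,x} w t_{y,v}`, it is `i_{u,x} c⁻¹ w⁻¹ c⁻¹ t_{y,v}` with `c = c_{y,vu,x}`. (The value for words `π`
plays no role, as `π` is never a word in a term of rank two.) -/
def Outline.limit {A : Type u} : Outline A → Outline A
  | .fin w => .fin w
  | .inf u x w y v =>
      .inf u x ((Var.cru y (v ++ u) x, false) ::
        (FreeGroup.invRev w ++ [(Var.cru y (v ++ u) x, false)])) y v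

/-- The outline of a letter, or of a limit term `x^{ω+p}`, namely `i_{ε,x} b_x^{q+p} t_{x,ε}`. -/
def Atom.outline {A : Type u} (q : ℕ) : Atom A → Outline A
  | .letter a => .fin [a]
  | .pow x p => .inf [] x (List.replicate ((q : ℤ) + p).toNat (Var.base x, true)) x []

/-- The `q`-outline of a term of rank at most one. -/
def outline1 {A : Type u} (q : ℕ) (t : Term1 A) : Outline A :=
  t.foldr (fun a o => (a.outline q).mul o) (.fin [])

/-- The `q`-outline of a term of rank at most two. -/
def Term2.outline {A : Type u} (q : ℕ) (α : Term2 A) : Outline A :=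
  (outline1 q α.head).mul
    (α.tail.foldr (fun s o => ((outline1 q s.1).limit.mul (outline1 q s.2)).mul o) (.fin []))

/-- The word over the variables and their inverses that an outline stands for. -/
def Outline.toWord {A : Type u} : Outline A → List (Var A × Bool)
  | .fin _ => []
  | .inf u x w y v => (Var.ini u x, true) :: (w ++ [(Var.fin y v, true)])

/-- The `q`-root: the reduced form of the `q`-outline in the free group on the variables. -/
def Term2.root {A : Type u} [DecidableEq A] (q : ℕ) (α : Term2 A) : List (Var A × Bool) :=
  FreeGroup.reduce (α.outline q).toWord

/-- The number `|p|` for `x^{ω+p}`, and `0` for a letter. -/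
def Atom.absExp {A : Type u} : Atom A → ℕ
  | .letter _ => 0
  | .pow _ p => p.natAbs

/-- The maximum of `|p|` over the exponents `ω+p` occurring in a term of rank at most one (`0` if
there is none). -/
def maxExp1 {A : Type u} (t : Term1 A) : ℕ := (t.map Atom.absExp).foldr max 0

/-- The number `1 + max {|p| : ω+p occurs in α}`; each limit term of rank two contributes
`|-1| = 1` to the maximum. -/
def Term2.qBound {A : Type u} (α : Term2 A) : ℕ :=
  1 + (maxExp1 α.head ::
    α.tail.map fun s => max 1 (max (maxExp1 s.1) (maxExp1 s.2))).foldr max 0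

end KappaLG

namespace KappaLG

variable {A : Type*}

/-! ### Words, limit terms and the positive words between two limit terms -/

/-! An outline reads a crucial variable between two consecutive limit terms of rank $1$ and a power
of a base variable at each of them. A term of rank $2$ thus becomes an alternating product
$a_0n_1^{-1}a_1\cdots n_m^{-1}a_m$ in the free group: $a_i$ reads the stretch around $\rho_i$, from
the last limit term of $\pi_i$ to the first one of $\pi_{i+1}$, and $n_i$ reads $\pi_i$ together
with the last limit-free word before it and the first one after it, as in a power of $\pi_i$. Since
$q$ exceeds all exponents, these are positive words from which the stretches can be read off
(`body_injective`). Information is hidden only by cancellation between neighbouring factors.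

The first step of the algorithm bounds these cancellations. If the two cancellations inside one
factor met, they would share a limit term; shifts would then expose an agglutination (positive
factor, `Irr.length_add_lt_pair`) or an elimination (negative factor, `Irr.length_add_lt_base`). So
in an irreducible term every factor survives in part (`Irr.exists_trim`), the reduced word has
exactly $m$ negative runs, and no term with the same value has smaller $2$-length (`Trim.length_le`,
`Irr.length_le`).

All rules preserve the value (`Step1.gEq`, `Step2.gEq`, `Step3.gEq`), the rules of the last two
steps preserve the $2$-length, and every rule of the first step lowers it. Hence irreducibility
persists to the end (`Irr.of_gEq`). Canonicity of the $2$-expansion persists as well, and so does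
enough of the normality for shifts (`Step3.shiftReduced`). An $\mathbf{LG}$ canonical form is
therefore irreducible, free of shifts and free of shortenings at the same time
(`Term2.IsLGCanonical.reduced`).

Equal roots give equal trimmed factors (`Trim.unique`), and it remains to reconstruct what was
cancelled, from left to right. The prefix of $n_i$ that cancels is empty or comes from a single
limit term (`BlockReduced.prefix_cases`). The suffix of $n_i$ that cancels is empty or starts at one
of at most two limit terms (`BlockReduced.suffix_cases`): shortenings of type 3 fix the exponents in
the base as $\omega$, those of type 2 force the word between the two limit terms to be $u_{x,z}$,
and those of type 1 decide whether the suffix is empty. So the surviving parts determine each block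
(`TrimmedBlock.unique`), and an induction on the blocks recovers the term (`Reduced.unique`). -/

@[simp] theorem word_nil : word ([] : List A) = [] := rfl

@[simp] theorem word_cons (a : A) (w : List A) : word (a :: w) = Atom.letter a :: word w := rfl

@[simp] theorem word_append (v w : List A) : word (v ++ w) = word v ++ word w := by
  simp [word]

theorem word_injective {v w : List A} (h : word v = word w) : v = w := by
  induction v generalizing w with
  | nil => cases w <;> simp_all
  | cons a v ih => cases w with
    | nil => simp at h
    | cons b w => simp only [word_cons, List.cons.injEq, Atom.letter.injEq] at h
                  rw [h.1, ih h.2]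

@[simp] theorem pow_not_mem_word (x : List A) (p : ℤ) (v : List A) : Atom.pow x p ∉ word v := by
  simp [word]

/-- Induction on the number of limit terms. -/
theorem term_induction {P : Term1 A → Prop} (hw : ∀ v, P (word v))
    (hp : ∀ v z p t, P t → P (word v ++ Atom.pow z p :: t)) (t : Term1 A) : P t := by
  have aux : ∀ t : Term1 A, ∀ v, P (word v ++ t) := by
    intro t
    induction t with
    | nil => intro v; simpa using hw v
    | cons a t ih =>
      intro v
      cases a with
      | letter a => simpa using ih (v ++ [a])
      | pow z p => exact hp v z p t (by simpa using ih [])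
  simpa using aux t []

theorem word_or_pow (t : Term1 A) :
    (∃ v, t = word v) ∨ ∃ v z p t', t = word v ++ Atom.pow z p :: t' := by
  induction t using term_induction with
  | hw v => exact Or.inl ⟨v, rfl⟩
  | hp v z p t _ => exact Or.inr ⟨v, z, p, t, rfl⟩

theorem word_or_pow_last (t : Term1 A) :
    (∃ v, t = word v) ∨ ∃ v z p t', t = t' ++ Atom.pow z p :: word v := by
  induction t using term_induction with
  | hw v => exact Or.inl ⟨v, rfl⟩
  | hp v z p t ih =>
    rcases ih with ⟨w, rfl⟩ | ⟨w, y, r, t', rfl⟩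
    · exact Or.inr ⟨w, z, p, word v, rfl⟩
    · exact Or.inr ⟨w, y, r, word v ++ Atom.pow z p :: t', by simp⟩

/-- Two factorizations with an initial `ω`-portion agree on this portion. -/
theorem word_pow_inj {u v : List A} {x y : List A} {p r : ℤ} {s t : Term1 A}
    (h : word u ++ Atom.pow x p :: s = word v ++ Atom.pow y r :: t) :
    u = v ∧ x = y ∧ p = r ∧ s = t := by
  induction u generalizing v with
  | nil => cases v <;> simp_all
  | cons a u ih => cases v with
    | nil => simp at h
    | cons b v =>
      simp only [word_cons, List.cons_append, List.cons.injEq, Atom.letter.injEq] at h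
      obtain ⟨h1, h2⟩ := h
      obtain ⟨h3, h4⟩ := ih h2
      exact ⟨by rw [h1, h3], h4⟩

theorem pow_word_inj {u v : List A} {x y : List A} {p r : ℤ} {s t : Term1 A}
    (h : s ++ Atom.pow x p :: word u = t ++ Atom.pow y r :: word v) :
    s = t ∧ x = y ∧ p = r ∧ u = v := by
  rw [List.append_eq_append_iff] at h
  have key : ∀ (w : Term1 A) {u v : List A} {x y : List A} {p r : ℤ},
      Atom.pow x p :: word u = w ++ Atom.pow y r :: word v → w = [] := by
    intro w u v x y p r h
    cases w with
    | nil => rfl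
    | cons b w =>
      simp only [List.cons_append, List.cons.injEq] at h
      exact absurd (h.2 ▸ (by simp : Atom.pow y r ∈ w ++ Atom.pow y r :: word v))
        (pow_not_mem_word _ _ _)
  rcases h with ⟨w, h1, h2⟩ | ⟨w, h1, h2⟩
  · obtain rfl := key w h2
    simp only [List.nil_append, List.cons.injEq, Atom.pow.injEq] at h2
    exact ⟨by simpa using h1.symm, h2.1.1, h2.1.2, word_injective h2.2⟩
  · obtain rfl := key w h2
    simp only [List.nil_append, List.cons.injEq, Atom.pow.injEq] at h2
    exact ⟨by simpa using h1, h2.1.1.symm, h2.1.2.symm, (word_injective h2.2).symm⟩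

/-- The positive word read between a limit term with base `y` followed by the word `v` and a limit
term with base `x`, when `t` is read in between. An empty base marks an end of the term. -/
def bodyAux (q : ℕ) : List A → List A → Term1 A → List A → List (Var A)
  | y, v, [], x => [Var.cru y v x]
  | y, v, Atom.letter a :: t, x => bodyAux q y (v ++ [a]) t x
  | y, v, Atom.pow z p :: t, x =>
      Var.cru y v z :: (List.replicate ((q : ℤ) + p).toNat (Var.base z) ++ bodyAux q z [] t x)

/-- The positive word read between limit terms with bases `y` and `x`, separated by `t`. -/
def body (q : ℕ) (y : List A) (t : Term1 A) (x : List A) : List (Var A) := bodyAux q y [] t x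

theorem bodyAux_eq (q : ℕ) (y v : List A) (t : Term1 A) (x : List A) :
    bodyAux q y v t x = body q y (word v ++ t) x := by
  have : ∀ v w, bodyAux q y w (word v ++ t) x = bodyAux q y (w ++ v) t x := by
    intro v
    induction v with
    | nil => simp
    | cons a v ih => intro w; simp [bodyAux, ih]
  rw [body, this]; rfl

theorem body_word (q : ℕ) (y v x : List A) : body q y (word v) x = [Var.cru y v x] := by
  have := bodyAux_eq q y v [] x
  simp only [List.append_nil] at this
  rw [← this]; rfl

theorem body_word_pow (q : ℕ) (y v : List A) (z : List A) (p : ℤ) (t : Term1 A) (x : List A) :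
    body q y (word v ++ Atom.pow z p :: t) x =
      Var.cru y v z :: (List.replicate ((q : ℤ) + p).toNat (Var.base z) ++ body q z t x) := by
  rw [← bodyAux_eq]; rfl

theorem body_append_pow (q : ℕ) (y : List A) (s : Term1 A) (z : List A) (p : ℤ) (t : Term1 A)
    (x : List A) :
    body q y (s ++ Atom.pow z p :: t) x =
      body q y s z ++ (List.replicate ((q : ℤ) + p).toNat (Var.base z) ++ body q z t x) := by
  induction s using term_induction generalizing y with
  | hw v => rw [body_word_pow, body_word]; rfl
  | hp v z' p' s ih =>
    rw [List.append_assoc, List.cons_append, body_word_pow, body_word_pow, ih]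
    simp

theorem body_eq_cru_cons (q : ℕ) (y : List A) (t : Term1 A) (x : List A) :
    ∃ v z B, body q y t x = Var.cru y v z :: B := by
  rcases word_or_pow t with ⟨v, rfl⟩ | ⟨v, z, p, t', rfl⟩
  · exact ⟨v, x, [], body_word ..⟩
  · exact ⟨v, z, _, body_word_pow ..⟩

theorem body_eq_append_cru (q : ℕ) (y : List A) (t : Term1 A) (x : List A) :
    ∃ v z B, body q y t x = B ++ [Var.cru z v x] := by
  rcases word_or_pow_last t with ⟨v, rfl⟩ | ⟨v, z, p, t', rfl⟩
  · exact ⟨v, y, [], body_word ..⟩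
  · exact ⟨v, z, _, by rw [body_append_pow, body_word, ← List.append_assoc]⟩

theorem body_ne_nil (q : ℕ) (y : List A) (t : Term1 A) (x : List A) : body q y t x ≠ [] := by
  obtain ⟨v, z, B, h⟩ := body_eq_cru_cons q y t x
  simp [h]

/-- Factorizations of the positive word at a base variable come from factorizations of the term. -/
theorem body_eq_append_base {q : ℕ} {y : List A} {t : Term1 A} {x : List A} {B C : List (Var A)}
    {z : List A} (h : body q y t x = B ++ Var.base z :: C) :
    ∃ l p r e f, t = l ++ Atom.pow z p :: r ∧ e + 1 + f = ((q : ℤ) + p).toNat ∧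
      B = body q y l z ++ List.replicate e (Var.base z) ∧
      C = List.replicate f (Var.base z) ++ body q z r x := by
  induction t using term_induction generalizing y B with
  | hw v => rw [body_word] at h; cases B <;> simp at h
  | hp v z' p' t ih =>
    rw [body_word_pow] at h
    cases B with
    | nil => simp at h
    | cons b B =>
      simp only [List.cons_append, List.cons.injEq] at h
      obtain ⟨rfl, h⟩ := h
      rw [List.append_eq_append_iff] at h
      rcases h with ⟨D, h1, h2⟩ | ⟨D, h1, h2⟩
      · obtain ⟨l, p, r, e, f, rfl, h4, h5, h6⟩ := ih h2
        refine ⟨word v ++ Atom.pow z' p' :: l, p, r, e, f, by simp, h4, ?_, h6⟩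
        rw [h1, h5, body_word_pow]; simp
      · cases D with
        | nil =>
          obtain ⟨v', z'', E, h3⟩ := body_eq_cru_cons q z' t x
          simp [h3] at h2
        | cons d D =>
          simp only [List.cons_append, List.cons.injEq] at h2
          obtain ⟨rfl, rfl⟩ := h2
          obtain ⟨h3, h4, h5⟩ := List.append_eq_replicate_iff.1 h1.symm
          obtain ⟨h6, h7⟩ : Var.base z = Var.base z' ∧
              D = List.replicate D.length (Var.base z') := by
            rw [List.eq_replicate_iff] at h5
            refine ⟨h5.2 _ (by simp), List.eq_replicate_iff.2 ⟨rfl, fun b hb => h5.2 _ (by simp [hb])⟩⟩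
          obtain rfl : z = z' := by simpa using h6
          refine ⟨word v, p', t, B.length, D.length, rfl, by simp at h3; omega, ?_, by rw [← h7]⟩
          rw [body_word, ← h4]; rfl

/-- Occurrences of a crucial variable. -/
theorem mem_body_cru {q : ℕ} {y : List A} {t : Term1 A} {x y₁ v z : List A}
    (h : Var.cru y₁ v z ∈ body q y t x) :
    (y₁ = y ∧ z = x ∧ t = word v) ∨ (y₁ = y ∧ ∃ p r, t = word v ++ Atom.pow z p :: r) ∨
    (z = x ∧ ∃ l p, t = l ++ Atom.pow y₁ p :: word v) ∨
    ∃ l p p' r, t = l ++ Atom.pow y₁ p :: (word v ++ Atom.pow z p' :: r) := by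
  induction t using term_induction generalizing y with
  | hw w =>
    rw [body_word] at h
    simp only [List.mem_singleton, Var.cru.injEq] at h
    exact Or.inl ⟨h.1, h.2.2, by rw [h.2.1]⟩
  | hp w z' p' t ih =>
    rw [body_word_pow] at h
    simp only [List.mem_cons, Var.cru.injEq, List.mem_append, List.mem_replicate, reduceCtorEq,
      and_false, false_or] at h
    rcases h with ⟨rfl, rfl, rfl⟩ | h
    · exact Or.inr (Or.inl ⟨rfl, p', t, rfl⟩)
    · rcases ih h with ⟨rfl, rfl, rfl⟩ | ⟨rfl, p, r, rfl⟩ | ⟨rfl, l, p, rfl⟩ | ⟨l, p, r, s, rfl⟩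
      · exact Or.inr (Or.inr (Or.inl ⟨rfl, word w, p', rfl⟩))
      · exact Or.inr (Or.inr (Or.inr ⟨word w, p', p, r, rfl⟩))
      · exact Or.inr (Or.inr (Or.inl ⟨rfl, word w ++ Atom.pow z' p' :: l, p, by simp⟩))
      · exact Or.inr (Or.inr (Or.inr ⟨word w ++ Atom.pow z' p' :: l, p, r, s, by simp⟩))

/-- All limit terms occurring in `t` have positive multiplicity at level `q`. -/
def ExpPos (q : ℕ) (t : Term1 A) : Prop := ∀ x p, Atom.pow x p ∈ t → 0 < (q : ℤ) + p

@[simp] theorem expPos_append {q : ℕ} {s t : Term1 A} :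
    ExpPos q (s ++ t) ↔ ExpPos q s ∧ ExpPos q t := by
  simp only [ExpPos, List.mem_append]
  exact ⟨fun h => ⟨fun x p hp => h x p (Or.inl hp), fun x p hp => h x p (Or.inr hp)⟩,
    fun h x p hp => hp.elim (h.1 x p) (h.2 x p)⟩

@[simp] theorem expPos_word (q : ℕ) (v : List A) : ExpPos q (word v) := by
  intro x p h; simp at h

@[simp] theorem expPos_cons_pow {q : ℕ} {x : List A} {p : ℤ} {t : Term1 A} :
    ExpPos q (Atom.pow x p :: t) ↔ 0 < (q : ℤ) + p ∧ ExpPos q t := by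
  constructor
  · intro h
    exact ⟨h x p (by simp), fun y r hr => h y r (by simp [hr])⟩
  · rintro ⟨h1, h2⟩ y r hr
    simp only [List.mem_cons, Atom.pow.injEq] at hr
    rcases hr with ⟨rfl, rfl⟩ | hr
    · exact h1
    · exact h2 y r hr

theorem replicate_append_inj {X : Type*} {b : X} {m n : ℕ} {s t : List X}
    (h : List.replicate m b ++ s = List.replicate n b ++ t) (hs : s.head? ≠ some b)
    (ht : t.head? ≠ some b) : m = n ∧ s = t := by
  induction m generalizing n with
  | zero => cases n with
    | zero => simpa using h
    | succ n => simp [List.replicate_succ] at h; simp [h] at hs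
  | succ m ih => cases n with
    | zero => simp [List.replicate_succ] at h; simp [← h] at ht
    | succ n =>
      simp only [List.replicate_succ, List.cons_append, List.cons.injEq, true_and] at h
      obtain ⟨h1, h2⟩ := ih h
      exact ⟨by rw [h1], h2⟩

theorem append_replicate_inj {X : Type*} {b : X} {m n : ℕ} {s t : List X}
    (h : s ++ List.replicate m b = t ++ List.replicate n b) (hs : s.getLast? ≠ some b)
    (ht : t.getLast? ≠ some b) : m = n ∧ s = t := by
  have := congrArg List.reverse h
  simp only [List.reverse_append, List.reverse_replicate] at this
  obtain ⟨h1, h2⟩ := replicate_append_inj this (by simpa using hs) (by simpa using ht)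
  exact ⟨h1, List.reverse_injective h2⟩

theorem body_head?_ne (q : ℕ) (y : List A) (t : Term1 A) (x z : List A) :
    (body q y t x).head? ≠ some (Var.base z) := by
  obtain ⟨v, z, B, h⟩ := body_eq_cru_cons q y t x
  simp [h]

theorem body_getLast?_ne (q : ℕ) (y : List A) (t : Term1 A) (x z : List A) :
    (body q y t x).getLast? ≠ some (Var.base z) := by
  obtain ⟨v, z, B, h⟩ := body_eq_append_cru q y t x
  simp [h]

/-- A term is determined by its positive word. -/
theorem body_injective {q : ℕ} {y y' : List A} {t t' : Term1 A} {x x' : List A}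
    (h : body q y t x = body q y' t' x') (ht : ExpPos q t) (ht' : ExpPos q t') :
    y = y' ∧ t = t' ∧ x = x' := by
  induction t using term_induction generalizing y y' t' with
  | hw v =>
    rw [body_word] at h
    rcases word_or_pow t' with ⟨v', rfl⟩ | ⟨v', z, p, s, rfl⟩
    · simp only [body_word, List.cons.injEq, Var.cru.injEq, and_true] at h
      exact ⟨h.1, by rw [h.2.1], h.2.2⟩
    · rw [body_word_pow] at h
      simp only [List.cons.injEq] at h
      exact absurd (List.append_eq_nil_iff.1 h.2.symm).2 (body_ne_nil _ _ _ _)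
  | hp v z p t ih =>
    rw [body_word_pow] at h
    rcases word_or_pow t' with ⟨v', rfl⟩ | ⟨v', z', p', s, rfl⟩
    · rw [body_word] at h
      simp only [List.cons.injEq] at h
      exact absurd (List.append_eq_nil_iff.1 h.2).2 (body_ne_nil _ _ _ _)
    · rw [body_word_pow] at h
      simp only [List.cons.injEq, Var.cru.injEq] at h
      obtain ⟨⟨rfl, rfl, rfl⟩, h⟩ := h
      obtain ⟨h1, h2⟩ := replicate_append_inj h (body_head?_ne _ _ _ _ _) (body_head?_ne _ _ _ _ _)
      simp only [expPos_append, expPos_cons_pow] at ht ht'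
      obtain ⟨-, rfl, rfl⟩ := ih h2 ht.2.2 ht'.2.2
      refine ⟨rfl, ?_, rfl⟩
      rw [show p = p' by omega]

/-- Positive multiplicities separate any two crucial variables: each of them, except the closing
one, is followed by the base variable of its right base. This turns a cut at an arbitrary place of a
positive word into a cut at a limit term. -/
theorem body_succ {q : ℕ} {y : List A} {t : Term1 A} {x y₁ v z : List A} {B C : List (Var A)}
    (ht : ExpPos q t) (h : body q y t x = B ++ Var.cru y₁ v z :: C) :
    (C = [] ∧ z = x) ∨ ∃ C', C = Var.base z :: C' := by
  induction t using term_induction generalizing y B with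
  | hw w =>
    rw [body_word] at h
    cases B with
    | nil => simp at h; exact Or.inl ⟨h.2, h.1.2.2.symm⟩
    | cons b B => simp at h
  | hp w z' p t ih =>
    rw [body_word_pow] at h
    simp only [expPos_append, expPos_cons_pow] at ht
    obtain ⟨n, hn⟩ : ∃ n, ((q : ℤ) + p).toNat = n + 1 := ⟨((q : ℤ) + p).toNat - 1, by omega⟩
    cases B with
    | nil =>
      simp only [List.nil_append, List.cons.injEq, Var.cru.injEq] at h
      obtain ⟨⟨rfl, rfl, rfl⟩, rfl⟩ := h
      exact Or.inr ⟨_, by rw [hn, List.replicate_succ]; rfl⟩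
    | cons b B =>
      simp only [List.cons_append, List.cons.injEq] at h
      obtain ⟨rfl, h⟩ := h
      rw [List.append_eq_append_iff] at h
      rcases h with ⟨D, h1, h2⟩ | ⟨D, h1, h2⟩
      · exact ih ht.2.2 h2
      · cases D with
        | nil =>
          exact ih (B := []) ht.2.2 (by simpa using h2.symm)
        | cons d D =>
          simp only [List.cons_append, List.cons.injEq] at h2
          have : d ∈ List.replicate ((q : ℤ) + p).toNat (Var.base z') := by rw [h1]; simp
          rw [← h2.1] at this
          simp at this

theorem body_pred {q : ℕ} {y : List A} {t : Term1 A} {x y₁ v z : List A} {B C : List (Var A)}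
    (ht : ExpPos q t) (h : body q y t x = B ++ Var.cru y₁ v z :: C) :
    (B = [] ∧ y₁ = y) ∨ ∃ B', B = B' ++ [Var.base y₁] := by
  induction t using term_induction generalizing y B with
  | hw w =>
    rw [body_word] at h
    cases B with
    | nil => simp at h; exact Or.inl ⟨rfl, h.1.1.symm⟩
    | cons b B => simp at h
  | hp w z' p t ih =>
    rw [body_word_pow] at h
    simp only [expPos_append, expPos_cons_pow] at ht
    obtain ⟨n, hn⟩ : ∃ n, ((q : ℤ) + p).toNat = n + 1 := ⟨((q : ℤ) + p).toNat - 1, by omega⟩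
    have hn' : List.replicate ((q : ℤ) + p).toNat (Var.base z') =
        List.replicate n (Var.base z') ++ [Var.base z'] := by rw [hn, List.replicate_succ']
    cases B with
    | nil =>
      simp only [List.nil_append, List.cons.injEq, Var.cru.injEq] at h
      exact Or.inl ⟨rfl, h.1.1.symm⟩
    | cons b B =>
      simp only [List.cons_append, List.cons.injEq] at h
      obtain ⟨rfl, h⟩ := h
      rw [List.append_eq_append_iff] at h
      rcases h with ⟨D, h1, h2⟩ | ⟨D, h1, h2⟩
      · rcases ih ht.2.2 h2 with ⟨rfl, rfl⟩ | ⟨B', rfl⟩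
        · exact Or.inr ⟨Var.cru y w y₁ :: List.replicate n (Var.base y₁), by rw [h1, hn']; simp⟩
        · exact Or.inr ⟨Var.cru y w z' :: (List.replicate ((q : ℤ) + p).toNat (Var.base z') ++ B'), by
            rw [h1]; simp⟩
      · cases D with
        | nil =>
          rcases ih (B := []) ht.2.2 (by simpa using h2.symm) with ⟨-, rfl⟩ | ⟨B', h3⟩
          · exact Or.inr ⟨Var.cru y w y₁ :: List.replicate n (Var.base y₁), by
              simp only [List.append_nil] at h1; rw [← h1, hn']; simp⟩
          · simp at h3
        | cons d D =>
          simp only [List.cons_append, List.cons.injEq] at h2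
          have : d ∈ List.replicate ((q : ℤ) + p).toNat (Var.base z') := by rw [h1]; simp
          rw [← h2.1] at this
          simp at this

end KappaLG

namespace KappaLG

/-! ### Alternating products of positive and negative words in free groups -/

section Alternating

variable {V : Type*}

/-- A word as a positive element of the free group. -/
def posWord (w : List V) : List (V × Bool) := w.map fun v => (v, true)

/-- The formal inverse of a word. -/
def negWord (w : List V) : List (V × Bool) := FreeGroup.invRev (posWord w)

/-- The signed word `a n₁⁻¹ a₁ n₂⁻¹ a₂ ⋯`. -/
def signedWord : List V → List (List V × List V) → List (V × Bool)
  | a, [] => posWord a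
  | a, (n, a') :: t => posWord a ++ (negWord n ++ signedWord a' t)

@[simp] theorem posWord_nil : posWord ([] : List V) = [] := rfl

@[simp] theorem posWord_append (v w : List V) : posWord (v ++ w) = posWord v ++ posWord w := by
  simp [posWord]

@[simp] theorem negWord_append (v w : List V) : negWord (v ++ w) = negWord w ++ negWord v := by
  simp [negWord, FreeGroup.invRev]

theorem negWord_eq_map (w : List V) : negWord w = w.reverse.map fun v => (v, false) := by
  simp [negWord, posWord, FreeGroup.invRev]

theorem mk_negWord (w : List V) :
    FreeGroup.mk (negWord w) = (FreeGroup.mk (posWord w))⁻¹ := by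
  rw [negWord, FreeGroup.inv_mk]

/-- The number of maximal negative factors of a signed word, the preceding sign being given. -/
def negBlocks : Bool → List (V × Bool) → ℕ
  | _, [] => 0
  | p, (_, b) :: L => (if p && !b then 1 else 0) + negBlocks b L

theorem negBlocks_bounds (L : List (V × Bool)) :
    negBlocks false L ≤ negBlocks true L ∧ negBlocks true L ≤ negBlocks false L + 1 := by
  cases L with
  | nil => simp [negBlocks]
  | cons a L => obtain ⟨a, b⟩ := a; cases b <;> simp [negBlocks]; omega

theorem negBlocks_le (p : Bool) (L : List (V × Bool)) : negBlocks p L ≤ negBlocks true L := by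
  cases p
  · exact (negBlocks_bounds L).1
  · exact le_rfl

/-- The two letters of a cancelled pair have opposite signs, so their removal may shorten, delete or
fuse negative runs, but never creates one. The reduced word therefore has the fewest negative runs
among the words with its value. -/
theorem negBlocks_step {L₁ L₂ : List (V × Bool)} (h : FreeGroup.Red.Step L₁ L₂) (p : Bool) :
    negBlocks p L₂ ≤ negBlocks p L₁ := by
  obtain ⟨L, R, x, b⟩ := h
  rename_i L R x b
  induction L generalizing p with
  | nil =>
    have h1 := negBlocks_bounds R
    cases p <;> cases b <;> simp [negBlocks] <;> omega
  | cons a L ih => obtain ⟨a, c⟩ := a; simp only [List.cons_append, negBlocks]; have := ih c; omega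

theorem negBlocks_red {L₁ L₂ : List (V × Bool)} (h : FreeGroup.Red L₁ L₂) :
    negBlocks true L₂ ≤ negBlocks true L₁ := by
  induction h with
  | refl => exact le_rfl
  | tail _ h ih => exact (negBlocks_step h _).trans ih

theorem negBlocks_pos_append (p : Bool) (w : List V) (L : List (V × Bool)) :
    negBlocks p (posWord w ++ L) ≤ negBlocks true L ∧
      (w ≠ [] → negBlocks p (posWord w ++ L) = negBlocks true L) := by
  induction w generalizing p with
  | nil => simpa using negBlocks_le p L
  | cons a w ih =>
    have h := ih true
    by_cases hw : w = []
    · subst hw; simp [posWord, negBlocks]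
    · have := h.2 hw
      simp only [posWord, List.map_cons, List.cons_append, negBlocks] at this ⊢
      simp [this]

theorem negBlocks_neg_append (w : List V) (L : List (V × Bool)) :
    negBlocks true (negWord w ++ L) ≤ 1 + negBlocks true L ∧
      (w ≠ [] → negBlocks true (negWord w ++ L) = 1 + negBlocks false L) := by
  rw [negWord_eq_map]
  have key : ∀ w : List V, negBlocks false (w.map (fun v => (v, false)) ++ L) = negBlocks false L := by
    intro w
    induction w with
    | nil => rfl
    | cons a w ih => simp [negBlocks, ih]
  have h2 : ∀ w : List V, w ≠ [] →
      negBlocks true (w.map (fun v => (v, false)) ++ L) = 1 + negBlocks false L := by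
    intro w hw
    cases w with
    | nil => exact absurd rfl hw
    | cons a w => simp [negBlocks, key]
  refine ⟨?_, fun hw => h2 _ (by simpa using hw)⟩
  by_cases hw : w = []
  · subst hw; simp
  · rw [h2 _ (by simpa using hw)]
    have := negBlocks_bounds L
    omega

theorem negBlocks_signedWord_le (a : List V) (t : List (List V × List V)) :
    negBlocks true (signedWord a t) ≤ t.length := by
  induction t generalizing a with
  | nil =>
    have := (negBlocks_pos_append true a []).1
    simpa [signedWord, negBlocks] using this
  | cons s t ih =>
    obtain ⟨n, a'⟩ := s
    have h1 := (negBlocks_pos_append true a (negWord n ++ signedWord a' t)).1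
    have h2 := (negBlocks_neg_append n (signedWord a' t)).1
    have h3 := ih a'
    simp only [signedWord, List.length_cons]
    omega

/-- `Trim R a t b s`: after deletion of the prefix `R` of `a`, all cancellations between the
consecutive factors of `a n₁⁻¹ a₁ n₂⁻¹ a₂ ⋯` yield `b` and `s`, and no factor disappears. -/
inductive Trim : List V → List V → List (List V × List V) → List V → List (List V × List V) → Prop
  | nil (R P : List V) (hP : P ≠ []) : Trim R (R ++ P) [] P []
  | cons (R P S R' N a P' : List V) (t t' : List (List V × List V)) (hP : P ≠ []) (hN : N ≠ [])
      (h1 : P.getLast? ≠ N.getLast?) (h2 : N.head? ≠ P'.head?) (h : Trim R' a t P' t') :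
      Trim R (R ++ (P ++ S)) ((R' ++ (N ++ S), a) :: t) P ((N, P') :: t')

theorem Trim.ne_nil {R a P : List V} {t t' : List (List V × List V)} (h : Trim R a t P t') :
    P ≠ [] ∧ (∀ s ∈ t', s.1 ≠ [] ∧ s.2 ≠ []) ∧ t'.length = t.length := by
  induction h with
  | nil R P hP => simpa using hP
  | cons R P S R' N a P' t t' hP hN h1 h2 h ih =>
    refine ⟨hP, ?_, by simp [ih.2.2]⟩
    intro s hs
    rcases List.mem_cons.1 hs with rfl | hs
    · exact ⟨hN, ih.1⟩
    · exact ih.2.1 s hs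

/-- The product telescopes: the common suffix $S$ cancels between a positive factor and the negative
one after it, the common prefix $R'$ cancels at the next junction, and only the prefix $R$ set aside
at the beginning stays outside. -/
theorem Trim.mk_signedWord {R a P : List V} {t t' : List (List V × List V)}
    (h : Trim R a t P t') :
    FreeGroup.mk (signedWord a t) = FreeGroup.mk (posWord R) * FreeGroup.mk (signedWord P t') := by
  induction h with
  | nil R P hP => simp [signedWord, FreeGroup.mul_mk]
  | cons R P S R' N a P' t t' hP hN h1 h2 h ih =>
    simp only [signedWord, posWord_append, negWord_append, ← FreeGroup.mul_mk, ih, mk_negWord,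
      ]
    group

theorem head?_signedWord {P : List V} (hP : P ≠ []) (t : List (List V × List V)) :
    (signedWord P t).head? = P.head?.map fun v => (v, true) := by
  cases P with
  | nil => exact absurd rfl hP
  | cons a P => cases t <;> simp [signedWord, posWord]

theorem isReduced_posWord (P : List V) : FreeGroup.IsReduced (posWord P) := by
  rw [FreeGroup.IsReduced, posWord, List.isChain_map]
  exact List.Pairwise.isChain (List.pairwise_of_forall (by simp))

theorem isReduced_negWord (P : List V) : FreeGroup.IsReduced (negWord P) := by
  rw [FreeGroup.IsReduced, negWord_eq_map, List.isChain_map]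
  exact List.Pairwise.isChain (List.pairwise_of_forall (by simp))

theorem Trim.isReduced {R a P : List V} {t t' : List (List V × List V)} (h : Trim R a t P t') :
    FreeGroup.IsReduced (signedWord P t') := by
  induction h with
  | nil R P hP => exact isReduced_posWord P
  | cons R P S R' N a P' t t' hP hN h1 h2 h ih =>
    have ih' := ih
    simp only [signedWord, FreeGroup.IsReduced] at ih ⊢
    refine List.isChain_append.2 ⟨isReduced_posWord P,
      List.isChain_append.2 ⟨isReduced_negWord N, ih, ?_⟩, ?_⟩
    · rw [head?_signedWord h.ne_nil.1, negWord_eq_map]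
      intro x hx y hy hxy
      simp only [List.getLast?_map, List.getLast?_reverse, Option.mem_def, Option.map_eq_some_iff]
        at hx hy
      obtain ⟨v, hv, rfl⟩ := hx
      obtain ⟨w, hw, rfl⟩ := hy
      simp only at hxy
      subst hxy
      exact absurd (hv.trans hw.symm) h2
    · intro x hx y hy hxy
      have : (negWord N ++ signedWord P' t').head? = N.getLast?.map fun v => (v, false) := by
        rw [List.head?_append_of_ne_nil _ (by simpa [negWord_eq_map] using hN), negWord_eq_map]
        simp
      rw [this] at hy
      simp only [posWord, List.getLast?_map, Option.mem_def, Option.map_eq_some_iff] at hx hy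
      obtain ⟨v, hv, rfl⟩ := hx
      obtain ⟨w, hw, rfl⟩ := hy
      simp only at hxy
      subst hxy
      exact absurd (hv.trans hw.symm) h1

theorem Trim.negBlocks_eq {R a P : List V} {t t' : List (List V × List V)}
    (h : Trim R a t P t') : negBlocks true (signedWord P t') = t.length := by
  induction h with
  | nil R P hP =>
    have := (negBlocks_pos_append true P []).1
    simpa [signedWord, negBlocks] using this
  | cons R P S R' N a P' t t' hP hN h1 h2 h ih =>
    simp only [signedWord, List.length_cons]
    rw [(negBlocks_pos_append true P _).2 hP, (negBlocks_neg_append N _).2 hN, ← ih]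
    have hP' := h.ne_nil.1
    cases t' with
    | nil =>
      have h3 := (negBlocks_pos_append false P' []).2 hP'
      have h4 := (negBlocks_pos_append true P' []).2 hP'
      simp only [List.append_nil] at h3 h4
      simp only [signedWord, h3, h4]
      omega
    | cons s t' =>
      simp only [signedWord]
      rw [(negBlocks_pos_append false P' _).2 hP', (negBlocks_pos_append true P' _).2 hP']
      omega

/-- A product in which no factor disappears has the minimal number of negative factors. -/
theorem Trim.length_le {a P : List V} {t t' : List (List V × List V)} (h : Trim [] a t P t')
    {b : List V} {s : List (List V × List V)}
    (hb : FreeGroup.mk (signedWord b s) = FreeGroup.mk (signedWord a t)) : t.length ≤ s.length := by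
  rw [h.mk_signedWord, posWord_nil, FreeGroup.mul_mk, List.nil_append] at hb
  obtain ⟨L, h1, h2⟩ := FreeGroup.Red.exact.1 hb
  rw [h.isReduced.red_iff_eq] at h2
  subst h2
  rw [← h.negBlocks_eq]
  exact (negBlocks_red h1).trans (negBlocks_signedWord_le _ _)

theorem map_append_inj {X : Type*} {c : Bool} {P P' : List X} {L L' : List (X × Bool)}
    (h : P.map (fun v => (v, c)) ++ L = P'.map (fun v => (v, c)) ++ L')
    (hL : ∀ v, L.head? ≠ some (v, c)) (hL' : ∀ v, L'.head? ≠ some (v, c)) : P = P' ∧ L = L' := by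
  induction P generalizing P' with
  | nil => cases P' with
    | nil => simpa using h
    | cons v P' => exact absurd (by simp at h; simp [h]) (hL v)
  | cons a P ih => cases P' with
    | nil => exact absurd (by simp at h; simp [← h]) (hL' a)
    | cons v P' =>
      simp only [List.map_cons, List.cons_append, List.cons.injEq, Prod.mk.injEq, and_true] at h
      obtain ⟨h1, h2⟩ := ih h.2
      exact ⟨by rw [h.1, h1], h2⟩

/-- Non-empty factors are the maximal runs of constant sign, and these can be read off the signed
word. -/
theorem signedWord_injective {P P' : List V} {t t' : List (List V × List V)}
    (h : signedWord P t = signedWord P' t') (ht : ∀ s ∈ t, s.1 ≠ [] ∧ s.2 ≠ [])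
    (ht' : ∀ s ∈ t', s.1 ≠ [] ∧ s.2 ≠ []) : P = P' ∧ t = t' := by
  have hn : ∀ {n : List V} (_ : n ≠ []) (L : List (V × Bool)) (v : V),
      (negWord n ++ L).head? ≠ some (v, true) := by
    intro n hn L v hv
    rw [List.head?_append_of_ne_nil _ (by simpa [negWord_eq_map] using hn), negWord_eq_map] at hv
    simp at hv
  induction t generalizing P P' t' with
  | nil =>
    cases t' with
    | nil =>
      have := @map_append_inj V true P P' [] [] (by simpa [signedWord, posWord] using h)
        (by simp) (by simp)
      exact ⟨this.1, rfl⟩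
    | cons s t' =>
      obtain ⟨n, a⟩ := s
      have hs := ht' (n, a) (by simp)
      have := @map_append_inj V true P P' [] _ (by simpa [signedWord, posWord] using h)
        (by simp) (hn hs.1 (signedWord a t'))
      exact absurd this.2.symm (by simp [negWord_eq_map, hs.1])
  | cons s t ih =>
    obtain ⟨n, a⟩ := s
    have hs := ht (n, a) (by simp)
    cases t' with
    | nil =>
      have := @map_append_inj V true P P' _ [] (by simpa [signedWord, posWord] using h)
        (hn hs.1 (signedWord a t)) (by simp)
      exact absurd this.2 (by simp [negWord_eq_map, hs.1])
    | cons s' t' =>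
      obtain ⟨n', a'⟩ := s'
      have hs' := ht' (n', a') (by simp)
      obtain ⟨h1, h2⟩ := @map_append_inj V true P P' _ _ (by simpa [signedWord, posWord] using h)
        (hn hs.1 (signedWord a t)) (hn hs'.1 (signedWord a' t'))
      rw [negWord_eq_map, negWord_eq_map] at h2
      obtain ⟨h3, h4⟩ := map_append_inj h2 (by simp [head?_signedWord hs.2])
        (by simp [head?_signedWord hs'.2])
      obtain ⟨h5, h6⟩ := ih h4 (fun s hs => ht s (by simp [hs])) (fun s hs => ht' s (by simp [hs]))
      have h7 : n = n' := List.reverse_injective h3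
      exact ⟨h1, by rw [h7, h5, h6]⟩

/-- Both trimmed products are reduced words with the same value in the free group, hence the same
word. -/
theorem Trim.unique {a P a' P' : List V} {t s t' s' : List (List V × List V)}
    (h : Trim [] a t P s) (h' : Trim [] a' t' P' s')
    (he : FreeGroup.mk (signedWord a t) = FreeGroup.mk (signedWord a' t')) : P = P' ∧ s = s' := by
  rw [h.mk_signedWord, h'.mk_signedWord] at he
  simp only [posWord_nil, FreeGroup.mul_mk, List.nil_append] at he
  obtain ⟨L, h1, h2⟩ := FreeGroup.Red.exact.1 he
  rw [h.isReduced.red_iff_eq] at h1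
  rw [h'.isReduced.red_iff_eq] at h2
  exact signedWord_injective (h1.symm.trans h2) h.ne_nil.2.1 h'.ne_nil.2.1

theorem exists_common_prefix {X : Type*} (s t : List X) :
    ∃ R s' t', s = R ++ s' ∧ t = R ++ t' ∧ (s' ≠ [] → t' ≠ [] → s'.head? ≠ t'.head?) := by
  induction s generalizing t with
  | nil => exact ⟨[], [], t, rfl, rfl, by simp⟩
  | cons a s ih =>
    cases t with
    | nil => exact ⟨[], a :: s, [], rfl, rfl, by simp⟩
    | cons b t =>
      by_cases hab : a = b
      · subst hab
        obtain ⟨R, s', t', h1, h2, h3⟩ := ih t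
        exact ⟨a :: R, s', t', by simp [h1], by simp [h2], h3⟩
      · exact ⟨[], a :: s, b :: t, rfl, rfl, by simpa using hab⟩

theorem exists_common_suffix {X : Type*} (s t : List X) :
    ∃ S s' t', s = s' ++ S ∧ t = t' ++ S ∧ (s' ≠ [] → t' ≠ [] → s'.getLast? ≠ t'.getLast?) := by
  obtain ⟨R, s', t', h1, h2, h3⟩ := exists_common_prefix s.reverse t.reverse
  refine ⟨R.reverse, s'.reverse, t'.reverse, ?_, ?_, ?_⟩
  · rw [← List.reverse_append, ← h1, List.reverse_reverse]
  · rw [← List.reverse_append, ← h2, List.reverse_reverse]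
  · intro h4 h5
    simpa using h3 (by simpa using h4) (by simpa using h5)

/-- Conditions on the overlaps of consecutive factors under which no factor disappears. -/
def Tight : List V → List V → List (List V × List V) → Prop
  | R, a, [] => R.length < a.length
  | R, a, (n, a') :: t => (∀ S, S <:+ a → S <:+ n → R.length + S.length < a.length ∧
      ∀ R', R' <+: n → R' <+: a' → R'.length + S.length < n.length) ∧
      ∀ R', R' <+: n → R' <+: a' → Tight R' a' t

/-- The pieces are what remains after deletion of the longest common suffixes and prefixes of
neighbouring factors. Maximality makes the letters at each junction differ; tightness keeps the two
deletions within a factor from meeting. The second conclusion says that $P$ starts with the letter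
of $a$ after $R$, which the induction needs to compare first letters at the preceding junction. -/
theorem Tight.exists_trim {R a : List V} {t : List (List V × List V)} (h : Tight R a t)
    (hR : R <+: a) : ∃ P t', Trim R a t P t' ∧ a.drop R.length = P ++ (a.drop (R.length + P.length)) := by
  induction t generalizing R a with
  | nil =>
    obtain ⟨P, rfl⟩ := hR
    refine ⟨P, [], Trim.nil R P ?_, by simp⟩
    rintro rfl
    simp [Tight] at h
  | cons s t ih =>
    obtain ⟨n, a'⟩ := s
    obtain ⟨S, a₁, n₁, rfl, rfl, hS⟩ := exists_common_suffix a n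
    obtain ⟨R', n₂, a₂, h3, rfl, hR'⟩ := exists_common_prefix (n₁ ++ S) a'
    rw [h3] at h
    obtain ⟨h4, h5⟩ := h
    have hT := h5 R' ⟨_, rfl⟩ ⟨_, rfl⟩
    obtain ⟨h6, h7⟩ := h4 S ⟨_, rfl⟩ (by rw [← h3]; exact ⟨_, rfl⟩)
    have h8 := h7 R' ⟨_, rfl⟩ ⟨_, rfl⟩
    obtain ⟨P', t', hP', hd⟩ := ih hT ⟨_, rfl⟩
    -- split `n₂` and `a₁`
    have hlen : n₂.length ≥ S.length := by simp at h8; omega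
    obtain ⟨N, hN⟩ : ∃ N, n₂ = N ++ S := by
      have : S <:+ R' ++ n₂ := by rw [← h3]; exact ⟨_, rfl⟩
      exact (List.suffix_of_suffix_length_le this ⟨_, rfl⟩ hlen).imp fun _ h => h.symm
    subst hN
    have hNne : N ≠ [] := by rintro rfl; simp at h8
    obtain ⟨P, hP⟩ : ∃ P, a₁ = R ++ P := by
      have h9 : R <+: a₁ := List.prefix_of_prefix_length_le hR ⟨_, rfl⟩ (by simp at h6; omega)
      exact h9.imp fun _ h => h.symm
    subst hP
    have hPne : P ≠ [] := by rintro rfl; simp at h6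
    have hn1 : n₁ = R' ++ N := by
      rw [← List.append_assoc] at h3; exact List.append_cancel_right h3
    subst hn1
    refine ⟨P, (N, P') :: t', ?_, by simp [List.drop_append]⟩
    rw [List.append_assoc, h3]
    refine Trim.cons R P S R' N _ P' t t' hPne hNne ?_ ?_ hP'
    · have := hS (by simp [hPne]) (by simp [hNne])
      rwa [List.getLast?_append_of_ne_nil _ hPne, List.getLast?_append_of_ne_nil _ hNne] at this
    · simp only [List.drop_left] at hd
      have ha2 : a₂ ≠ [] := by rintro rfl; simp at hd; exact hP'.ne_nil.1 hd
      have := hR' (by simp [hNne]) ha2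
      rw [hd, List.head?_append_of_ne_nil _ hNne, List.head?_append_of_ne_nil _ hP'.ne_nil.1] at this
      exact this

end Alternating

end KappaLG

namespace KappaLG

variable {A : Type*}

/-! ### Portions of terms and the alternating product of a term of rank two -/

/-- The word in the initial `ω`-portion. -/
def iniWord : Term1 A → List A
  | [] => []
  | Atom.letter a :: t => a :: iniWord t
  | Atom.pow _ _ :: _ => []

/-- The base in the initial `ω`-portion. -/
def iniBase : Term1 A → List A
  | [] => []
  | Atom.letter _ :: t => iniBase t
  | Atom.pow x _ :: _ => x

/-- The last limit base and the word after it, starting from given values. -/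
def finState : List A × List A → Term1 A → List A × List A
  | s, [] => s
  | s, Atom.letter a :: t => finState (s.1, s.2 ++ [a]) t
  | _, Atom.pow z _ :: t => finState (z, []) t

/-- The base in the final `ω`-portion. -/
def finBase (t : Term1 A) : List A := (finState ([], []) t).1

/-- The word in the final `ω`-portion. -/
def finWord (t : Term1 A) : List A := (finState ([], []) t).2

@[simp] theorem iniWord_word_pow (u x : List A) (p : ℤ) (t : Term1 A) :
    iniWord (word u ++ Atom.pow x p :: t) = u := by
  induction u with
  | nil => rfl
  | cons a u ih => simp [iniWord, ih]

@[simp] theorem iniBase_word_pow (u x : List A) (p : ℤ) (t : Term1 A) :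
    iniBase (word u ++ Atom.pow x p :: t) = x := by
  induction u with
  | nil => rfl
  | cons a u ih => simp [iniBase, ih]

theorem finState_word (s : List A × List A) (v : List A) :
    finState s (word v) = (s.1, s.2 ++ v) := by
  induction v generalizing s with
  | nil => simp [finState]
  | cons a v ih => simp [finState, ih]

theorem finState_append (s : List A × List A) (t t' : Term1 A) :
    finState s (t ++ t') = finState (finState s t) t' := by
  induction t generalizing s with
  | nil => rfl
  | cons a t ih => cases a <;> simp [finState, ih]

theorem finState_pow (s : List A × List A) (t : Term1 A) (y : List A) (p : ℤ) (t' : Term1 A) :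
    finState s (t ++ Atom.pow y p :: t') = finState (y, []) t' := by
  simp [finState_append, finState]

theorem finState_pow_word (s : List A × List A) (t : Term1 A) (y : List A) (p : ℤ) (v : List A) :
    finState s (t ++ Atom.pow y p :: word v) = (y, v) := by
  simp [finState_pow, finState_word]

@[simp] theorem finBase_pow_word (t : Term1 A) (y : List A) (p : ℤ) (v : List A) :
    finBase (t ++ Atom.pow y p :: word v) = y := by simp [finBase, finState_pow_word]

@[simp] theorem finWord_pow_word (t : Term1 A) (y : List A) (p : ℤ) (v : List A) :
    finWord (t ++ Atom.pow y p :: word v) = v := by simp [finWord, finState_pow_word]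

theorem HasRankOne.exists_ini {t : Term1 A} (h : HasRankOne t) :
    ∃ p r, t = word (iniWord t) ++ Atom.pow (iniBase t) p :: r := by
  rcases word_or_pow t with ⟨v, rfl⟩ | ⟨v, z, p, t', rfl⟩
  · obtain ⟨x, q, h⟩ := h; simp at h
  · exact ⟨p, t', by simp⟩

theorem HasRankOne.exists_fin {t : Term1 A} (h : HasRankOne t) :
    ∃ p l, t = l ++ Atom.pow (finBase t) p :: word (finWord t) := by
  rcases word_or_pow_last t with ⟨v, rfl⟩ | ⟨v, z, p, t', rfl⟩
  · obtain ⟨x, q, h⟩ := h; simp at h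
  · exact ⟨p, t', by simp⟩

theorem HasRankOne.finState_eq {t : Term1 A} (h : HasRankOne t) (s : List A × List A) :
    finState s t = (finBase t, finWord t) := by
  obtain ⟨p, l, h⟩ := h.exists_fin
  rw [h, finState_pow_word]
  simp

/-- The positive word of the square of a base, between its extreme limit terms. -/
def baseWord (q : ℕ) (π : Term1 A) : List (Var A) :=
  body q (finBase π) (word (finWord π) ++ (π ++ word (iniWord π))) (iniBase π)

/-- The first positive factor of the alternating product of a term. -/
def altHead (q : ℕ) (y : List A) (r : Term1 A) : List (Term1 A × Term1 A) → List (Var A)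
  | [] => body q y r []
  | s :: _ => body q y (r ++ word (iniWord s.1)) (iniBase s.1)

/-- The other factors of the alternating product of a term. -/
def altTail (q : ℕ) : List (Term1 A × Term1 A) → List (List (Var A) × List (Var A))
  | [] => []
  | s :: t => (baseWord q s.1, altHead q (finBase s.1) (word (finWord s.1) ++ s.2) t) :: altTail q t

theorem altTail_length (q : ℕ) (s : List (Term1 A × Term1 A)) :
    (altTail q s).length = s.length := by
  induction s with
  | nil => rfl
  | cons a s ih => simp [altTail, ih]

/-- The signed word of an outline between two given limit bases. -/
def Outline.eval (y : List A) (o : Outline A) (x : List A) : List (Var A × Bool) :=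
  match o with
  | .fin w => [(Var.cru y w x, true)]
  | .inf u x₀ w y₀ v => (Var.cru y u x₀, true) :: (w ++ [(Var.cru y₀ v x, true)])

theorem Outline.mul_assoc (o₁ o₂ o₃ : Outline A) :
    (o₁.mul o₂).mul o₃ = o₁.mul (o₂.mul o₃) := by
  cases o₁ <;> cases o₂ <;> cases o₃ <;> simp [Outline.mul]

theorem Outline.fin_nil_mul (o : Outline A) : (Outline.fin []).mul o = o := by
  cases o <;> simp [Outline.mul]

/-- `eval` closes an outline by two limit bases, so that outlines of rank zero and of positive rank
are treated alike; a product can then be cut at any factor of positive rank. -/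
theorem Outline.eval_mul (y₀ : List A) (o₁ o₂ : Outline A) (u x : List A)
    (w : List (Var A × Bool)) (y v x₀ : List A) :
    (o₁.mul ((Outline.inf u x w y v).mul o₂)).eval y₀ x₀ =
      (o₁.mul (.fin u)).eval y₀ x ++ (w ++ ((Outline.fin v).mul o₂).eval y x₀) := by
  cases o₁ <;> cases o₂ <;> simp [Outline.mul, Outline.eval]

theorem outline1_cons (q : ℕ) (a : Atom A) (t : Term1 A) :
    outline1 q (a :: t) = (a.outline q).mul (outline1 q t) := rfl

theorem outline1_append (q : ℕ) (s t : Term1 A) :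
    outline1 q (s ++ t) = (outline1 q s).mul (outline1 q t) := by
  induction s with
  | nil => exact (Outline.fin_nil_mul _).symm
  | cons a s ih => rw [List.cons_append, outline1_cons, outline1_cons, ih, Outline.mul_assoc]

theorem outline1_word (q : ℕ) (v : List A) : outline1 q (word v) = .fin v := by
  induction v with
  | nil => rfl
  | cons a v ih => rw [word_cons, outline1_cons, ih]; rfl

theorem eval_outline1 (q : ℕ) (y : List A) (t : Term1 A) (x : List A) :
    (outline1 q t).eval y x = posWord (body q y t x) := by
  induction t using term_induction generalizing y with
  | hw v => rw [outline1_word, body_word]; rfl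
  | hp v z p t ih =>
    rw [outline1_append, outline1_cons, outline1_word, Atom.outline, Outline.eval_mul, body_word_pow,
      Outline.fin_nil_mul, ih]
    simp [Outline.mul, Outline.eval, posWord]

theorem outline1_eq_fin {q : ℕ} {t : Term1 A} {w : List A} (h : outline1 q t = .fin w) :
    t = word w := by
  rcases word_or_pow t with ⟨v, rfl⟩ | ⟨v, z, p, t', rfl⟩
  · rw [outline1_word] at h; rw [Outline.fin.inj h]
  · rw [outline1_append, outline1_cons, outline1_word, Atom.outline] at h
    cases h' : outline1 q t' <;> simp [h', Outline.mul] at h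

theorem outline1_eq_inf {q : ℕ} {t : Term1 A} {u x y v : List A} {w : List (Var A × Bool)}
    (h : outline1 q t = .inf u x w y v) :
    HasRankOne t ∧ iniWord t = u ∧ iniBase t = x ∧ finBase t = y ∧ finWord t = v := by
  induction t using term_induction generalizing u x w with
  | hw v => rw [outline1_word] at h; simp at h
  | hp v' z p t ih =>
    refine ⟨⟨z, p, by simp⟩, ?_⟩
    rw [outline1_append, outline1_cons, outline1_word, Atom.outline] at h
    rw [iniWord_word_pow, iniBase_word_pow]
    cases h' : outline1 q t with
    | fin w' =>
      obtain rfl := outline1_eq_fin h'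
      simp only [h', Outline.mul, Outline.inf.injEq, List.append_nil] at h
      simp only [finBase_pow_word, finWord_pow_word]
      simpa using ⟨h.1, h.2.1, h.2.2.2⟩
    | inf u' x' w' y' v'' =>
      simp only [h', Outline.mul, Outline.inf.injEq, List.append_nil] at h
      obtain ⟨h1, h2, h3, rfl, rfl⟩ := h
      obtain ⟨hr, -, -, h4, h5⟩ := ih h'
      rw [finBase, finWord, finState_pow, hr.finState_eq]
      simpa using ⟨h1, h2, h4, h5⟩

/-- The outline of $\pi^{\omega-1}$ contains $\mathsf c^{-1}\overline{\mathsf w}^{-1}\mathsf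
c^{-1}$, the inverse of the positive word $\mathsf c\,\overline{\mathsf w}\,\mathsf c$. The point is
that the latter is `baseWord`. -/
theorem HasRankOne.outline1_eq {t : Term1 A} (h : HasRankOne t) (q : ℕ) :
    ∃ w, outline1 q t = .inf (iniWord t) (iniBase t) w (finBase t) (finWord t) ∧
      posWord (baseWord q t) =
        (Var.cru (finBase t) (finWord t ++ iniWord t) (iniBase t), true) ::
          (w ++ [(Var.cru (finBase t) (finWord t ++ iniWord t) (iniBase t), true)]) := by
  cases h' : outline1 q t with
  | fin w =>
    obtain rfl := outline1_eq_fin h'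
    obtain ⟨x, p, h⟩ := h; simp at h
  | inf u x w y v =>
    obtain ⟨-, rfl, rfl, rfl, rfl⟩ := outline1_eq_inf h'
    refine ⟨w, rfl, ?_⟩
    rw [baseWord, ← eval_outline1, outline1_append, outline1_append, h', outline1_word,
      outline1_word, Outline.eval_mul]
    simp [Outline.mul, Outline.eval]

/-- The outline of the part of a term that starts with the first limit term of rank two. -/
def tailOutline (q : ℕ) (s : List (Term1 A × Term1 A)) : Outline A :=
  s.foldr (fun s o => ((outline1 q s.1).limit.mul (outline1 q s.2)).mul o) (.fin [])

/-- Inverse letters arise only from the limit terms of rank $2$, one negative factor for each. The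
limit-free words at the two ends of a base also enter the neighbouring positive factors. -/
theorem eval_outline (q : ℕ) (y : List A) (r : Term1 A) (s : List (Term1 A × Term1 A))
    (hs : ∀ a ∈ s, HasRankOne a.1) :
    ((outline1 q r).mul (tailOutline q s)).eval y [] =
      signedWord (altHead q y r s) (altTail q s) := by
  induction s generalizing y r with
  | nil =>
    have : (outline1 q r).mul (tailOutline q []) = outline1 q r := by
      simp only [tailOutline, List.foldr_nil]
      cases outline1 q r <;> simp [Outline.mul]
    rw [this, eval_outline1]
    rfl
  | cons a s ih =>
    obtain ⟨π, ρ⟩ := a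
    have ih' := ih (finBase π) (word (finWord π) ++ ρ) fun a ha => hs a (by simp [ha])
    obtain ⟨w, h1, h2⟩ := (hs (π, ρ) (by simp)).outline1_eq q
    simp only at h1 h2
    have h3 : tailOutline q ((π, ρ) :: s) =
        (outline1 q π).limit.mul ((outline1 q ρ).mul (tailOutline q s)) := by
      simp [tailOutline, Outline.mul_assoc]
    rw [h3, h1, Outline.limit, Outline.eval_mul]
    rw [outline1_append, outline1_word, Outline.mul_assoc] at ih'
    rw [ih', ← outline1_word q (iniWord π), ← outline1_append, eval_outline1]
    simp only [altHead, altTail, signedWord, negWord, h2]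
    simp [FreeGroup.invRev]

theorem body_base_or_cru {q : ℕ} {y : List A} {t : Term1 A} {x : List A} {b : Var A}
    (h : b ∈ body q y t x) : (∃ z, b = Var.base z) ∨ ∃ z v z', b = Var.cru z v z' := by
  induction t using term_induction generalizing y with
  | hw v => rw [body_word] at h; exact Or.inr ⟨y, v, x, by simpa using h⟩
  | hp v z p t ih =>
    rw [body_word_pow] at h
    simp only [List.mem_cons, List.mem_append, List.mem_replicate] at h
    rcases h with rfl | ⟨-, rfl⟩ | h
    · exact Or.inr ⟨_, _, _, rfl⟩
    · exact Or.inl ⟨_, rfl⟩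
    · exact ih h

/-- The substitution of initial and final variables by crucial variables with an empty base. -/
def closeVar : Var A → Var A
  | .ini u x => .cru [] u x
  | .fin y v => .cru y v []
  | .cru y v x => .cru y v x
  | .base x => .base x

theorem closeVar_altHead {q : ℕ} {y : List A} {r : Term1 A} {s : List (Term1 A × Term1 A)}
    {b : Var A} (h : b ∈ altHead q y r s) : closeVar b = b := by
  cases s <;> rcases body_base_or_cru h with ⟨z, rfl⟩ | ⟨z, v, z', rfl⟩ <;> rfl

theorem closeVar_signedWord (q : ℕ) (y : List A) (r : Term1 A) (s : List (Term1 A × Term1 A)) :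
    ∀ b ∈ signedWord (altHead q y r s) (altTail q s), closeVar b.1 = b.1 := by
  induction s generalizing y r with
  | nil =>
    intro b hb
    simp only [altTail, signedWord, posWord, List.mem_map] at hb
    obtain ⟨c, hc, rfl⟩ := hb
    exact closeVar_altHead hc
  | cons a s ih =>
    intro b hb
    simp only [altTail, signedWord, posWord, negWord_eq_map, List.mem_append, List.mem_map,
      List.mem_reverse] at hb
    rcases hb with ⟨c, hc, rfl⟩ | ⟨c, hc, rfl⟩ | hb
    · exact closeVar_altHead hc
    · rcases body_base_or_cru hc with ⟨z, rfl⟩ | ⟨z, v, z', rfl⟩ <;> rfl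
    · exact ih _ _ b hb

/-- The value of a term in the free group, as an alternating product. -/
theorem map_closeVar_outline (q : ℕ) (α : Term2 A) (ht : α.tail ≠ [])
    (hs : ∀ a ∈ α.tail, HasRankOne a.1) :
    FreeGroup.map closeVar (FreeGroup.mk (α.outline q).toWord) =
      FreeGroup.mk (signedWord (altHead q [] α.head α.tail) (altTail q α.tail)) := by
  have h := eval_outline q [] α.head α.tail hs
  have h' : α.outline q = (outline1 q α.head).mul (tailOutline q α.tail) := rfl
  have hc := closeVar_signedWord q [] α.head α.tail
  rw [← h] at hc ⊢
  rw [h']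
  obtain ⟨u, x, w, y, v, hw⟩ : ∃ u x w y v,
      (outline1 q α.head).mul (tailOutline q α.tail) = .inf u x w y v := by
    obtain ⟨a, s, has⟩ := List.exists_cons_of_ne_nil ht
    obtain ⟨w, h1, -⟩ := (hs a (by simp [has])).outline1_eq q
    have h2 : tailOutline q α.tail = (outline1 q a.1).limit.mul
        ((outline1 q a.2).mul (tailOutline q s)) := by
      simp [has, tailOutline, Outline.mul_assoc]
    rw [h2, h1, Outline.limit]
    cases outline1 q α.head <;> cases (outline1 q a.2).mul (tailOutline q s) <;>
      exact ⟨_, _, _, _, _, rfl⟩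
  rw [hw] at hc ⊢
  have hm : w.map (fun b => (closeVar b.1, b.2)) = w := by
    conv_rhs => rw [← List.map_id w]
    refine List.map_congr_left fun b hb => ?_
    rw [hc b (by simp [Outline.eval, hb])]; rfl
  simp only [Outline.toWord, FreeGroup.map.mk, Outline.eval, List.map_cons, List.map_append,
    List.map_nil, hm]
  rfl

end KappaLG

namespace KappaLG

variable {A : Type*}

/-! ### Values in the free group -/

/-- The value in the free group of the word between two limit terms. -/
def gBodyAux (q : ℕ) : List A → List A → Term1 A → List A → FreeGroup (Var A)
  | y, v, [], x => FreeGroup.of (Var.cru y v x)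
  | y, v, Atom.letter a :: t, x => gBodyAux q y (v ++ [a]) t x
  | y, v, Atom.pow z p :: t, x =>
      FreeGroup.of (Var.cru y v z) * (FreeGroup.of (Var.base z) ^ ((q : ℤ) + p) * gBodyAux q z [] t x)

/-- The value in the free group of the word between two limit terms. -/
def gBody (q : ℕ) (y : List A) (t : Term1 A) (x : List A) : FreeGroup (Var A) :=
  gBodyAux q y [] t x

theorem gBodyAux_eq (q : ℕ) (y v : List A) (t : Term1 A) (x : List A) :
    gBodyAux q y v t x = gBody q y (word v ++ t) x := by
  have : ∀ v w, gBodyAux q y w (word v ++ t) x = gBodyAux q y (w ++ v) t x := by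
    intro v
    induction v with
    | nil => simp
    | cons a v ih => intro w; simp [gBodyAux, ih]
  rw [gBody, this]; rfl

theorem gBody_word (q : ℕ) (y v x : List A) :
    gBody q y (word v) x = FreeGroup.of (Var.cru y v x) := by
  have := gBodyAux_eq q y v [] x
  simp only [List.append_nil] at this
  rw [← this]; rfl

theorem gBody_word_pow (q : ℕ) (y v : List A) (z : List A) (p : ℤ) (t : Term1 A) (x : List A) :
    gBody q y (word v ++ Atom.pow z p :: t) x =
      FreeGroup.of (Var.cru y v z) * (FreeGroup.of (Var.base z) ^ ((q : ℤ) + p) * gBody q z t x) := by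
  rw [← gBodyAux_eq]; rfl

theorem gBody_append_pow (q : ℕ) (y : List A) (s : Term1 A) (z : List A) (p : ℤ) (t : Term1 A)
    (x : List A) :
    gBody q y (s ++ Atom.pow z p :: t) x =
      gBody q y s z * (FreeGroup.of (Var.base z) ^ ((q : ℤ) + p) * gBody q z t x) := by
  induction s using term_induction generalizing y with
  | hw v => rw [gBody_word_pow, gBody_word]
  | hp v z' p' s ih =>
    rw [List.append_assoc, List.cons_append, gBody_word_pow, gBody_word_pow, ih]
    group

/-- `gBody` allows arbitrary integer powers, so identities between values hold without any condition
on exponents. Positivity is needed only here, on return to positive words. -/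
theorem gBody_eq_mk {q : ℕ} {y : List A} {t : Term1 A} {x : List A} (ht : ExpPos q t) :
    gBody q y t x = FreeGroup.mk (posWord (body q y t x)) := by
  induction t using term_induction generalizing y with
  | hw v => rw [gBody_word, body_word]; rfl
  | hp v z p t ih =>
    simp only [expPos_append, expPos_cons_pow] at ht
    have h1 : ∀ n : ℕ, FreeGroup.of (Var.base z) ^ n =
        FreeGroup.mk (posWord (List.replicate n (Var.base z))) := by
      intro n
      induction n with
      | zero => rfl
      | succ n ih => rw [pow_succ', ih]; rfl
    rw [gBody_word_pow, body_word_pow, ih ht.2.2, ← Int.toNat_of_nonneg ht.2.1.le, zpow_natCast, h1,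
      Int.toNat_natCast]
    rw [FreeGroup.of, FreeGroup.mul_mk, FreeGroup.mul_mk]
    simp [posWord]

/-- The value in the free group of a term, preceded by a limit term of base `y`. -/
def gValue (q : ℕ) : List A → Term1 A → List (Term1 A × Term1 A) → FreeGroup (Var A)
  | y, r, [] => gBody q y r []
  | y, r, s :: t => gBody q y (r ++ word (iniWord s.1)) (iniBase s.1) *
      ((gBody q (finBase s.1) (word (finWord s.1) ++ (s.1 ++ word (iniWord s.1))) (iniBase s.1))⁻¹ *
        gValue q (finBase s.1) (word (finWord s.1) ++ s.2) t)

theorem gValue_append_pow (q : ℕ) (y : List A) (r₁ : Term1 A) (z : List A) (p : ℤ) (r₂ : Term1 A)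
    (s : List (Term1 A × Term1 A)) :
    gValue q y (r₁ ++ Atom.pow z p :: r₂) s =
      gBody q y r₁ z * (FreeGroup.of (Var.base z) ^ ((q : ℤ) + p) * gValue q z r₂ s) := by
  cases s with
  | nil => exact gBody_append_pow ..
  | cons a s =>
    simp only [gValue, List.append_assoc, List.cons_append]
    rw [gBody_append_pow]
    group

theorem gValue_eq_mk {q : ℕ} {y : List A} {r : Term1 A} {s : List (Term1 A × Term1 A)}
    (hr : ExpPos q r) (hs : ∀ a ∈ s, ExpPos q a.1 ∧ ExpPos q a.2) :
    gValue q y r s = FreeGroup.mk (signedWord (altHead q y r s) (altTail q s)) := by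
  induction s generalizing y r with
  | nil => exact gBody_eq_mk hr
  | cons a s ih =>
    have ha := hs a (by simp)
    rw [gValue, ih (by simp [ha.2]) fun b hb => hs b (by simp [hb]), gBody_eq_mk (by simp [hr]),
      gBody_eq_mk (by simp [ha.1])]
    simp only [altHead, altTail, signedWord, ← FreeGroup.mul_mk, mk_negWord, baseWord]

/-- The factor `k` is the value from the first limit term of the base up to `z`. It does not depend
on what precedes the base, so it can be cancelled against the same part of an inverse factor. -/
theorem exists_gBody_ini (q : ℕ) (l : Term1 A) (z : List A) (p : ℤ) (r : Term1 A) :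
    ∃ k, ∀ y t, gBody q y (t ++ l) z =
      gBody q y (t ++ word (iniWord (l ++ Atom.pow z p :: r))) (iniBase (l ++ Atom.pow z p :: r)) * k := by
  rcases word_or_pow l with ⟨v, rfl⟩ | ⟨v, x, p', l, rfl⟩
  · exact ⟨1, fun y t => by simp⟩
  · refine ⟨FreeGroup.of (Var.base x) ^ ((q : ℤ) + p') * gBody q x l z, fun y t => ?_⟩
    rw [← List.append_assoc, gBody_append_pow, List.append_assoc, List.cons_append,
      iniWord_word_pow, iniBase_word_pow]

theorem exists_gBody_fin (q : ℕ) (z : List A) (r : Term1 A) :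
    ∃ k, (∀ t x, gBody q z (r ++ t) x = k * gBody q (finState (z, []) r).1
        (word (finState (z, []) r).2 ++ t) x) ∧
      ∀ t s, gValue q z (r ++ t) s = k * gValue q (finState (z, []) r).1
        (word (finState (z, []) r).2 ++ t) s := by
  rcases word_or_pow_last r with ⟨v, rfl⟩ | ⟨v, y, p, r, rfl⟩
  · exact ⟨1, by simp [finState_word], by simp [finState_word]⟩
  · refine ⟨gBody q z r y * FreeGroup.of (Var.base y) ^ ((q : ℤ) + p), fun t x => ?_, fun t s => ?_⟩
    · rw [finState_pow_word, List.append_assoc, List.cons_append, gBody_append_pow]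
      group
    · rw [finState_pow_word, List.append_assoc, List.cons_append, gValue_append_pow]
      group

/-- The value may be computed from any limit term of rank one in the first base. -/
theorem gValue_cons (q : ℕ) (y : List A) (r l : Term1 A) (z : List A) (p : ℤ) (r' ρ : Term1 A)
    (s : List (Term1 A × Term1 A)) :
    gValue q y r ((l ++ Atom.pow z p :: r', ρ) :: s) =
      gBody q y (r ++ l) z * ((gBody q z (r' ++ l) z)⁻¹ * (FreeGroup.of (Var.base z) ^ (-((q : ℤ) + p)) *
        ((gBody q z (r' ++ l) z)⁻¹ * gValue q z (r' ++ ρ) s))) := by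
  -- With `k` leading from the first limit term of the base to `z`, and `k'` from `z` to the last
  -- one, the loop at `z` through the end and the beginning of the base is $k'ck$. Moving the
  -- reference point from the extreme limit terms to `z` only cancels `k` and `k'`.
  obtain ⟨k, hk⟩ := exists_gBody_ini q l z p r'
  obtain ⟨k', hk1, hk2⟩ := exists_gBody_fin q z r'
  have hf : ∀ s, finState s (l ++ Atom.pow z p :: r') = finState (z, []) r' :=
    fun s => finState_pow s l z p r'
  have h1 : gBody q z (r' ++ l) z = k' * (gBody q (finState (z, []) r').1
      (word (finState (z, []) r').2 ++ word (iniWord (l ++ Atom.pow z p :: r')))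
      (iniBase (l ++ Atom.pow z p :: r')) * k) := by
    rw [hk1, hk]
  have h2 : gBody q z (r' ++ word (iniWord (l ++ Atom.pow z p :: r')))
      (iniBase (l ++ Atom.pow z p :: r')) = k' * (gBody q (finState (z, []) r').1
      (word (finState (z, []) r').2 ++ word (iniWord (l ++ Atom.pow z p :: r')))
      (iniBase (l ++ Atom.pow z p :: r'))) := by
    rw [hk1]
  rw [gValue, hk y r, hk2, h1]
  simp only [finBase, finWord, hf]
  rw [List.append_assoc, List.cons_append, ← List.append_assoc, gBody_append_pow, h2, hk]
  group

theorem exists_gValue_context (q : ℕ) (y : List A) (r π : Term1 A) :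
    ∃ k, ∀ ρ s, gValue q y r ((π, ρ) :: s) =
      k * gValue q (finBase π) (word (finWord π) ++ ρ) s :=
  ⟨gBody q y (r ++ word (iniWord π)) (iniBase π) * (gBody q (finBase π)
    (word (finWord π) ++ (π ++ word (iniWord π))) (iniBase π))⁻¹, fun _ _ => by
      rw [mul_assoc]; rfl⟩

/-- All bases of rank two have rank one. -/
def BaseRank (α : Term2 A) : Prop := ∀ s ∈ α.tail, HasRankOne s.1

/-- The terms have the same value in the free group in every context. -/
def GEq (δ ε : Term2 A) : Prop :=
  ∀ q y v s, gValue q y (v ++ δ.head) (δ.tail ++ s) = gValue q y (v ++ ε.head) (ε.tail ++ s)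

theorem HasRankOne.exists_eq {t : Term1 A} (h : HasRankOne t) :
    ∃ l z p r, t = l ++ Atom.pow z p :: r := by
  obtain ⟨p, r, h⟩ := h.exists_ini
  exact ⟨_, _, p, r, h⟩

@[simp] theorem hasRankOne_append {s t : Term1 A} :
    HasRankOne (s ++ t) ↔ HasRankOne s ∨ HasRankOne t := by
  simp only [HasRankOne, List.mem_append, exists_or]

@[simp] theorem hasRankOne_pow_cons (x : List A) (p : ℤ) (t : Term1 A) :
    HasRankOne (Atom.pow x p :: t) := ⟨x, p, by simp⟩

/-- Both values are expanded at one limit term of $xy$. If it lies in $y$, the two expansions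
coincide; if it lies in $x$, the extra passage through it gained on the left of the inverse cancels
against the one lost on the right. -/
theorem gEq_shift (r x y s : Term1 A) (h : HasRankOne (x ++ y)) :
    GEq ⟨r, [(x ++ y, x ++ s)]⟩ ⟨r ++ x, [(y ++ x, s)]⟩ := by
  intro q b v t
  simp only [List.cons_append, List.nil_append]
  rcases hasRankOne_append.1 h with h | h
  · obtain ⟨l, z, p, m, rfl⟩ := h.exists_eq
    rw [List.append_assoc l, List.cons_append, gValue_cons, ← List.append_assoc y, gValue_cons]
    have h1 : v ++ (r ++ (l ++ Atom.pow z p :: m)) ++ (y ++ l) =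
        (v ++ r ++ l) ++ Atom.pow z p :: (m ++ y ++ l) := by simp
    have h2 : m ++ y ++ (l ++ Atom.pow z p :: m ++ s) =
        (m ++ y ++ l) ++ Atom.pow z p :: (m ++ s) := by simp
    have h3 : m ++ (y ++ l) = m ++ y ++ l := by simp
    rw [h1, h2, h3, gBody_append_pow, gValue_append_pow]
    group
  · obtain ⟨l, z, p, m, rfl⟩ := h.exists_eq
    rw [← List.append_assoc x, gValue_cons, List.append_assoc l, List.cons_append, gValue_cons]
    have h1 : v ++ r ++ (x ++ l) = v ++ (r ++ x) ++ l := by simp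
    have h2 : m ++ (x ++ l) = m ++ x ++ l := by simp
    have h3 : m ++ (x ++ s) = m ++ x ++ s := by simp
    rw [h1, h2, h3]

theorem InContext.gEq {R : Term2 A → Term2 A → Prop}
    (hR : ∀ δ ε, R δ ε → BaseRank δ → GEq δ ε) {α β : Term2 A} (h : InContext R α β)
    (hα : BaseRank α) : GEq α β := by
  induction h with
  | here r r₁ s s₁ rest h =>
    intro q y v t
    have := hR _ _ h (fun a ha => hα a (by simp at ha; simp [ha])) q y v (rest ++ t)
    simpa using this
  | skip ρ π r r₁ s s₁ h ih =>
    intro q y v t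
    have := ih (fun a ha => hα a (by simp at ha; simp [ha])) q (finBase π) (word (finWord π)) t
    simp only [List.cons_append, gValue]
    rw [this]

/-- The relation of terms with the same shape, `2`-expansion and values that is generated by
rank two shifts. -/
structure ShiftInv (δ ε : Term2 A) : Prop where
  rank : BaseRank δ ↔ BaseRank ε
  gEq : BaseRank δ → GEq δ ε
  expansion : δ.twoExpansion = ε.twoExpansion
  length : δ.tail.length = ε.tail.length

theorem ShiftRule.inv {δ ε : Term2 A} (h : ShiftRule δ ε) : ShiftInv δ ε := by
  obtain ⟨r, x, y, s, hx, hy⟩ := h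
  refine ⟨?_, fun h => gEq_shift _ _ _ _ (h (x ++ y, x ++ s) (by simp)), by simp [Term2.twoExpansion], rfl⟩
  simp [BaseRank, or_comm]

theorem inContext_shiftInv {α β : Term2 A} (h : InContext ShiftRule α β) : ShiftInv α β := by
  have hg := fun hα => h.gEq (fun _ _ h => h.inv.gEq) hα
  refine ⟨?_, hg, ?_, ?_⟩
  · clear hg
    induction h with
    | here r r₁ s s₁ rest h =>
      have := h.inv.rank
      simp only [BaseRank, List.mem_append, or_imp, forall_and] at this ⊢
      rw [this]
    | skip ρ π r r₁ s s₁ h ih =>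
      simp only [BaseRank, List.mem_cons, forall_eq_or_imp] at ih ⊢
      rw [ih]
  · clear hg
    induction h with
    | here r r₁ s s₁ rest h =>
      have := h.inv.expansion
      simp only [Term2.twoExpansion, List.map_append, List.flatten_append] at this ⊢
      rw [← List.append_assoc, this, List.append_assoc]
    | skip ρ π r r₁ s s₁ h ih =>
      simp only [Term2.twoExpansion, List.map_cons, List.flatten_cons, List.append_assoc] at ih ⊢
      rw [ih]
  · clear hg
    induction h with
    | here r r₁ s s₁ rest h => simpa using h.inv.length
    | skip ρ π r r₁ s s₁ h ih => simpa using ih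

theorem ShiftInv.refl (δ : Term2 A) : ShiftInv δ δ :=
  ⟨Iff.rfl, fun _ _ _ _ _ => rfl, rfl, rfl⟩

theorem ShiftInv.symm {δ ε : Term2 A} (h : ShiftInv δ ε) : ShiftInv ε δ :=
  ⟨h.rank.symm, fun h' q y v s => (h.gEq (h.rank.2 h') q y v s).symm, h.expansion.symm,
    h.length.symm⟩

theorem ShiftInv.trans {δ ε ζ : Term2 A} (h : ShiftInv δ ε) (h' : ShiftInv ε ζ) : ShiftInv δ ζ :=
  ⟨h.rank.trans h'.rank, fun hd q y v s => (h.gEq hd q y v s).trans (h'.gEq (h.rank.1 hd) q y v s),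
    h.expansion.trans h'.expansion, h.length.trans h'.length⟩

theorem shiftEquiv_inv {δ ε : Term2 A} (h : ShiftEquiv δ ε) : ShiftInv δ ε := by
  induction h with
  | rel _ _ h => exact inContext_shiftInv h
  | refl => exact ShiftInv.refl _
  | symm _ _ _ ih => exact ih.symm
  | trans _ _ _ _ _ ih ih' => exact ih.trans ih'

theorem reflTransGen_shiftRight_inv {δ ε : Term2 A} (h : Relation.ReflTransGen ShiftRight δ ε) :
    ShiftInv δ ε := by
  induction h with
  | refl => exact ShiftInv.refl _
  | tail _ h ih => exact ih.trans (inContext_shiftInv h)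

/-! ### Values under the rules -/

/-- Expanded at $x$, the inverse factor is $g^{-1}\mathsf b_x^{-(n+q)}g^{-1}$, where $g$ reads $w_1$
between two limit terms with base $x$. Both copies of $g^{-1}$ meet a copy of $g$, and the powers of
$\mathsf b_x$ add up. -/
theorem gEq_elimination (w₀ w₁ w₂ : Term1 A) (x : List A) (p q r : ℤ) :
    GEq ⟨w₀ ++ Atom.pow x p :: w₁, [(Atom.pow x q :: w₁, Atom.pow x r :: w₂)]⟩
      ⟨w₀ ++ Atom.pow x (p - q + r) :: w₂, []⟩ := by
  intro n y v s
  have h := gValue_cons n y (v ++ (w₀ ++ Atom.pow x p :: w₁)) [] x q w₁ (Atom.pow x r :: w₂) s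
  simp only [List.nil_append, List.append_nil] at h
  simp only [List.cons_append, List.nil_append]
  rw [h, ← List.append_assoc, gBody_append_pow, gValue_append_pow, ← List.append_assoc,
    gValue_append_pow]
  group

theorem gEq_agglutination_inner (w₀ w₁ w₂ w₃ : Term1 A) (x : List A) (p q r : ℤ) :
    GEq ⟨w₀, [(Atom.pow x p :: w₁, [Atom.pow x q]), (w₂ ++ [Atom.pow x r], w₃)]⟩
      ⟨w₀, [(Atom.pow x 0 :: w₂ ++ Atom.pow x (p - q + r) :: w₁, Atom.pow x 0 :: w₃)]⟩ := by
  intro n y v s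
  have h1 := gValue_cons n y (v ++ w₀) [] x p w₁ [Atom.pow x q] ((w₂ ++ [Atom.pow x r], w₃) :: s)
  have h2 := gValue_cons n x [] w₂ x r [] w₃ s
  have h3 := gValue_cons n y (v ++ w₀) [] x 0 (w₂ ++ Atom.pow x (p - q + r) :: w₁)
    (Atom.pow x 0 :: w₃) s
  simp only [List.nil_append, List.append_nil] at h1 h2 h3
  simp only [List.cons_append, List.nil_append]
  rw [h1, h3, gValue_append_pow, h2, gValue_append_pow, gBody_append_pow]
  group

theorem gEq_agglutination_initial (w₀ w₁ w₂ w₃ : Term1 A) (u x : List A) (p q : ℤ) :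
    GEq ⟨w₀, [(word u ++ Atom.pow x p :: w₁, []), (word u ++ Atom.pow x q :: w₂, w₃)]⟩
      ⟨w₀, [((word u ++ Atom.pow x q :: w₂) ++ (word u ++ Atom.pow x q :: w₂)
            ++ (word u ++ Atom.pow x p :: w₁), (word u ++ Atom.pow x q :: w₂) ++ w₃)]⟩ := by
  intro n y v s
  have h1 := gValue_cons n y (v ++ w₀) (word u) x p w₁ [] ((word u ++ Atom.pow x q :: w₂, w₃) :: s)
  have h2 := gValue_cons n x w₁ (word u) x q w₂ w₃ s
  have h3 := gValue_cons n y (v ++ w₀) (word u) x q ((w₂ ++ word u) ++ Atom.pow x q ::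
    ((w₂ ++ word u) ++ Atom.pow x p :: w₁)) ((word u ++ Atom.pow x q :: w₂) ++ w₃) s
  have e1 : (word u ++ Atom.pow x q :: w₂) ++ (word u ++ Atom.pow x q :: w₂)
      ++ (word u ++ Atom.pow x p :: w₁) = word u ++ Atom.pow x q :: ((w₂ ++ word u) ++
      Atom.pow x q :: ((w₂ ++ word u) ++ Atom.pow x p :: w₁)) := by simp
  have e2 : ((w₂ ++ word u) ++ Atom.pow x q :: ((w₂ ++ word u) ++ Atom.pow x p :: w₁)) ++ word u =
      (w₂ ++ word u) ++ Atom.pow x q :: ((w₂ ++ word u) ++ Atom.pow x p :: (w₁ ++ word u)) := by simp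
  have e3 : ((w₂ ++ word u) ++ Atom.pow x q :: ((w₂ ++ word u) ++ Atom.pow x p :: w₁)) ++
      ((word u ++ Atom.pow x q :: w₂) ++ w₃) =
      (w₂ ++ word u) ++ Atom.pow x q :: ((w₂ ++ word u) ++ Atom.pow x p :: ((w₁ ++ word u) ++
        Atom.pow x q :: (w₂ ++ w₃))) := by simp
  simp only [List.append_nil] at h1
  simp only [List.cons_append, List.nil_append]
  rw [h1, h2, e1, h3, e2, e3]
  simp only [gValue_append_pow, gBody_append_pow]
  group

theorem gEq_agglutination_final (w₀ w₁ w₂ w₃ : Term1 A) (u x : List A) (p q : ℤ) :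
    GEq ⟨w₀, [(w₁ ++ Atom.pow x p :: word u, []), (w₂ ++ Atom.pow x q :: word u, w₃)]⟩
      ⟨w₀ ++ (w₁ ++ Atom.pow x p :: word u), [((w₂ ++ Atom.pow x q :: word u)
            ++ (w₁ ++ Atom.pow x p :: word u) ++ (w₁ ++ Atom.pow x p :: word u), w₃)]⟩ := by
  intro n y v s
  have h1 := gValue_cons n y (v ++ w₀) w₁ x p (word u) []
    ((w₂ ++ Atom.pow x q :: word u, w₃) :: s)
  have h2 := gValue_cons n x (word u) w₂ x q (word u) w₃ s
  have h3 := gValue_cons n y (v ++ (w₀ ++ (w₁ ++ Atom.pow x p :: word u))) w₂ x q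
    ((word u ++ w₁) ++ Atom.pow x p :: ((word u ++ w₁) ++ Atom.pow x p :: word u)) w₃ s
  have e1 : (w₂ ++ Atom.pow x q :: word u)
      ++ (w₁ ++ Atom.pow x p :: word u) ++ (w₁ ++ Atom.pow x p :: word u) = w₂ ++ Atom.pow x q ::
      ((word u ++ w₁) ++ Atom.pow x p :: ((word u ++ w₁) ++ Atom.pow x p :: word u)) := by simp
  have e2 : ((word u ++ w₁) ++ Atom.pow x p :: ((word u ++ w₁) ++ Atom.pow x p :: word u)) ++ w₂ =
      (word u ++ w₁) ++ Atom.pow x p :: ((word u ++ w₁) ++ Atom.pow x p :: (word u ++ w₂)) := by simp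
  have e3 : ((word u ++ w₁) ++ Atom.pow x p :: ((word u ++ w₁) ++ Atom.pow x p :: word u)) ++ w₃ =
      (word u ++ w₁) ++ Atom.pow x p :: ((word u ++ w₁) ++ Atom.pow x p :: (word u ++ w₃)) := by simp
  have e4 : v ++ (w₀ ++ (w₁ ++ Atom.pow x p :: word u)) ++ w₂ =
      (v ++ w₀ ++ w₁) ++ Atom.pow x p :: (word u ++ w₂) := by simp
  simp only [List.append_nil] at h1
  simp only [List.cons_append, List.nil_append]
  rw [h1, h2, e1, h3, e2, e3, e4]
  simp only [gValue_append_pow, gBody_append_pow]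
  group

theorem Step1.gEq {α β : Term2 A} (h : Step1 α β) (hα : BaseRank α) : GEq α β := by
  refine InContext.gEq ?_ h hα
  rintro δ ε (h | h) hδ q y v s
  · obtain ⟨w₀, w₁, w₂, x, p, q, r, h⟩ := h
    rw [(shiftEquiv_inv h).gEq hδ, gEq_elimination]
  · obtain ⟨w₀, w₁, w₂, w₃, x, p, q, r, h⟩ | ⟨w₀, w₁, w₂, w₃, u, x, p, q, h⟩ |
      ⟨w₀, w₁, w₂, w₃, u, x, p, q, h⟩ := h
    · rw [(shiftEquiv_inv h).gEq hδ, gEq_agglutination_inner]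
    · rw [(shiftEquiv_inv h).gEq hδ, gEq_agglutination_initial]
    · rw [(shiftEquiv_inv h).gEq hδ, gEq_agglutination_final]

theorem gEq_shift_npow (r x y s : Term1 A) (h : HasRankOne (x ++ y)) (k : ℕ) :
    GEq ⟨r, [(x ++ y, npow (x ++ y) k ++ (x ++ s))]⟩
      ⟨r ++ (npow (x ++ y) k ++ x), [(y ++ x, s)]⟩ := by
  induction k generalizing r with
  | zero => simpa [npow] using gEq_shift r x y s h
  | succ k ih =>
    intro q b v t
    have h1 := gEq_shift r (x ++ y) [] (npow (x ++ y) k ++ (x ++ s)) (by simpa using h) q b v t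
    have h2 := ih (r ++ (x ++ y)) q b v t
    have h3 : npow (x ++ y) (k + 1) = (x ++ y) ++ npow (x ++ y) k := by
      simp [npow, List.replicate_succ]
    simp only [List.append_nil, List.nil_append] at h1
    rw [h3, List.append_assoc, h1, h2]
    simp

theorem gEq_expansion (q : ℕ) (y : List A) (r t π : Term1 A) (h : HasRankOne π)
    (s : List (Term1 A × Term1 A)) :
    gValue q y (r ++ π) ((π ++ π, t) :: s) = gValue q y r ((π, t) :: s) := by
  obtain ⟨l, z, p, m, rfl⟩ := h.exists_eq
  have e1 : (l ++ Atom.pow z p :: m) ++ (l ++ Atom.pow z p :: m) =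
      l ++ Atom.pow z p :: ((m ++ l) ++ Atom.pow z p :: m) := by simp
  have e2 : r ++ (l ++ Atom.pow z p :: m) ++ l = (r ++ l) ++ Atom.pow z p :: (m ++ l) := by simp
  have e3 : ((m ++ l) ++ Atom.pow z p :: m) ++ l = (m ++ l) ++ Atom.pow z p :: (m ++ l) := by simp
  have e4 : ((m ++ l) ++ Atom.pow z p :: m) ++ t = (m ++ l) ++ Atom.pow z p :: (m ++ t) := by simp
  rw [e1, gValue_cons, gValue_cons, e2, e3, e4]
  simp only [gBody_append_pow, gValue_append_pow]
  group

theorem Step2.gEq {α β : Term2 A} (h : Step2 α β) (hα : BaseRank α) : GEq α β := by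
  refine InContext.gEq ?_ h hα
  rintro δ ε (⟨δ, ε, h⟩ | ⟨r, x, y, s, τ, t, u, k, hu, h⟩) hδ
  · exact h.inv.gEq hδ
  · intro q b v w
    have h1 : HasRankOne (x ++ y) := hδ (x ++ y, s) (by simp)
    have h2 : HasRankOne (word u ++ τ) := hδ (word u ++ τ, t) (by simp)
    have h3 := gEq_shift_npow r x y τ h1 k q b v (((word u ++ τ) ++ (word u ++ τ), t) :: w)
    rw [← List.append_assoc (npow (x ++ y) k), ← h] at h3
    simp only [List.cons_append, List.nil_append] at h3 ⊢
    rw [List.append_assoc r s, ← h3]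
    obtain ⟨K, hK⟩ := exists_gValue_context q b (v ++ r) (x ++ y)
    rw [hK, hK, ← gEq_expansion _ _ _ _ _ h2]
    simp

/-- Equal $\omega$-portions make the crucial variables at the ends of $\sigma$ and $\tau$ agree, so
that everything read inside $\sigma$ cancels. The long base is expanded at the first limit term of
its factor $\sigma$, the short one at that of $\tau$. -/
theorem gEq_shortening1 {σ τ : Term1 A} (w s : Term1 A) (h : SameOmegaPortions σ τ) :
    GEq ⟨w ++ σ, [(τ ++ σ, s)]⟩ ⟨w, [(τ, s)]⟩ := by
  obtain ⟨u, x, y, v, ⟨p, R, hσ⟩, ⟨p', R', hτ⟩, ⟨_, L, hσ'⟩, ⟨_, L', hτ'⟩⟩ := h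
  intro q b c t
  have hf : finState (x, []) R = (y, v) := by
    rw [← finState_pow ([], []) (word u) x p R, ← hσ, hσ', finState_pow_word]
  have hf' : finState (x, []) R' = (y, v) := by
    rw [← finState_pow ([], []) (word u) x p' R', ← hτ, hτ', finState_pow_word]
  obtain ⟨k, hk1, hk2⟩ := exists_gBody_fin q x R
  obtain ⟨k', hk1', hk2'⟩ := exists_gBody_fin q x R'
  rw [hf] at hk1 hk2
  rw [hf'] at hk1' hk2'
  clear hσ' hτ'
  subst hσ hτ
  have h1 := gValue_cons q b (c ++ (w ++ (word u ++ Atom.pow x p :: R)))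
    ((word u ++ Atom.pow x p' :: R') ++ word u) x p R s t
  have h2 := gValue_cons q b (c ++ w) (word u) x p' R' s t
  have e1 : (word u ++ Atom.pow x p' :: R') ++ word u ++ Atom.pow x p :: R =
    (word u ++ Atom.pow x p' :: R') ++ (word u ++ Atom.pow x p :: R) := by simp
  have e2 : (c ++ (w ++ (word u ++ Atom.pow x p :: R))) ++
      ((word u ++ Atom.pow x p' :: R') ++ word u) =
      (c ++ w ++ word u) ++ Atom.pow x p :: ((R ++ word u) ++ Atom.pow x p' :: (R' ++ word u)) := by
    simp
  have e3 : R ++ ((word u ++ Atom.pow x p' :: R') ++ word u) =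
      (R ++ word u) ++ Atom.pow x p' :: (R' ++ word u) := by simp
  rw [e1, e2, e3] at h1
  simp only [List.cons_append, List.nil_append] at h1 h2 ⊢
  rw [h1, h2]
  simp only [gBody_append_pow]
  rw [hk1, hk1', hk2, hk2']
  group

theorem gEq_shortening2_left (w₀ w₁ w₂ w₃ : Term1 A) (x : List A) (p₁ p₂ q₁ q₂ : ℤ)
    (hq : q₂ - q₁ = 0) :
    GEq ⟨w₀ ++ Atom.pow x p₁ :: w₁,
        [(Atom.pow x q₁ :: w₂ ++ Atom.pow x p₂ :: w₁, Atom.pow x q₂ :: w₃)]⟩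
      ⟨w₀ ++ [Atom.pow x (p₁ - p₂)], [(w₂ ++ [Atom.pow x 0], w₃)]⟩ := by
  obtain rfl : q₂ = q₁ := by omega
  intro n y v s
  have h1 := gValue_cons n y (v ++ (w₀ ++ Atom.pow x p₁ :: w₁)) [] x q₂ (w₂ ++ Atom.pow x p₂ :: w₁)
    (Atom.pow x q₂ :: w₃) s
  have h2 := gValue_cons n y (v ++ (w₀ ++ [Atom.pow x (p₁ - p₂)])) w₂ x 0 [] w₃ s
  have e1 : v ++ (w₀ ++ Atom.pow x p₁ :: w₁) = (v ++ w₀) ++ Atom.pow x p₁ :: w₁ := by simp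
  have e2 : v ++ (w₀ ++ [Atom.pow x (p₁ - p₂)]) ++ w₂ =
    (v ++ w₀) ++ Atom.pow x (p₁ - p₂) :: w₂ := by simp
  simp only [List.cons_append, List.nil_append, List.append_nil] at h1 h2 ⊢
  rw [h1, h2, e1, e2]
  simp only [gBody_append_pow, gValue_append_pow]
  group

theorem gEq_shortening2_right (w₀ w₁ w₂ w₃ : Term1 A) (x : List A) (p₁ p₂ q₁ q₂ : ℤ)
    (hp : p₁ - p₂ = 0) :
    GEq ⟨w₀ ++ Atom.pow x p₁ :: w₁,
        [(Atom.pow x q₁ :: w₂ ++ Atom.pow x p₂ :: w₁, Atom.pow x q₂ :: w₃)]⟩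
      ⟨w₀, [(Atom.pow x 0 :: w₂, Atom.pow x (q₂ - q₁) :: w₃)]⟩ := by
  obtain rfl : p₁ = p₂ := by omega
  intro n y v s
  have h1 := gValue_cons n y (v ++ (w₀ ++ Atom.pow x p₁ :: w₁)) [] x q₁ (w₂ ++ Atom.pow x p₁ :: w₁)
    (Atom.pow x q₂ :: w₃) s
  have h2 := gValue_cons n y (v ++ w₀) [] x 0 w₂ (Atom.pow x (q₂ - q₁) :: w₃) s
  have e1 : v ++ (w₀ ++ Atom.pow x p₁ :: w₁) = (v ++ w₀) ++ Atom.pow x p₁ :: w₁ := by simp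
  simp only [List.cons_append, List.nil_append, List.append_nil] at h1 h2 ⊢
  rw [h1, h2, e1]
  simp only [gBody_append_pow, gValue_append_pow]
  group

/-- The value depends on the exponents only through $p_1-p_2$ and $q_2-q_1$, and not at all on
$w_1$, which cancels completely. So $w_1$ may be replaced by anything, in particular by $u_{x,z}$.
-/
theorem gEq_shortening2_generic (w₀ w₁ w₁' w₂ w₃ : Term1 A) (x z : List A) (p₁ p₂ q₁ q₂ : ℤ) :
    GEq ⟨w₀ ++ Atom.pow x p₁ :: w₁,
        [(Atom.pow z q₁ :: w₂ ++ Atom.pow x p₂ :: w₁, Atom.pow z q₂ :: w₃)]⟩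
      ⟨w₀ ++ Atom.pow x (p₁ - p₂) :: w₁',
        [(Atom.pow z 0 :: w₂ ++ Atom.pow x 0 :: w₁', Atom.pow z (q₂ - q₁) :: w₃)]⟩ := by
  intro n y v s
  have key : ∀ w₁ p₁ p₂ q₁ q₂,
      gValue n y (v ++ (w₀ ++ Atom.pow x p₁ :: w₁)) ([(Atom.pow z q₁ :: w₂ ++
        Atom.pow x p₂ :: w₁, Atom.pow z q₂ :: w₃)] ++ s) =
      gBody n y (v ++ w₀) x * (FreeGroup.of (Var.base x) ^ (p₁ - p₂) * ((gBody n z w₂ x)⁻¹ *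
        (FreeGroup.of (Var.base z) ^ (q₂ - q₁) * gValue n z w₃ s))) := by
    intro w₁ p₁ p₂ q₁ q₂
    have h1 := gValue_cons n y (v ++ (w₀ ++ Atom.pow x p₁ :: w₁)) [] z q₁
      (w₂ ++ Atom.pow x p₂ :: w₁) (Atom.pow z q₂ :: w₃) s
    have e1 : v ++ (w₀ ++ Atom.pow x p₁ :: w₁) = (v ++ w₀) ++ Atom.pow x p₁ :: w₁ := by simp
    simp only [List.cons_append, List.nil_append, List.append_nil] at h1 ⊢
    rw [h1, e1]
    simp only [gBody_append_pow, gValue_append_pow]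
    group
  simp only
  rw [key, key]
  simp

theorem gEq_shortening3_right (r v s : Term1 A) (w x : List A) (p q : ℤ) :
    GEq ⟨r, [(word w ++ Atom.pow x q :: v, word w ++ Atom.pow x p :: s)]⟩
      ⟨r, [(word w ++ Atom.pow x 0 :: v, word w ++ Atom.pow x (p - q) :: s)]⟩ := by
  intro n y c t
  have e1 : ∀ q, v ++ (word w ++ Atom.pow x q :: s) = (v ++ word w) ++ Atom.pow x q :: s := by simp
  simp only [List.cons_append, List.nil_append]
  rw [gValue_cons, gValue_cons, e1, e1, gValue_append_pow, gValue_append_pow]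
  group

theorem gEq_shortening3_left (r v s : Term1 A) (w x : List A) (p q : ℤ) :
    GEq ⟨r ++ Atom.pow x p :: word w, [(v ++ Atom.pow x q :: word w, s)]⟩
      ⟨r ++ Atom.pow x (p - q) :: word w, [(v ++ Atom.pow x 0 :: word w, s)]⟩ := by
  intro n y c t
  have e1 : ∀ q, c ++ (r ++ Atom.pow x q :: word w) ++ v =
    (c ++ r) ++ Atom.pow x q :: (word w ++ v) := by simp
  simp only [List.cons_append, List.nil_append]
  rw [gValue_cons, gValue_cons, e1, e1, gBody_append_pow, gBody_append_pow]
  group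

theorem Step3.gEq [LinearOrder A] {α β : Term2 A} (h : Step3 α β) (hα : BaseRank α) :
    GEq α β := by
  refine InContext.gEq ?_ h hα
  rintro δ ε (⟨w, σ, τ, s, h⟩ | ⟨γ, h, h', -⟩ | (⟨r, v, s, w, x, p, q⟩ | ⟨r, v, s, w, x, p, q⟩)) hδ
  · exact gEq_shortening1 w s h
  · have key : BaseRank γ ∧ GEq δ γ := by
      obtain ⟨w₀, w₁, w₂, w₃, x, p₁, p₂, q₁, q₂, h, hq⟩ |
        ⟨w₀, w₁, w₂, w₃, x, p₁, p₂, q₁, q₂, h, hq, hp⟩ |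
        ⟨w₀, w₁, w₂, w₃, x, z, u, p₁, p₂, q₁, q₂, h, hxz, hu⟩ := h
      · refine ⟨by simp [BaseRank], fun q y v s => ?_⟩
        rw [(shiftEquiv_inv h).gEq hδ, gEq_shortening2_left _ _ _ _ _ _ _ _ _ hq]
      · refine ⟨by simp [BaseRank], fun q y v s => ?_⟩
        rw [(shiftEquiv_inv h).gEq hδ, gEq_shortening2_right _ _ _ _ _ _ _ _ _ hp]
      · refine ⟨by simp [BaseRank], fun q y v s => ?_⟩
        rw [(shiftEquiv_inv h).gEq hδ, gEq_shortening2_generic]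
    intro q y v s
    rw [key.2, (reflTransGen_shiftRight_inv h').gEq key.1]
  · exact gEq_shortening3_right r v s w x p q
  · exact gEq_shortening3_left r v s w x p q

end KappaLG

namespace KappaLG

variable {A : Type*}

/-! ### Canonical forms and junctions -/

/-- All junctions `(y, v, z)`, i.e. factors `y^ω v z^ω`, of a term placed between limit terms of bases
`y` and `x` satisfy `P`. -/
def Junctions (P : List A → List A → List A → Prop) (y : List A) (t : Term1 A) (x : List A) : Prop :=
  ∀ y₁ v z, Var.cru y₁ v z ∈ body 0 y t x → P y₁ v z

section Junctions

variable {P : List A → List A → List A → Prop} {y : List A} {x : List A}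

theorem junctions_word {v : List A} : Junctions P y (word v) x ↔ P y v x := by
  simp only [Junctions, body_word, List.mem_singleton, Var.cru.injEq]
  exact ⟨fun h => h y v x ⟨rfl, rfl, rfl⟩, by rintro h _ _ _ ⟨rfl, rfl, rfl⟩; exact h⟩

/-- Canonicity is local and splits at every limit term. For most rules its preservation then reduces
to the fact that each junction of the result occurs in the source, a purely propositional matter. -/
theorem junctions_append_pow {s : Term1 A} {z : List A} {p : ℤ} {t : Term1 A} :
    Junctions P y (s ++ Atom.pow z p :: t) x ↔ Junctions P y s z ∧ Junctions P z t x := by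
  simp only [Junctions, body_append_pow, List.mem_append, List.mem_replicate, reduceCtorEq,
    and_false, false_or, or_imp, forall_and]

theorem junctions_pow {z : List A} {p : ℤ} {t : Term1 A} :
    Junctions P y (Atom.pow z p :: t) x ↔ Junctions P y [] z ∧ Junctions P z t x :=
  junctions_append_pow (s := [])

theorem junctions_append₂ {a b : Term1 A} {z : List A} {p : ℤ} {t : Term1 A} :
    Junctions P y (a ++ (b ++ Atom.pow z p :: t)) x ↔ Junctions P y (a ++ b) z ∧ Junctions P z t x := by
  rw [← List.append_assoc, junctions_append_pow]

theorem junctions_append₃ {a b c : Term1 A} {z : List A} {p : ℤ} {t : Term1 A} :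
    Junctions P y (a ++ (b ++ (c ++ Atom.pow z p :: t))) x ↔
      Junctions P y (a ++ (b ++ c)) z ∧ Junctions P z t x := by
  rw [← List.append_assoc, junctions_append₂, List.append_assoc]

/-- Only the final $\omega$-portion of `r` interacts with what comes next; the junctions inside `r`
are supplied by `h`. -/
theorem Junctions.fin_transfer {r : Term1 A} {v y' x' : List A} {b b' : Term1 A}
    (hr : finState (y, []) r = (y', v)) (h : Junctions P y (r ++ b) x)
    (h' : Junctions P y' (word v ++ b') x') : Junctions P y (r ++ b') x' := by
  rcases word_or_pow_last r with ⟨w, rfl⟩ | ⟨w, z, p, r, rfl⟩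
  · rw [finState_word] at hr
    simp only [List.nil_append, Prod.mk.injEq] at hr
    rw [hr.1, hr.2]; exact h'
  · rw [finState_pow_word] at hr
    simp only [Prod.mk.injEq] at hr
    obtain ⟨rfl, rfl⟩ := hr
    rw [List.append_assoc, List.cons_append, junctions_append_pow] at h ⊢
    exact ⟨h.1, h'⟩

end Junctions

/-- The condition on a junction in a canonical form, an empty base standing for an end of the term. -/
def GoodJunction (y v z : List A) : Prop :=
  (z ≠ [] → ¬ z <:+ v) ∧ (y ≠ [] → ∀ l, ¬ y <+: v ++ npow z l)

/-- The bases of the limit terms. -/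
def bases (t : Term1 A) : Set (List A) := {x | ∃ p, Atom.pow x p ∈ t}

@[simp] theorem bases_append (s t : Term1 A) : bases (s ++ t) = bases s ∪ bases t := by
  ext x; simp [bases, exists_or]

@[simp] theorem bases_cons_pow (x : List A) (p : ℤ) (t : Term1 A) :
    bases (Atom.pow x p :: t) = insert x (bases t) := by
  ext y; simp [bases, exists_or]

@[simp] theorem bases_word (v : List A) : bases (word v) = ∅ := by
  ext x; simp [bases]

@[simp] theorem bases_nil : bases ([] : Term1 A) = ∅ := by
  ext x; simp [bases]

theorem IsLyndon.ne_nil [LinearOrder A] {x : List A} (h : IsLyndon x) : x ≠ [] := by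
  rintro rfl
  exact h.1 [] 2 (by norm_num) rfl

theorem npow_nil (l : ℕ) : npow ([] : List A) l = [] := by simp [npow]

/-- A reformulation of canonicity in terms of bases and junctions. -/
def Canon [LinearOrder A] (t : Term1 A) : Prop :=
  bases t ⊆ {x | IsLyndon x} ∧ Junctions GoodJunction [] t []

theorem IsCanonical1.canon [LinearOrder A] {t : Term1 A} (h : IsCanonical1 t) : Canon t := by
  refine ⟨fun x ⟨p, hp⟩ => h.lyndon x p hp, fun y v z hc => ?_⟩
  rcases mem_body_cru hc with ⟨rfl, rfl, rfl⟩ | ⟨rfl, p, r, rfl⟩ | ⟨rfl, l, p, rfl⟩ |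
    ⟨l, p, p', r, rfl⟩
  · exact ⟨fun h => absurd rfl h, fun h => absurd rfl h⟩
  · refine ⟨fun _ ⟨a, ha⟩ => h.not_suffix (word a) z p r ?_, fun h => absurd rfl h⟩
    rw [← ha]; simp
  · refine ⟨fun h => absurd rfl h, fun _ n ⟨b, hb⟩ => h.not_prefix l y p (word b) ?_⟩
    rw [npow_nil, List.append_nil] at hb
    rw [← hb]; simp
  · refine ⟨fun _ ⟨a, ha⟩ => h.not_suffix (l ++ Atom.pow y p :: word a) z p' r ?_,
      fun _ n => h.not_prefix_next l y p v z p' r rfl n⟩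
    rw [← ha]; simp

theorem exists_cru_mem_body (q : ℕ) (y : List A) (l : Term1 A) :
    ∃ y₁ v₁, ∀ w x, Var.cru y₁ (v₁ ++ w) x ∈ body q y (l ++ word w) x := by
  rcases word_or_pow_last l with ⟨v, rfl⟩ | ⟨v, z, p, l, rfl⟩
  · exact ⟨y, v, fun w x => by rw [← word_append, body_word]; simp⟩
  · exact ⟨z, v, fun w x => by
      rw [List.append_assoc, List.cons_append, ← word_append, body_append_pow, body_word]; simp⟩

theorem Canon.isCanonical1 [LinearOrder A] {t : Term1 A} (h : Canon t) : IsCanonical1 t := by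
  obtain ⟨h1, h2⟩ := h
  refine ⟨fun x p hp => h1 ⟨p, hp⟩, ?_, ?_, ?_⟩
  · rintro l x p r rfl
    have hx : x ≠ [] := (h1 ⟨p, by simp⟩ : IsLyndon x).ne_nil
    obtain ⟨y₁, v₁, hc⟩ := exists_cru_mem_body 0 [] l
    exact ((junctions_append_pow.1 h2).1 _ _ _ (hc x x)).1 hx ⟨v₁, rfl⟩
  · rintro l x p r rfl
    have hx : x ≠ [] := (h1 ⟨p, by simp⟩ : IsLyndon x).ne_nil
    have h3 := (junctions_append_pow.1 h2).2
    rcases word_or_pow r with ⟨v, rfl⟩ | ⟨v, z, p', r, rfl⟩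
    · rw [← word_append, junctions_word] at h3
      exact h3.2 hx 0 ⟨v, by simp [npow]⟩
    · rw [← List.append_assoc, ← word_append, junctions_append_pow, junctions_word] at h3
      exact h3.1.2 hx 0 ⟨v, by simp [npow]⟩
  · rintro l x p u y p' r rfl n
    have hx : x ≠ [] := (h1 ⟨p, by simp⟩ : IsLyndon x).ne_nil
    have h3 := (junctions_append_pow.1 h2).2
    rw [junctions_append_pow, junctions_word] at h3
    exact h3.1.2 hx n

/-! ### Preservation of semi-canonicity -/

section Canonical

variable [LinearOrder A]

/-- Replacing `s` by `t` preserves canonicity in every context. -/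
def CanonLe (s t : Term1 A) : Prop := ∀ P S : Term1 A, Canon (P ++ (s ++ S)) → Canon (P ++ (t ++ S))

/-- Terms all of whose bases of rank two have rank one and whose `2`-expansion is canonical. -/
def SemiCanon (α : Term2 A) : Prop := BaseRank α ∧ Canon α.twoExpansion

theorem InContext.semiCanon {R : Term2 A → Term2 A → Prop}
    (hR : ∀ δ ε, R δ ε → BaseRank δ → BaseRank ε ∧
      ∀ P S, Canon (P ++ (δ.twoExpansion ++ S)) → Canon (P ++ (ε.twoExpansion ++ S)))
    {α β : Term2 A} (h : InContext R α β) (hα : SemiCanon α) : SemiCanon β := by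
  have key : ∀ α β, InContext R α β → BaseRank α → BaseRank β ∧
      CanonLe α.twoExpansion β.twoExpansion := by
    intro α β h
    induction h with
    | here r r₁ s s₁ rest h =>
      intro hα
      have h1 := hR _ _ h fun a ha => hα a (by simp at ha; simp [ha])
      refine ⟨fun a ha => ?_, fun P S hc => ?_⟩
      · rcases List.mem_append.1 ha with ha | ha
        · exact h1.1 a ha
        · exact hα a (by simp [ha])
      · have := h1.2 P ((rest.map fun s => s.1 ++ s.1 ++ s.2).flatten ++ S)
        simp only [Term2.twoExpansion, List.map_append, List.flatten_append, List.append_assoc] at this hc ⊢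
        exact this hc
    | skip ρ π r r₁ s s₁ h ih =>
      intro hα
      have h1 := ih fun a ha => hα a (by simp at ha; simp [ha])
      refine ⟨fun a ha => ?_, fun P S hc => ?_⟩
      · rcases List.mem_cons.1 ha with rfl | ha
        · exact hα (π, r) (by simp)
        · exact h1.1 a ha
      · have := h1.2 (P ++ (ρ ++ (π ++ π))) S
        simp only [Term2.twoExpansion, List.map_cons, List.flatten_cons, List.append_assoc] at this hc ⊢
        exact this hc
  obtain ⟨h1, h2⟩ := key α β h hα.1
  exact ⟨h1, by simpa using h2 [] [] (by simpa using hα.2)⟩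

/-- The squares in the $2$-expansion contain the junction from the end of a base to its own
beginning. Hence every junction of the new expansion is found in the old one, and shifts do not
alter the expansion at all. -/
theorem Step1.semiCanon {α β : Term2 A} (h : Step1 α β) (hα : SemiCanon α) : SemiCanon β := by
  refine InContext.semiCanon ?_ h hα
  rintro δ ε (h | h) hδ
  · obtain ⟨w₀, w₁, w₂, x, p, q, r, h⟩ := h
    refine ⟨by simp [BaseRank], fun P S => ?_⟩
    rw [(shiftEquiv_inv h).expansion]
    simp only [Term2.twoExpansion, Canon, List.map_cons, List.map_nil, List.flatten_cons,
      List.flatten_nil, List.append_assoc, List.cons_append, List.append_nil,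
      bases_append, bases_cons_pow, Set.union_subset_iff, Set.insert_subset_iff, junctions_append_pow,
      junctions_append₂]
    tauto
  · obtain ⟨w₀, w₁, w₂, w₃, x, p, q, r, h⟩ | ⟨w₀, w₁, w₂, w₃, u, x, p, q, h⟩ |
      ⟨w₀, w₁, w₂, w₃, u, x, p, q, h⟩ := h
    all_goals
      refine ⟨by simp [BaseRank], fun P S => ?_⟩
      rw [(shiftEquiv_inv h).expansion]
      simp only [Term2.twoExpansion, Canon, List.map_cons, List.map_nil, List.flatten_cons,
        List.flatten_nil, List.append_assoc, List.cons_append, List.nil_append, List.append_nil,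
        bases_append, bases_cons_pow, Set.union_subset_iff, Set.insert_subset_iff, junctions_append_pow,
        junctions_append₂, junctions_append₃, bases_word]
      tauto

/-- After two copies of a base no new junction appears. An extended shift produces five: one from
the left expansion and four from the square of $\pi\pi$. -/
theorem canon_square {π P S : Term1 A} (hπ : HasRankOne π) (h : Canon (P ++ (π ++ (π ++ S)))) :
    Canon (P ++ (π ++ (π ++ (π ++ (π ++ (π ++ S)))))) := by
  obtain ⟨l, z, p, m, rfl⟩ := hπ.exists_eq
  simp only [Canon, List.append_assoc, List.cons_append, bases_append, bases_cons_pow,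
    Set.union_subset_iff, Set.insert_subset_iff,
    junctions_append₂] at h ⊢
  tauto

theorem npow_append_comm {X : Type*} (x y : List X) (k : ℕ) :
    npow (x ++ y) k ++ x = x ++ npow (y ++ x) k := by
  induction k with
  | zero => simp [npow]
  | succ k ih =>
    have h3 : ∀ z : List X, npow z (k + 1) = z ++ npow z k := by
      simp [npow, List.replicate_succ]
    rw [h3, h3, List.append_assoc, ih]; simp

theorem npow_comm {X : Type*} (x : List X) (k : ℕ) : npow x k ++ x = x ++ npow x k := by
  simpa using npow_append_comm x [] k

theorem Step2.semiCanon {α β : Term2 A} (h : Step2 α β) (hα : SemiCanon α) : SemiCanon β := by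
  refine InContext.semiCanon ?_ h hα
  rintro δ ε (⟨δ, ε, h⟩ | ⟨r, x, y, s, τ, t, u, k, hu, h⟩) hδ
  · exact ⟨h.inv.rank.1 hδ, fun P S => by rw [h.inv.expansion]; exact id⟩
  · have h1 : HasRankOne (x ++ y) := hδ (x ++ y, s) (by simp)
    have h2 : HasRankOne (word u ++ τ) := hδ (word u ++ τ, t) (by simp)
    refine ⟨?_, fun P S hc => ?_⟩
    · intro a ha
      simp only [List.mem_cons, List.not_mem_nil, or_false] at ha
      rcases ha with rfl | rfl
      · simpa [or_comm] using h1
      · exact hasRankOne_append.2 (Or.inl h2)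
    · have h3 := @canon_square A _ (word u ++ τ) (P ++ (r ++ ((x ++ y) ++ ((x ++ y) ++ s)))) (t ++ S) h2
        (by simpa [Term2.twoExpansion] using hc)
      -- As $\rho_iu$ is $(xy)^kx$, the factor $\rho_iu(yx)^2$ of the new expansion equals
      -- $(xy)^2\rho_iu$, so up to this place the two expansions agree.
      have h4 : s ++ (word u ++ ((y ++ x) ++ (y ++ x))) =
          (x ++ y) ++ ((x ++ y) ++ (s ++ word u)) := by
        rw [← List.append_assoc, h, npow_append_comm, List.append_assoc,
          ← List.append_assoc (npow _ _), npow_comm, List.append_assoc, npow_comm]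
        simp
      have h5 : P ++ (r ++ (s ++ (word u ++ ((y ++ x) ++ (y ++ x))))) =
          P ++ (r ++ ((x ++ y) ++ ((x ++ y) ++ (s ++ word u)))) := by rw [h4]
      have h6 := congrArg (· ++ (τ ++ (word u ++ τ ++ (word u ++ τ ++ (word u ++ τ ++ (word u ++ τ ++ (t ++ S))))))) h5
      simp only [Term2.twoExpansion, List.append_assoc, List.map_cons, List.map_nil, List.flatten_cons,
        List.flatten_nil, List.nil_append] at h6 h3 ⊢
      rw [h6]; exact h3

theorem IsConnector.good {x z u : List A} (h : IsConnector x z u) (hx : IsLyndon x) :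
    GoodJunction x u z := by
  rcases h with ⟨rfl, a, rfl, ha⟩ | ⟨-, k, l, -, h⟩
  · have ha' : x.head? ≠ some a := ha.1
    obtain ⟨b, x', rfl⟩ := List.exists_cons_of_ne_nil hx.ne_nil
    have hab : b ≠ a := by simpa using ha'
    refine ⟨fun _ h => ?_, fun _ l h => ?_⟩
    · rcases List.suffix_cons_iff.1 h with h | h
      · simp at h; exact hab h.1
      · simp at h
    · simp at h; exact hab h.1
  · have := h.canon.2
    rw [junctions_pow, junctions_append_pow, junctions_word] at this
    exact this.2.1

/-- In the first two variants every junction is inherited. The third one introduces the junction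
$(x,u_{x,z},z)$, admissible by the choice of the connector. -/
theorem Shortening2Core.semiCanon {δ γ : Term2 A} (h : Shortening2Core δ γ) :
    BaseRank γ ∧
      ∀ P S, Canon (P ++ (δ.twoExpansion ++ S)) → Canon (P ++ (γ.twoExpansion ++ S)) := by
  obtain ⟨w₀, w₁, w₂, w₃, x, p₁, p₂, q₁, q₂, h, hq⟩ |
    ⟨w₀, w₁, w₂, w₃, x, p₁, p₂, q₁, q₂, h, hq, hp⟩ |
    ⟨w₀, w₁, w₂, w₃, x, z, u, p₁, p₂, q₁, q₂, h, hxz, hu⟩ := h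
  all_goals
    refine ⟨by simp [BaseRank], fun P S => ?_⟩
    rw [(shiftEquiv_inv h).expansion]
    simp only [Term2.twoExpansion, Canon, List.map_cons, List.map_nil, List.flatten_cons,
      List.flatten_nil, List.append_assoc, List.cons_append, List.nil_append, List.append_nil,
      bases_append, bases_cons_pow, Set.union_subset_iff, Set.insert_subset_iff, junctions_append_pow,
      junctions_append₂, bases_word]
  · tauto
  · tauto
  · rintro ⟨hb, hc⟩
    have : Junctions GoodJunction x (word u) z := junctions_word.2 (hu.good (by tauto))
    refine ⟨by simp only [Set.empty_subset]; tauto, by tauto⟩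

/-- Some copies of $\tau$ get neighbours that only $\sigma$ had before, but junctions see no more
than $\omega$-portions, and these are the same for $\sigma$ and $\tau$. -/
theorem Shortening1.canonLe {σ τ w s : Term1 A} (h : SameOmegaPortions σ τ) (P S : Term1 A)
    (hc : Canon (P ++ (w ++ (σ ++ (τ ++ (σ ++ (τ ++ (σ ++ (s ++ S))))))))) :
    Canon (P ++ (w ++ (τ ++ (τ ++ (s ++ S))))) := by
  obtain ⟨u, x, y, v, ⟨p, R, hσ⟩, ⟨p', R', hτ⟩, ⟨p₂, L, hσ'⟩, ⟨_, L', hτ'⟩⟩ := h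
  have hf : finState (x, []) R = (y, v) := by
    rw [← finState_pow ([], []) (word u) x p R, ← hσ, hσ', finState_pow_word]
  have hf' : finState (x, []) R' = (y, v) := by
    rw [← finState_pow ([], []) (word u) x p' R', ← hτ, hτ', finState_pow_word]
  obtain ⟨hb, hc⟩ := hc
  have h1 : Junctions GoodJunction y (word v ++ (s ++ S)) [] := by
    have : P ++ (w ++ (σ ++ (τ ++ (σ ++ (τ ++ (σ ++ (s ++ S))))))) =
      (P ++ (w ++ (σ ++ (τ ++ (σ ++ (τ ++ L)))))) ++ Atom.pow y p₂ :: (word v ++ (s ++ S)) := by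
        conv_lhs => rw [show (σ ++ (s ++ S)) = L ++ Atom.pow y p₂ :: (word v ++ (s ++ S)) by
          rw [hσ']; simp]
        simp
    rw [this, junctions_append_pow] at hc
    exact hc.2
  clear hσ' hτ'
  subst hσ hτ
  refine ⟨?_, ?_⟩
  · simp only [bases_append, bases_cons_pow, Set.union_subset_iff, Set.insert_subset_iff] at hb ⊢
    tauto
  · simp only [List.append_assoc, List.cons_append, junctions_append₂, junctions_append₃] at hc ⊢
    exact ⟨hc.1, hc.2.2.1, hc.2.2.1.fin_transfer hf' h1⟩

theorem Step3.semiCanon {α β : Term2 A} (h : Step3 α β) (hα : SemiCanon α) : SemiCanon β := by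
  refine InContext.semiCanon ?_ h hα
  rintro δ ε (⟨w, σ, τ, s, h⟩ | ⟨γ, h, h', -⟩ | (⟨r, v, s, w, x, p, q⟩ | ⟨r, v, s, w, x, p, q⟩)) hδ
  · refine ⟨?_, fun P S hc => ?_⟩
    · obtain ⟨u, x, y, v, -, ⟨p', R', rfl⟩, -⟩ := h
      simp [BaseRank]
    · have := Shortening1.canonLe h P S (by simpa [Term2.twoExpansion] using hc)
      simpa [Term2.twoExpansion] using this
  · have h1 := h.semiCanon
    have h2 := reflTransGen_shiftRight_inv h'
    exact ⟨h2.rank.1 h1.1, fun P S hc => by rw [← h2.expansion]; exact h1.2 P S hc⟩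
  all_goals
    refine ⟨by simp [BaseRank], fun P S => ?_⟩
    simp only [Term2.twoExpansion, Canon, List.map_cons, List.map_nil, List.flatten_cons,
      List.flatten_nil, List.append_assoc, List.cons_append, List.append_nil,
      bases_append, bases_cons_pow, Set.union_subset_iff, Set.insert_subset_iff,
      junctions_append₂, junctions_append₃, bases_word]
    tauto

end Canonical

end KappaLG

namespace KappaLG

variable {A : Type*}

/-! ### Rotations by rank two shifts -/

theorem ShiftEquiv.refl (δ : Term2 A) : ShiftEquiv δ δ := Relation.EqvGen.refl _

theorem ShiftEquiv.symm {δ ε : Term2 A} (h : ShiftEquiv δ ε) : ShiftEquiv ε δ :=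
  Relation.EqvGen.symm _ _ h

theorem ShiftEquiv.trans {δ ε ζ : Term2 A} (h : ShiftEquiv δ ε) (h' : ShiftEquiv ε ζ) :
    ShiftEquiv δ ζ := Relation.EqvGen.trans _ _ _ h h'

theorem ShiftEquiv.skip {r r₁ : Term1 A} {s s₁ : List (Term1 A × Term1 A)}
    (h : ShiftEquiv ⟨r, s⟩ ⟨r₁, s₁⟩) (ρ π : Term1 A) :
    ShiftEquiv ⟨ρ, (π, r) :: s⟩ ⟨ρ, (π, r₁) :: s₁⟩ := by
  have key : ∀ δ ε : Term2 A, ShiftEquiv δ ε →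
      ShiftEquiv ⟨ρ, (π, δ.head) :: δ.tail⟩ ⟨ρ, (π, ε.head) :: ε.tail⟩ := by
    intro δ ε h
    induction h with
    | rel _ _ h => exact Relation.EqvGen.rel _ _ (InContext.skip _ _ _ _ _ _ h)
    | refl => exact ShiftEquiv.refl _
    | symm _ _ _ ih => exact ih.symm
    | trans _ _ _ _ _ ih ih' => exact ih.trans ih'
  exact key _ _ h

theorem shiftRight_cons {x y : Term1 A} (hx : x ≠ []) (hy : y ≠ []) (r s : Term1 A)
    (tl : List (Term1 A × Term1 A)) :
    ShiftRight ⟨r, (x ++ y, x ++ s) :: tl⟩ ⟨r ++ x, (y ++ x, s) :: tl⟩ :=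
  InContext.here _ _ [_] [_] tl (ShiftRule.mk r x y s hx hy)

/-- A single shift moves a proper part of the base. A whole base is moved by two shifts, for which
it must have at least two factors. -/
theorem shiftEquiv_cons {x y : Term1 A} (h : 2 ≤ (x ++ y).length) (r s : Term1 A)
    (tl : List (Term1 A × Term1 A)) :
    ShiftEquiv ⟨r, (x ++ y, x ++ s) :: tl⟩ ⟨r ++ x, (y ++ x, s) :: tl⟩ := by
  have h1 : ∀ (x y r s : Term1 A), x ≠ [] → y ≠ [] →
      ShiftEquiv ⟨r, (x ++ y, x ++ s) :: tl⟩ ⟨r ++ x, (y ++ x, s) :: tl⟩ := fun x y r s hx hy =>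
    Relation.EqvGen.rel _ _ (shiftRight_cons hx hy r s tl)
  rcases x with _ | ⟨a, x⟩
  · simpa using ShiftEquiv.refl _
  rcases eq_or_ne y [] with rfl | hy
  · have hx : x ≠ [] := by rintro rfl; simp at h
    have h2 := (h1 [a] x r (x ++ s) (by simp) hx).trans (h1 x [a] (r ++ [a]) s hx (by simp))
    simpa using h2
  · exact h1 _ _ _ _ (by simp) hy

/-- The rotated base is described through its square, which gives one formula whether `P` is shorter
or longer than `π`. -/
theorem shiftEquiv_right {π P rest : Term1 A} (h : P ++ rest = π ++ π) (hπ : 2 ≤ π.length)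
    (r s : Term1 A) (tl : List (Term1 A × Term1 A)) :
    ∃ π', ShiftEquiv ⟨r, (π, P ++ s) :: tl⟩ ⟨r ++ P, (π', s) :: tl⟩ ∧ π' ++ π' = rest ++ P := by
  rw [List.append_eq_append_iff] at h
  rcases h with ⟨y, rfl, rfl⟩ | ⟨x, rfl, hx⟩
  · exact ⟨y ++ P, shiftEquiv_cons hπ r s tl, by simp⟩
  · obtain rfl : π = x ++ rest := hx
    refine ⟨rest ++ x, ?_, by simp⟩
    have h1 := shiftEquiv_cons (x := x ++ rest) (y := []) (by simpa using hπ) r (x ++ s) tl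
    have h2 := shiftEquiv_cons (x := x) (y := rest) hπ (r ++ (x ++ rest)) s tl
    simpa using h1.trans (by simpa using h2)

theorem shiftEquiv_left {π P rest : Term1 A} (h : rest ++ P = π ++ π) (hπ : 2 ≤ π.length)
    (r s : Term1 A) (tl : List (Term1 A × Term1 A)) :
    ∃ π', ShiftEquiv ⟨r ++ P, (π, s) :: tl⟩ ⟨r, (π', P ++ s) :: tl⟩ ∧ π' ++ π' = P ++ rest := by
  rw [List.append_eq_append_iff] at h
  rcases h with ⟨y, rfl, rfl⟩ | ⟨x, rfl, hx⟩
  · refine ⟨y ++ rest, ?_, by simp⟩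
    have hπ' : 2 ≤ ((rest ++ y) ++ ([] : Term1 A)).length := by simpa using hπ
    have h1 := shiftEquiv_cons hπ' r (y ++ s) tl
    have h2 := shiftEquiv_cons (x := y) (y := rest) (by simp at hπ ⊢; omega) r (rest ++ (y ++ s)) tl
    have h3 := shiftEquiv_cons (x := rest) (y := y) hπ (r ++ y) (y ++ s) tl
    have h4 := shiftEquiv_cons (x := y) (y := rest) (by simp at hπ ⊢; omega) (r ++ y ++ rest) s tl
    have := (h2.trans (by simpa using h3)).trans h4
    simpa using this.symm
  · subst hx
    exact ⟨P ++ x, (shiftEquiv_cons (by simp at hπ ⊢; omega) r s tl).symm, by simp⟩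

/-! ### Factorizations of positive words -/

theorem word_append_eq {v : List A} {t l : Term1 A} {z : List A} {p : ℤ} {r : Term1 A}
    (h : word v ++ t = l ++ Atom.pow z p :: r) :
    ∃ l', l = word v ++ l' ∧ t = l' ++ Atom.pow z p :: r := by
  rw [List.append_eq_append_iff] at h
  rcases h with ⟨d, rfl, h⟩ | ⟨d, h1, h2⟩
  · exact ⟨d, rfl, h⟩
  · rcases d with _ | ⟨a, d⟩
    · exact ⟨[], by simpa using h1.symm, by simpa using h2.symm⟩
    · simp only [List.cons_append, List.cons.injEq] at h2
      have : Atom.pow z p ∈ word v := by rw [h1, h2.1]; simp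
      simp at this

theorem append_word_eq {u : List A} {t l : Term1 A} {z : List A} {p : ℤ} {r : Term1 A}
    (h : t ++ word u = l ++ Atom.pow z p :: r) :
    ∃ r', r = r' ++ word u ∧ t = l ++ Atom.pow z p :: r' := by
  rw [List.append_eq_append_iff] at h
  rcases h with ⟨d, rfl, h⟩ | ⟨d, rfl, h⟩
  · have : Atom.pow z p ∈ word u := by rw [h]; simp
    simp at this
  · rcases d with _ | ⟨a, d⟩
    · have : Atom.pow z p ∈ word u := by rw [← (by simpa using h : _ = word u)]; simp
      simp at this
    · simp only [List.cons_append, List.cons.injEq] at h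
      exact ⟨d, h.2, by rw [h.1]⟩

/-- The prefix closes with a crucial variable; being proper, it is followed by the base variable of
its right base (`body_succ`). So the cut lies at the beginning of a limit term, and injectivity
identifies the part before it. -/
theorem eq_of_body_prefix {q : ℕ} {y y' : List A} {l t : Term1 A} {z x : List A}
    (h : body q y l z <+: body q y' t x) (hne : body q y l z ≠ body q y' t x)
    (ht : ExpPos q t) (hl : ExpPos q l) : y = y' ∧ ∃ p r, t = l ++ Atom.pow z p :: r := by
  obtain ⟨C, hC⟩ := h
  obtain ⟨v, z', B, hB⟩ := body_eq_append_cru q y l z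
  rw [hB, List.append_assoc, List.singleton_append] at hC
  rcases body_succ ht hC.symm with ⟨rfl, -⟩ | ⟨C', rfl⟩
  · exact absurd (hB.trans hC) hne
  · have h1 : body q y' t x = body q y l z ++ Var.base z :: C' := by rw [hB, ← hC]; simp
    obtain ⟨l', p, r, e, f, rfl, -, h2, -⟩ := body_eq_append_base h1
    have h3 : body q y l z ++ List.replicate 0 (Var.base z) =
      body q y' l' z ++ List.replicate e (Var.base z) := by simpa using h2
    obtain ⟨-, h4⟩ := append_replicate_inj h3 (body_getLast?_ne _ _ _ _ _) (body_getLast?_ne _ _ _ _ _)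
    obtain ⟨h5, rfl, -⟩ := body_injective h4 hl (by simp at ht; exact ht.1)
    exact ⟨h5, p, r, rfl⟩

theorem eq_of_body_suffix {q : ℕ} {y : List A} {r t : Term1 A} {z x x' : List A}
    (h : body q z r x' <:+ body q y t x) (hne : body q z r x' ≠ body q y t x)
    (ht : ExpPos q t) (hr : ExpPos q r) : x' = x ∧ ∃ l p, t = l ++ Atom.pow z p :: r := by
  obtain ⟨B, hB⟩ := h
  obtain ⟨v, z', C, hC⟩ := body_eq_cru_cons q z r x'
  have hz : ∃ v z' C, body q z r x' = Var.cru z v z' :: C := by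
    rcases word_or_pow r with ⟨v, rfl⟩ | ⟨v, z₁, p, t', rfl⟩
    · exact ⟨v, x', [], body_word ..⟩
    · exact ⟨v, z₁, _, body_word_pow ..⟩
  obtain ⟨v, z', C, hC⟩ := hz
  rw [hC] at hB
  rcases body_pred ht hB.symm with ⟨rfl, -⟩ | ⟨B', rfl⟩
  · exact absurd (hC.trans hB) hne
  · have h1 : body q y t x = B' ++ Var.base z :: body q z r x' := by rw [hC, ← hB]; simp
    obtain ⟨l', p, r', e, f, rfl, -, -, h2⟩ := body_eq_append_base h1
    have h3 : List.replicate 0 (Var.base z) ++ body q z r x' =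
      List.replicate f (Var.base z) ++ body q z r' x := by simpa using h2
    obtain ⟨-, h4⟩ := replicate_append_inj h3 (body_head?_ne _ _ _ _ _) (body_head?_ne _ _ _ _ _)
    obtain ⟨-, rfl, h5⟩ := body_injective h4 hr (by simp at ht; exact ht.2.2)
    exact ⟨h5, l', p, rfl⟩

/-- Crucial variables are isolated, so a cut strictly inside a positive word falls within a power of
a base variable or at one of its ends. In each case the limit term concerned has its whole past in
`R` and its whole future in `S`. -/
theorem exists_base_of_append {q : ℕ} {y : List A} {t : Term1 A} {x : List A} {R S : List (Var A)}
    (h : body q y t x = R ++ S) (hR : R ≠ []) (hS : S ≠ []) (ht : ExpPos q t) :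
    ∃ l z p r, t = l ++ Atom.pow z p :: r ∧ body q y l z <+: R ∧ body q z r x <:+ S := by
  have base1 : ∀ R₁ z, R = R₁ ++ [Var.base z] →
      ∃ l z p r, t = l ++ Atom.pow z p :: r ∧ body q y l z <+: R ∧ body q z r x <:+ S := by
    rintro R₁ z rfl
    rw [List.append_assoc, List.singleton_append] at h
    obtain ⟨l, p, r, e, f, rfl, -, rfl, rfl⟩ := body_eq_append_base h
    exact ⟨l, z, p, r, rfl, ⟨_, by rw [List.append_assoc]⟩, ⟨_, rfl⟩⟩
  obtain ⟨R₁, b, rfl⟩ : ∃ R₁ b, R = R₁ ++ [b] := ⟨_, _, (List.dropLast_append_getLast hR).symm⟩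
  have hb : b ∈ body q y t x := by rw [h]; simp
  rcases body_base_or_cru hb with ⟨z, rfl⟩ | ⟨y₁, v, z, rfl⟩
  · exact base1 _ _ rfl
  · have h' := h
    rw [List.append_assoc, List.singleton_append] at h'
    rcases body_succ ht h' with ⟨h1, -⟩ | ⟨C, rfl⟩
    · exact absurd h1 hS
    · obtain ⟨l, p, r, e, f, rfl, -, h1, rfl⟩ := body_eq_append_base h
      exact ⟨l, z, p, r, rfl, ⟨_, h1.symm⟩, ⟨Var.base z :: List.replicate f (Var.base z), by simp⟩⟩

/-! ### Irreducibility under the rules of the first step -/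

/-- No elimination and no agglutination is applicable. -/
def Irr (α : Term2 A) : Prop := ∀ β, ¬ Step1 α β

theorem Step1.length_lt {α β : Term2 A} (h : Step1 α β) : β.tail.length < α.tail.length := by
  unfold Step1 at h
  induction h with
  | here r r₁ s s₁ rest h =>
    have : s₁.length < s.length := by
      rcases h with ⟨w₀, w₁, w₂, x, p, q, r, h⟩ | ⟨w₀, w₁, w₂, w₃, x, p, q, r, h⟩ |
        ⟨w₀, w₁, w₂, w₃, u, x, p, q, h⟩ | ⟨w₀, w₁, w₂, w₃, u, x, p, q, h⟩ <;>
      · have := (shiftEquiv_inv h).length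
        simp at this ⊢
        omega
    simp; omega
  | skip ρ π r r₁ s s₁ h ih => simpa using ih

/-- `IsNormal` tolerates applications that return the same term. The rules of the first step lower
the $2$-length, so none of them is applicable at all. -/
theorem irr_of_isNormal {α : Term2 A} (h : IsNormal Step1 α) : Irr α := fun β hβ => by
  have := hβ.length_lt
  rw [h β hβ] at this
  exact lt_irrefl _ this

theorem Irr.tail {r π ρ : Term1 A} {s : List (Term1 A × Term1 A)} (h : Irr ⟨r, (π, ρ) :: s⟩) :
    Irr ⟨ρ, s⟩ := fun β hβ => h ⟨r, (π, β.head) :: β.tail⟩ (InContext.skip _ _ _ _ _ _ hβ)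

theorem Irr.not_elimination {r : Term1 A} {s : List (Term1 A × Term1 A)} {b : Term1 A × Term1 A}
    (h : Irr ⟨r, b :: s⟩) (w₀ w₁ w₂ : Term1 A) (x : List A) (p q p' : ℤ) :
    ¬ ShiftEquiv ⟨r, [b]⟩
      ⟨w₀ ++ Atom.pow x p :: w₁, [(Atom.pow x q :: w₁, Atom.pow x p' :: w₂)]⟩ := fun hs =>
  h _ (InContext.here _ _ [b] _ s (Or.inl (EliminationRule.mk _ _ _ _ _ _ _ _ hs)))

theorem Irr.not_agglutination {r : Term1 A} {s : List (Term1 A × Term1 A)} {b b' : Term1 A × Term1 A}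
    (h : Irr ⟨r, b :: b' :: s⟩) (ε : Term2 A) : ¬ AgglutinationRule ⟨r, [b, b']⟩ ε := fun hs =>
  h _ (InContext.here _ _ [b, b'] _ s (Or.inr hs))

/-- A base of rank one which is not a single limit term and whose bases are non-empty. -/
structure GoodBase (π : Term1 A) : Prop where
  rank : HasRankOne π
  length : 2 ≤ π.length
  ne_nil : [] ∉ bases π

/-- The positive word of the cube of a base, between its extreme limit terms. -/
def baseWord₂ (q : ℕ) (π : Term1 A) : List (Var A) :=
  body q (finBase π) (word (finWord π) ++ ((π ++ π) ++ word (iniWord π))) (iniBase π)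

/-! ### Overlaps of neighbouring factors in an irreducible term. -/

theorem length_body_pos (q : ℕ) (y : List A) (t : Term1 A) (x : List A) : 0 < (body q y t x).length :=
  List.length_pos_iff.2 (body_ne_nil _ _ _ _)

/-- Inside the longer word `baseWord₂` even the full `baseWord` is a proper prefix, as
`eq_of_body_prefix` requires. -/
theorem baseWord_prefix {q : ℕ} {π : Term1 A} (hπ : HasRankOne π) {R : List (Var A)}
    (h : R <+: baseWord q π) : R <+: baseWord₂ q π ∧ R ≠ baseWord₂ q π := by
  obtain ⟨p, r, hπ'⟩ := hπ.exists_ini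
  have h1 : baseWord₂ q π = baseWord q π ++ (List.replicate ((q : ℤ) + p).toNat (Var.base (iniBase π)) ++
      body q (iniBase π) (r ++ word (iniWord π)) (iniBase π)) := by
    have h2 : word (finWord π) ++ ((π ++ π) ++ word (iniWord π)) =
        (word (finWord π) ++ (π ++ word (iniWord π))) ++
          Atom.pow (iniBase π) p :: (r ++ word (iniWord π)) := by
      conv_lhs => rw [List.append_assoc π π]; arg 2; arg 2; rw [hπ']
      simp
    rw [baseWord₂, h2, body_append_pow]; rfl
  refine ⟨h.trans ⟨_, h1.symm⟩, fun h3 => ?_⟩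
  have h4 := h.length_le
  have h5 := length_body_pos q (iniBase π) (r ++ word (iniWord π)) (iniBase π)
  rw [h3, h1] at h4
  simp only [List.length_append] at h4
  omega

theorem baseWord_suffix {q : ℕ} {π : Term1 A} (hπ : HasRankOne π) {S : List (Var A)}
    (h : S <:+ baseWord q π) : S <:+ baseWord₂ q π ∧ S ≠ baseWord₂ q π := by
  obtain ⟨p, l, hπ'⟩ := hπ.exists_fin
  have h1 : baseWord₂ q π = body q (finBase π) (word (finWord π) ++ l) (finBase π) ++
      (List.replicate ((q : ℤ) + p).toNat (Var.base (finBase π)) ++ baseWord q π) := by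
    have h2 : word (finWord π) ++ ((π ++ π) ++ word (iniWord π)) =
        (word (finWord π) ++ l) ++ Atom.pow (finBase π) p ::
          (word (finWord π) ++ (π ++ word (iniWord π))) := by
      conv_lhs => rw [List.append_assoc π π]; arg 2; arg 1; rw [hπ']
      simp
    rw [baseWord₂, h2, body_append_pow]; rfl
  refine ⟨h.trans ⟨_, by rw [← List.append_assoc] at h1; exact h1.symm⟩, fun h3 => ?_⟩
  have h4 := h.length_le
  have h5 := length_body_pos q (finBase π) (word (finWord π) ++ l) (finBase π)
  rw [h3, h1] at h4
  simp only [List.length_append] at h4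
  omega

theorem eq_of_baseWord_prefix {q : ℕ} {π l : Term1 A} {y z : List A} (hπ : HasRankOne π)
    (h : body q y (word (finWord π) ++ l) z <+: baseWord q π) (hq : ExpPos q π) (hl : ExpPos q l) :
    ∃ p r, π ++ π = l ++ Atom.pow z p :: r := by
  obtain ⟨h1, h2⟩ := baseWord_prefix hπ h
  obtain ⟨-, p, r, h3⟩ := eq_of_body_prefix h1 h2 (by simp [hq]) (by simp [hl])
  rw [List.append_assoc (word (finWord π)) l, List.append_right_inj] at h3
  obtain ⟨r', -, h4⟩ := append_word_eq h3
  exact ⟨p, r', h4⟩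

theorem eq_of_baseWord_suffix {q : ℕ} {π r : Term1 A} {z x : List A} (hπ : HasRankOne π)
    (h : body q z (r ++ word (iniWord π)) x <:+ baseWord q π) (hq : ExpPos q π) (hr : ExpPos q r) :
    ∃ l p, π ++ π = l ++ Atom.pow z p :: r := by
  obtain ⟨h1, h2⟩ := baseWord_suffix hπ h
  obtain ⟨-, l, p, h3⟩ := eq_of_body_suffix h1 h2 (by simp [hq]) (by simp [hr])
  obtain ⟨l', -, h4⟩ := word_append_eq h3
  refine ⟨l', p, ?_⟩
  rw [← List.cons_append, ← List.append_assoc, List.append_left_inj] at h4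
  exact h4

theorem eq_pow_cons_of_square {π r : Term1 A} {z : List A} {p : ℤ} (h : π ++ π = Atom.pow z p :: r)
    : ∃ r', π = Atom.pow z p :: r' := by
  rcases π with _ | ⟨a, π⟩
  · simp at h
  · simp only [List.cons_append, List.cons.injEq] at h
    exact ⟨π, by rw [h.1]⟩

theorem eq_append_pow_of_square {π l : Term1 A} {z : List A} {p : ℤ}
    (h : π ++ π = l ++ [Atom.pow z p]) : ∃ l', π = l' ++ [Atom.pow z p] := by
  rcases List.eq_nil_or_concat π with rfl | ⟨l', a, rfl⟩
  · simp at h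
  · simp only [List.concat_eq_append] at *
    rw [← List.append_assoc] at h
    exact ⟨l', by rw [(List.append_inj_right' h rfl)]⟩

theorem HasRankOne.eq_of_square {π r : Term1 A} {u z : List A} {p : ℤ} (hπ : HasRankOne (π ++ π))
    (h : π ++ π = word u ++ Atom.pow z p :: r) : ∃ r', π = word u ++ Atom.pow z p :: r' := by
  have hπ' : HasRankOne π := by simpa using hπ
  obtain ⟨p', r', hr⟩ := hπ'.exists_ini
  rw [hr, List.append_assoc, List.cons_append] at h
  obtain ⟨h1, h2, h3, -⟩ := word_pow_inj h
  exact ⟨r', by rw [← h1, ← h2, ← h3]; exact hr⟩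

theorem HasRankOne.eq_of_square' {π l : Term1 A} {v z : List A} {p : ℤ} (hπ : HasRankOne (π ++ π))
    (h : π ++ π = l ++ Atom.pow z p :: word v) : ∃ l', π = l' ++ Atom.pow z p :: word v := by
  have hπ' : HasRankOne π := by simpa using hπ
  obtain ⟨p', l', hl⟩ := hπ'.exists_fin
  rw [hl, ← List.append_assoc] at h
  obtain ⟨-, h2, h3, h1⟩ := pow_word_inj h
  exact ⟨l', by rw [← h1, ← h2, ← h3]; exact hl⟩

/-- If a prefix cancelled on the left and a suffix cancelled on the right covered the positive
factor, shifts of the two bases towards a meeting point would produce one of the three patterns of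
agglutination. -/
theorem Irr.length_add_lt_pair {q : ℕ} {r π ρ π' ρ' : Term1 A} {s : List (Term1 A × Term1 A)}
    (h : Irr ⟨r, (π, ρ) :: (π', ρ') :: s⟩) (hπ : GoodBase π) (hπ' : GoodBase π')
    (hq : ExpPos q π) (hq' : ExpPos q π') (hρ : ExpPos q ρ) {R S : List (Var A)}
    (hR : R <+: baseWord q π)
    (hR' : R <+: body q (finBase π) (word (finWord π) ++ (ρ ++ word (iniWord π'))) (iniBase π'))
    (hS : S <:+ body q (finBase π) (word (finWord π) ++ (ρ ++ word (iniWord π'))) (iniBase π'))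
    (hS' : S <:+ baseWord q π') : R.length + S.length <
      (body q (finBase π) (word (finWord π) ++ (ρ ++ word (iniWord π'))) (iniBase π')).length := by
  by_contra! hlen
  set a := body q (finBase π) (word (finWord π) ++ (ρ ++ word (iniWord π'))) (iniBase π') with ha
  obtain ⟨S₁, hS₁⟩ := hR'
  have hS₂ : S₁ <:+ S := by
    refine List.suffix_of_suffix_length_le ⟨R, hS₁⟩ hS ?_
    have := congrArg List.length hS₁
    simp at this; omega
  have hS₃ : S₁ <:+ baseWord q π' := hS₂.trans hS'
  rcases eq_or_ne S₁ [] with rfl | hS₁n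
  -- The whole positive factor is a prefix of the negative factor before it. Moving `ρ` to the left
  -- of the first base makes the two bases begin with the same $\omega$-portion.
  · rw [List.append_nil] at hS₁
    rw [hS₁] at hR
    obtain ⟨p, m, h1⟩ := eq_of_baseWord_prefix hπ.rank hR hq (by simp [hρ])
    obtain ⟨p', r', h5⟩ := hπ'.rank.exists_ini
    rw [List.append_assoc] at h1
    obtain ⟨π₁, h2, h3⟩ := shiftEquiv_right h1.symm hπ.length r [] [(π', ρ')]
    have h4 : HasRankOne (π₁ ++ π₁) := by rw [h3]; simp
    rw [List.append_assoc, List.cons_append] at h3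
    obtain ⟨r₁, rfl⟩ := h4.eq_of_square h3
    rw [List.append_nil] at h2
    generalize hu : iniWord π' = u at *
    generalize hx : iniBase π' = x at *
    subst h5
    exact h.not_agglutination _ (AgglutinationRule.initial _ _ _ _ _ _ _ _ _ h2)
  rcases eq_or_ne R [] with rfl | hRn
  -- Dually, moving `ρ` to the right of the second base makes the two bases end with the same
  -- $\omega$-portion.
  · rw [List.nil_append] at hS₁
    rw [hS₁, ha, ← List.append_assoc] at hS₃
    obtain ⟨m, p, h1⟩ := eq_of_baseWord_suffix hπ'.rank hS₃ hq' (by simp [hρ])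
    obtain ⟨p', l', h5⟩ := hπ.rank.exists_fin
    rw [← List.cons_append, ← List.append_assoc] at h1
    obtain ⟨π₁, h2, h3⟩ := shiftEquiv_left h1.symm hπ'.length [] ρ' []
    have h4 : HasRankOne (π₁ ++ π₁) := by rw [h3]; simp
    rw [← List.append_assoc] at h3
    obtain ⟨l₁, rfl⟩ := h4.eq_of_square' h3
    have h6 := h2.skip r π
    rw [List.nil_append] at h6
    generalize hu : finWord π = u at *
    generalize hx : finBase π = x at *
    subst h5
    exact h.not_agglutination _ (AgglutinationRule.final _ _ _ _ _ _ _ _ _ h6)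
  -- A limit term of `ρ` is reached from both sides: the part `l` before it moves left and the part
  -- `m` after it moves right, so that the first base begins and the second one ends with this limit
  -- base.
  · obtain ⟨l, z, p, m, h1, h2, h3⟩ := exists_base_of_append hS₁.symm hRn hS₁n (by simp [hρ])
    obtain ⟨l, rfl, h4⟩ := word_append_eq h1
    obtain ⟨m, rfl, rfl⟩ := append_word_eq h4
    simp only [expPos_append, expPos_cons_pow] at hρ
    obtain ⟨p₁, r₁, h5⟩ := eq_of_baseWord_prefix hπ.rank (h2.trans hR) hq hρ.1
    obtain ⟨l₁, p₂, h6⟩ := eq_of_baseWord_suffix hπ'.rank (h3.trans hS₃) hq' hρ.2.2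
    obtain ⟨π₁, h7, h8⟩ := shiftEquiv_right h5.symm hπ.length r (Atom.pow z p :: m) [(π', ρ')]
    obtain ⟨r₂, rfl⟩ := eq_pow_cons_of_square (by simpa using h8)
    obtain ⟨π₂, h9, h10⟩ := shiftEquiv_left (rest := l₁ ++ [Atom.pow z p₂]) (P := m)
      (by rw [h6]; simp) hπ'.length [Atom.pow z p] ρ' []
    rw [← List.append_assoc] at h10
    obtain ⟨l₂, rfl⟩ := eq_append_pow_of_square h10
    exact h.not_agglutination _ (AgglutinationRule.inner _ _ _ _ _ _ _ _ _
      (h7.trans (h9.skip _ _)))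

theorem Irr.false_of_elimination {l l' m r₁ : Term1 A} {z : List A} {p p₁ p₂ : ℤ}
    {s : List (Term1 A × Term1 A)}
    (h : Irr ⟨l' ++ Atom.pow z p₂ :: m, (l ++ Atom.pow z p :: m, l ++ Atom.pow z p₁ :: r₁) :: s⟩)
    (hl : 2 ≤ (l ++ Atom.pow z p :: m).length) : False := by
  have h6 := shiftEquiv_cons (x := l) (y := Atom.pow z p :: m) hl
    (l' ++ Atom.pow z p₂ :: m) (Atom.pow z p₁ :: r₁) []
  refine h.not_elimination l' (m ++ l) r₁ z p₂ p p₁ ?_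
  simpa using h6

theorem Irr.false_of_agglutination_inner {r w v m ρ : Term1 A} {x : List A} {p p' p₂ : ℤ}
    {s : List (Term1 A × Term1 A)}
    (h : Irr ⟨r, (Atom.pow x p :: w, Atom.pow x p' :: m) :: (v ++ Atom.pow x p₂ :: m, ρ) :: s⟩)
    (hl : 2 ≤ (v ++ Atom.pow x p₂ :: m).length) : False := by
  have h6 := (shiftEquiv_cons (x := m) (y := v ++ [Atom.pow x p₂]) (by simp at hl ⊢; omega)
    [Atom.pow x p'] ρ []).symm
  refine h.not_agglutination _ (AgglutinationRule.inner _ r w (m ++ v) (m ++ ρ) x p p' p₂ ?_)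
  simpa using ShiftEquiv.skip h6 r (Atom.pow x p :: w)

/-- If the two cancellations in a negative factor met, some limit term of the base would reappear in
`ρ` with all that precedes it in the base, and in `r` with all that follows it in the base. Up to
shifts this is the pattern of an elimination. Total cancellation of a neighbouring positive factor
is excluded here and is dealt with separately. -/
theorem Irr.length_add_lt_base {q : ℕ} {r π ρ : Term1 A} {s : List (Term1 A × Term1 A)}
    (h : Irr ⟨r, (π, ρ) :: s⟩) (hπ : GoodBase π) {y₀ v₀ x₁ u₁ : List A}
    (hr : ExpPos q r) (hq : ExpPos q π) (hρ : ExpPos q ρ) {R S : List (Var A)}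
    (hR : R <+: baseWord q π)
    (hR' : R <+: body q (finBase π) (word (finWord π) ++ (ρ ++ word u₁)) x₁)
    (hRn : R ≠ body q (finBase π) (word (finWord π) ++ (ρ ++ word u₁)) x₁)
    (hS : S <:+ body q y₀ (word v₀ ++ (r ++ word (iniWord π))) (iniBase π))
    (hSn : S ≠ body q y₀ (word v₀ ++ (r ++ word (iniWord π))) (iniBase π))
    (hS' : S <:+ baseWord q π) : R.length + S.length < (baseWord q π).length := by
  by_contra! hlen
  obtain ⟨S₁, hS₁⟩ := hR
  have hS₂ : S₁ <:+ S := by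
    refine List.suffix_of_suffix_length_le ⟨R, hS₁⟩ hS' ?_
    have := congrArg List.length hS₁
    simp at this; omega
  have hS₃ := hS₂.trans hS
  have hS₄ : S₁ ≠ body q y₀ (word v₀ ++ (r ++ word (iniWord π))) (iniBase π) := by
    rintro rfl
    exact hSn (hS.eq_of_length_le hS₂.length_le)
  have hpre : ∀ (l : Term1 A) (z : List A), ExpPos q l → body q (finBase π) (word (finWord π) ++ l) z <+: R →
      ∃ p r₁, ρ ++ word u₁ = l ++ Atom.pow z p :: r₁ := by
    intro l z hl hlz
    have hne : body q (finBase π) (word (finWord π) ++ l) z ≠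
        body q (finBase π) (word (finWord π) ++ (ρ ++ word u₁)) x₁ := by
      intro h1
      rw [h1] at hlz
      exact hRn (hR'.eq_of_length_le hlz.length_le)
    obtain ⟨-, p, r₁, h1⟩ := eq_of_body_prefix (hlz.trans hR') hne (by simp [hρ]) (by simp [hl])
    rw [List.append_assoc (word (finWord π)) l, List.append_right_inj] at h1
    exact ⟨p, r₁, h1⟩
  have hsuf : ∀ (m : Term1 A) (z : List A), ExpPos q m → body q z (m ++ word (iniWord π)) (iniBase π) <:+ S₁ →
      ∃ l p, r = l ++ Atom.pow z p :: m := by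
    intro m z hm hmz
    have hne : body q z (m ++ word (iniWord π)) (iniBase π) ≠
        body q y₀ (word v₀ ++ (r ++ word (iniWord π))) (iniBase π) := by
      intro h1
      rw [h1] at hmz
      exact hS₄ (hS₃.eq_of_length_le hmz.length_le)
    obtain ⟨-, l, p, h1⟩ := eq_of_body_suffix (hmz.trans hS₃) hne (by simp [hr]) (by simp [hm])
    obtain ⟨l', -, h4⟩ := word_append_eq h1
    rw [← List.cons_append, ← List.append_assoc, List.append_left_inj] at h4
    exact ⟨l', p, h4⟩
  rcases eq_or_ne S₁ [] with rfl | hS₁n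
  -- The whole negative factor cancels on the right, so `ρ` begins with a copy of the base followed
  -- by its initial word and a limit term with its initial limit base.
  · rw [List.append_nil] at hS₁
    obtain ⟨p, r₁, h1⟩ := hpre (π ++ word (iniWord π)) (iniBase π) (by simp [hq]) (by rw [hS₁]; exact List.prefix_rfl)
    obtain ⟨r₂, -, rfl⟩ := append_word_eq h1
    obtain ⟨p', π₂, h2⟩ := hπ.rank.exists_ini
    generalize iniWord π = u at *
    generalize iniBase π = x at *
    have h3 := hπ.length
    subst h2
    obtain ⟨π₃, h4, h5⟩ := shiftEquiv_right (π := word u ++ Atom.pow x p' :: π₂)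
      (P := word u ++ Atom.pow x p' :: π₂ ++ word u) (rest := Atom.pow x p' :: π₂) (by simp) h3 r
      (Atom.pow x p :: r₂) []
    obtain rfl : π₃ = Atom.pow x p' :: (π₂ ++ word u) := by
      rw [show Atom.pow x p' :: π₂ ++ (word u ++ Atom.pow x p' :: π₂ ++ word u) =
        (Atom.pow x p' :: (π₂ ++ word u)) ++ (Atom.pow x p' :: (π₂ ++ word u)) by simp] at h5
      have := congrArg List.length h5
      exact List.append_inj_left h5 (by simp at this ⊢; omega)
    refine h.not_elimination (r ++ word u) (π₂ ++ word u) r₂ x p' p' p ?_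
    simpa using h4
  rcases eq_or_ne R [] with rfl | hRn'
  · rw [List.nil_append] at hS₁
    obtain ⟨l, p, h1⟩ := hsuf (word (finWord π) ++ π) (finBase π) (by simp [hq])
      (by rw [hS₁, List.append_assoc]; exact List.suffix_rfl)
    obtain ⟨p', π₂, h2⟩ := hπ.rank.exists_fin
    generalize finWord π = v at *
    generalize finBase π = y at *
    have h3 := hπ.length
    subst h2 h1
    obtain ⟨π₃, h4, h5⟩ := shiftEquiv_left (π := π₂ ++ Atom.pow y p' :: word v)
      (P := Atom.pow y p' :: (word v)) (rest := π₂ ++ Atom.pow y p' :: word v ++ π₂) (by simp) h3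
      (l ++ Atom.pow y p :: (word v ++ π₂)) ρ []
    obtain rfl : π₃ = Atom.pow y p' :: (word v ++ π₂) := by
      rw [show Atom.pow y p' :: word v ++ (π₂ ++ Atom.pow y p' :: word v ++ π₂) =
        (Atom.pow y p' :: (word v ++ π₂)) ++ (Atom.pow y p' :: (word v ++ π₂)) by simp] at h5
      have := congrArg List.length h5
      exact List.append_inj_left h5 (by simp at this ⊢; omega)
    refine h.not_elimination l (word v ++ π₂) (word v ++ ρ) y p p' p' ?_
    simpa using h4
  · obtain ⟨l, z, p, m, h1, h2, h3⟩ := exists_base_of_append hS₁.symm hRn' hS₁n (by simp [hq])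
    obtain ⟨l, rfl, h4⟩ := word_append_eq h1
    obtain ⟨m, rfl, rfl⟩ := append_word_eq h4
    simp only [expPos_append, expPos_cons_pow] at hq
    obtain ⟨p₁, r₁, h5⟩ := hpre l z hq.1 h2
    obtain ⟨l', p₂, rfl⟩ := hsuf m z hq.2.2 h3
    obtain ⟨r₁, -, rfl⟩ := append_word_eq h5
    exact h.false_of_elimination hπ.length

end KappaLG

namespace KappaLG

variable {A : Type*}

/-! ### Irreducible terms of rank two -/

/-- The terms of rank at most one in a term of rank two satisfy `P`. -/
def Term2.All (P : Term1 A → Prop) (α : Term2 A) : Prop :=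
  P α.head ∧ ∀ s ∈ α.tail, P s.1 ∧ P s.2

theorem le_maxExp1 {t : Term1 A} {x : List A} {p : ℤ} (h : Atom.pow x p ∈ t) :
    p.natAbs ≤ maxExp1 t := by
  induction t with
  | nil => simp at h
  | cons a t ih =>
    simp only [maxExp1, List.map_cons, List.foldr_cons] at ih ⊢
    rcases List.mem_cons.1 h with rfl | h
    · exact le_max_left _ _
    · exact (ih h).trans (le_max_right _ _)

theorem le_foldr_max {l : List ℕ} {n : ℕ} (h : n ∈ l) : n ≤ l.foldr max 0 := by
  induction l with
  | nil => simp at h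
  | cons a t ih =>
    rcases List.mem_cons.1 h with rfl | h
    · exact le_max_left _ _
    · exact (ih h).trans (le_max_right _ _)

theorem expPos_of_maxExp1_lt {t : Term1 A} {q : ℕ} (h : maxExp1 t < q) : ExpPos q t :=
  fun x p hp => by
    have := le_maxExp1 hp
    omega

theorem all_expPos_of_qBound_le {α : Term2 A} {q : ℕ} (h : α.qBound ≤ q) : α.All (ExpPos q) := by
  unfold Term2.qBound at h
  refine ⟨expPos_of_maxExp1_lt ?_, fun s hs => ?_⟩
  · have := le_foldr_max (l := maxExp1 α.head ::
      α.tail.map fun s => max 1 (max (maxExp1 s.1) (maxExp1 s.2))) (List.mem_cons_self)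
    omega
  · have := le_foldr_max (l := maxExp1 α.head ::
      α.tail.map fun s => max 1 (max (maxExp1 s.1) (maxExp1 s.2)))
      (List.mem_cons_of_mem _ (List.mem_map_of_mem hs))
    exact ⟨expPos_of_maxExp1_lt (by omega), expPos_of_maxExp1_lt (by omega)⟩

/-- Crucial variables with an empty base mark the ends of a term. As negative factors contain none,
the first and the last positive factor cannot disappear. -/
theorem GoodBase.cru_ne_nil {π : Term1 A} (h : GoodBase π) {q : ℕ} {y v z : List A}
    (hc : Var.cru y v z ∈ baseWord q π) : y ≠ [] ∧ z ≠ [] := by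
  obtain ⟨p, l, hl⟩ := h.rank.exists_fin
  obtain ⟨p', r, hr⟩ := h.rank.exists_ini
  have hmem : ∀ {x p}, Atom.pow x p ∈ word (finWord π) ++ (π ++ word (iniWord π)) → x ≠ [] := by
    rintro x p hx rfl
    simp only [List.mem_append, pow_not_mem_word, false_or, or_false] at hx
    exact h.ne_nil ⟨_, hx⟩
  have hf : finBase π ≠ [] := fun h0 => h.ne_nil ⟨p, by rw [← h0, hl]; simp⟩
  have hi : iniBase π ≠ [] := fun h0 => h.ne_nil ⟨p', by
    rw [← h0]
    have : Atom.pow (iniBase π) p' ∈ word (iniWord π) ++ Atom.pow (iniBase π) p' :: r := by simp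
    rwa [← hr] at this⟩
  rcases mem_body_cru hc with ⟨rfl, rfl, -⟩ | ⟨rfl, p, r, hr⟩ | ⟨rfl, l, p, hr⟩ | ⟨l, p, p', r, hr⟩
  · exact ⟨hf, hi⟩
  · exact ⟨hf, hmem (p := p) (by rw [hr]; simp)⟩
  · exact ⟨hmem (p := p) (by rw [hr]; simp), hi⟩
  · exact ⟨hmem (p := p) (by rw [hr]; simp), hmem (p := p') (by rw [hr]; simp)⟩

/-- The hypotheses on `R` express that the current positive factor outlives its cancellations. The
same is obtained for the next one in `hnext`, from the pair lemma, or from the closing variable with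
empty base when no further base follows; this in turn permits the lemma on negative factors. -/
theorem Irr.tight {q : ℕ} {y v : List A} {ρ : Term1 A} {s : List (Term1 A × Term1 A)}
    (h : Irr ⟨ρ, s⟩) (hs : ∀ b ∈ s, GoodBase b.1) (hq : Term2.All (ExpPos q) ⟨ρ, s⟩)
    {R : List (Var A)}
    (hR : R.length < (altHead q y (word v ++ ρ) s).length)
    (hR' : ∀ b ∈ s.head?, ∀ S, S <:+ altHead q y (word v ++ ρ) s → S <:+ baseWord q b.1 →
      R.length + S.length < (altHead q y (word v ++ ρ) s).length) :
    Tight R (altHead q y (word v ++ ρ) s) (altTail q s) := by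
  induction s generalizing R y v ρ with
  | nil => exact hR
  | cons b s ih =>
    obtain ⟨π, ρ'⟩ := b
    have hπ : GoodBase π := hs (π, ρ') (by simp)
    have hπq := hq.2 (π, ρ') (by simp)
    -- the next positive factor
    have hnext : ∀ R', R' <+: baseWord q π → R' <+: altHead q (finBase π) (word (finWord π) ++ ρ') s →
        R'.length < (altHead q (finBase π) (word (finWord π) ++ ρ') s).length ∧
        ∀ b ∈ s.head?, ∀ S, S <:+ altHead q (finBase π) (word (finWord π) ++ ρ') s →
          S <:+ baseWord q b.1 →
          R'.length + S.length < (altHead q (finBase π) (word (finWord π) ++ ρ') s).length := by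
      intro R' h1 h2
      cases s with
      | nil =>
        refine ⟨lt_of_le_of_ne h2.length_le fun h3 => ?_, by simp⟩
        obtain rfl := h2.eq_of_length h3
        obtain ⟨v', z, B, hB⟩ := body_eq_append_cru q (finBase π) (word (finWord π) ++ ρ') []
        have h4 : Var.cru z v' [] ∈ baseWord q π := h1.subset (by rw [altHead, hB]; simp)
        exact (hπ.cru_ne_nil h4).2 rfl
      | cons b s =>
        obtain ⟨π₁, ρ₁⟩ := b
        have hπ₁ : GoodBase π₁ := hs (π₁, ρ₁) (by simp)
        have h3 : ∀ S, S <:+ altHead q (finBase π) (word (finWord π) ++ ρ') ((π₁, ρ₁) :: s) →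
            S <:+ baseWord q π₁ → R'.length + S.length <
            (altHead q (finBase π) (word (finWord π) ++ ρ') ((π₁, ρ₁) :: s)).length := by
          intro S hS hS'
          simp only [altHead, List.append_assoc] at h2 hS ⊢
          exact h.length_add_lt_pair hπ hπ₁ hπq.1 (hq.2 (π₁, ρ₁) (by simp)).1 hπq.2 h1 h2 hS hS'
        refine ⟨by simpa using h3 [] (List.nil_suffix) (List.nil_suffix), ?_⟩
        intro b hb S hS hS'
        simp at hb
        subst hb
        exact h3 S hS hS'
    refine ⟨fun S hS hS' => ⟨hR' (π, ρ') (by simp) S hS hS', fun R' h1 h2 => ?_⟩, fun R' h1 h2 => ?_⟩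
    · have h3 := (hnext R' h1 h2).1
      have h4 : S.length < (altHead q y (word v ++ ρ) ((π, ρ') :: s)).length := by
        have := hR' (π, ρ') (by simp) S hS hS'
        omega
      have hn := fun (u₁ x₁ : List A) (h5 : altHead q (finBase π) (word (finWord π) ++ ρ') s =
          body q (finBase π) (word (finWord π) ++ (ρ' ++ word u₁)) x₁) =>
        h.length_add_lt_base (R := R') (S := S) hπ (y₀ := y) (v₀ := v) (x₁ := x₁) (u₁ := u₁) hq.1
          hπq.1 hπq.2 h1 (h5 ▸ h2)
          (by rw [← h5]; rintro rfl; exact lt_irrefl _ h3)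
          (by simpa [altHead] using hS)
          (by rintro rfl; simp [altHead] at h4) hS'
      cases s with
      | nil => exact hn [] [] (by simp [altHead])
      | cons b s => exact hn (iniWord b.1) (iniBase b.1) (by simp [altHead])
    · obtain ⟨h3, h4⟩ := hnext R' h1 h2
      exact ih h.tail (fun b hb => hs b (by simp [hb])) ⟨hπq.2, fun b hb => hq.2 b (by simp [hb])⟩ h3 h4

theorem bases_subset_of_mem {α : Term2 A} {s : Term1 A × Term1 A} (hs : s ∈ α.tail) :
    bases s.1 ⊆ bases α.twoExpansion ∧ bases s.2 ⊆ bases α.twoExpansion := by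
  obtain ⟨l, r, hlr⟩ := List.append_of_mem hs
  constructor
  · intro x hx
    simp [Term2.twoExpansion, hlr, hx]
  · intro x hx
    simp [Term2.twoExpansion, hlr, hx]

theorem Step2.length_eq {α β : Term2 A} (h : Step2 α β) : β.tail.length = α.tail.length := by
  unfold Step2 at h
  induction h with
  | here r r₁ s s₁ rest h =>
    obtain ⟨δ, ε, h⟩ | ⟨r, x, y, s, τ, t, u, k, hu, h⟩ := h
    · simpa using h.inv.length.symm
    · simp
  | skip ρ π r r₁ s s₁ h ih => simpa using ih

section Canonical

variable [LinearOrder A]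

/-- A base consisting of one limit term would put two adjacent limit terms with the same base $x$
into the $2$-expansion, where $x$ is a prefix of $x^1$. -/
theorem SemiCanon.goodBase {α : Term2 A} (h : SemiCanon α) {s : Term1 A × Term1 A}
    (hs : s ∈ α.tail) : GoodBase s.1 := by
  have h1 := (bases_subset_of_mem hs).1.trans h.2.1
  have h0 : HasRankOne s.1 := h.1 s hs
  refine ⟨h0, ?_, fun h2 => (h1 h2).ne_nil rfl⟩
  by_contra! hl
  obtain ⟨x, p, hx⟩ := h0
  obtain ⟨π, ρ⟩ := s
  obtain rfl : π = [Atom.pow x p] := by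
    rcases π with _ | ⟨a, _ | ⟨b, π⟩⟩
    · simp at hx
    · simp at hx; simp [hx]
    · simp at hl
  have hx' : x ≠ [] := (h1 ⟨p, by simp⟩ : IsLyndon x).ne_nil
  obtain ⟨l, r, hlr⟩ := List.append_of_mem hs
  have h2 := h.2.2
  have h3 : α.twoExpansion = (α.head ++ (l.map fun s => s.1 ++ s.1 ++ s.2).flatten) ++ Atom.pow x p ::
      Atom.pow x p :: (ρ ++ (r.map fun s => s.1 ++ s.1 ++ s.2).flatten) := by
    simp [Term2.twoExpansion, hlr]
  rw [h3, junctions_append_pow, junctions_pow] at h2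
  have h4 := (junctions_word (v := [])).1 h2.2.1
  exact h4.2 hx' 1 ⟨[], by simp [npow]⟩

theorem Irr.exists_trim {α : Term2 A} (h : Irr α) (hα : SemiCanon α) {q : ℕ}
    (hq : α.All (ExpPos q)) :
    ∃ P t, Trim [] (altHead q [] α.head α.tail) (altTail q α.tail) P t := by
  obtain ⟨r, s⟩ := α
  have hpos : 0 < (altHead q [] r s).length := by
    cases s <;> exact length_body_pos _ _ _ _
  have h1 := h.tight (v := []) (y := []) (fun b hb => hα.goodBase hb) hq (R := [])
    (by simpa using hpos) (fun b hb S hS hS' => by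
      simp only [word_nil, List.nil_append] at hS ⊢
      rw [List.length_nil, zero_add]
      refine lt_of_le_of_ne hS.length_le fun h3 => ?_
      obtain rfl := hS.eq_of_length h3
      cases s with
      | nil => simp at hb
      | cons b' s =>
        simp only [List.head?_cons, Option.mem_def, Option.some.injEq] at hb
        subst hb
        have hgb : GoodBase b'.1 := hα.goodBase (by simp)
        rcases word_or_pow r with ⟨w, rfl⟩ | ⟨w, z, p, t, rfl⟩
        · simp only [altHead, ← word_append, body_word] at hS'
          exact (hgb.cru_ne_nil (hS'.subset (List.mem_singleton_self _))).1 rfl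
        · simp only [altHead, List.append_assoc, List.cons_append, body_word_pow] at hS'
          exact (hgb.cru_ne_nil (hS'.subset List.mem_cons_self)).1 rfl)
  obtain ⟨P, t, h2, -⟩ := h1.exists_trim (List.nil_prefix)
  exact ⟨P, t, by simpa using h2⟩

/-- At a level above all exponents of both terms, both values are alternating products of positive
words, and the one that trims without loss has the least number of negative factors. -/
theorem Irr.length_le {α β : Term2 A} (h : Irr α) (hα : SemiCanon α) (hαβ : GEq α β) :
    α.tail.length ≤ β.tail.length := by
  set q := max α.qBound β.qBound
  have h1 := all_expPos_of_qBound_le (le_max_left α.qBound β.qBound)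
  have h2 := all_expPos_of_qBound_le (le_max_right α.qBound β.qBound)
  obtain ⟨P, t, hP⟩ := h.exists_trim hα h1
  have h3 := hαβ q [] [] []
  simp only [List.nil_append, List.append_nil] at h3
  rw [gValue_eq_mk h1.1 h1.2, gValue_eq_mk h2.1 h2.2] at h3
  have := hP.length_le h3.symm
  simpa [altTail_length] using this

/-- A rule of the first step applied to `β` would yield a term with the value of `α` and a smaller
$2$-length. This spares a direct check that the later steps create no elimination or agglutination.
-/
theorem Irr.of_gEq {α β : Term2 A} (h : Irr α) (hα : SemiCanon α) (hαβ : GEq α β)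
    (hβ : BaseRank β) (hl : β.tail.length ≤ α.tail.length) : Irr β := fun γ hγ => by
  have h1 := hγ.length_lt
  have h2 := h.length_le hα fun q y v s => (hαβ q y v s).trans (hγ.gEq hβ q y v s)
  omega

theorem Step3.length_eq {α β : Term2 A} (h : Step3 α β) : β.tail.length = α.tail.length := by
  unfold Step3 at h
  induction h with
  | here r r₁ s s₁ rest h =>
    have : s₁.length = s.length := by
      obtain (⟨w, σ, τ, s, h⟩ | ⟨γ, h, h', -⟩ | (⟨r, v, s, w, x, p, q⟩ | ⟨r, v, s, w, x, p, q⟩)) := h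
      · rfl
      · have h2 := (reflTransGen_shiftRight_inv h').length
        obtain ⟨w₀, w₁, w₂, w₃, x, p₁, p₂, q₁, q₂, h, hq⟩ |
          ⟨w₀, w₁, w₂, w₃, x, p₁, p₂, q₁, q₂, h, hq, hp⟩ |
          ⟨w₀, w₁, w₂, w₃, x, z, u, p₁, p₂, q₁, q₂, h, hxz, hu⟩ := h
        all_goals
          have := (shiftEquiv_inv h).length
          simp at this h2
          omega
      · rfl
      · rfl
    simp [this]
  | skip ρ π r r₁ s s₁ h ih => simpa using ih

theorem Step2.irr {α β : Term2 A} (h : Step2 α β) (hα : SemiCanon α) (hi : Irr α) : Irr β :=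
  hi.of_gEq hα (h.gEq hα.1) (h.semiCanon hα).1 h.length_eq.le

theorem Step3.irr {α β : Term2 A} (h : Step3 α β) (hα : SemiCanon α) (hi : Irr α) : Irr β :=
  hi.of_gEq hα (h.gEq hα.1) (h.semiCanon hα).1 h.length_eq.le

end Canonical

end KappaLG

namespace KappaLG

variable {A : Type*}

/-! ### Unit shifts of a single limit term of rank two -/

/-- A shift right by a single factor. -/
inductive UnitShift : Term2 A → Term2 A → Prop
  | mk (r x s : Term1 A) (a : Atom A) (hx : x ≠ []) :
      UnitShift ⟨r, [(a :: x, a :: s)]⟩ ⟨r ++ [a], [(x ++ [a], s)]⟩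

theorem UnitShift.shiftRight {δ ε : Term2 A} (h : UnitShift δ ε) : ShiftRight δ ε := by
  obtain ⟨r, x, s, a, hx⟩ := h
  exact shiftRight_cons (x := [a]) (by simp) hx r s []

/-- Unit shifts are deterministic in both directions, so the shift class of a single limit term of
rank $2$ with its neighbours is a chain. -/
theorem unitShift_rightUnique : Relator.RightUnique (UnitShift (A := A)) := by
  rintro _ _ _ ⟨r, x, s, a, -⟩ h
  cases h
  rfl

theorem unitShift_leftUnique : Relator.LeftUnique (UnitShift (A := A)) := by
  intro δ ε ζ h h'
  obtain ⟨r, x, s, a, -⟩ := h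
  generalize hε : (⟨r ++ [a], [(x ++ [a], s)]⟩ : Term2 A) = ε' at h'
  obtain ⟨r', x', s', a', -⟩ := h'
  simp only [Term2.mk.injEq, List.cons.injEq, Prod.mk.injEq, and_true] at hε
  obtain ⟨h1, h2, rfl⟩ := hε
  obtain ⟨rfl, h3⟩ := List.append_inj' h1 rfl
  obtain ⟨rfl, -⟩ := List.append_inj' h2 rfl
  simp at h3
  rw [h3]

theorem reflTransGen_unitShift (r x y s : Term1 A) (hy : y ≠ []) :
    Relation.ReflTransGen UnitShift ⟨r, [(x ++ y, x ++ s)]⟩ ⟨r ++ x, [(y ++ x, s)]⟩ := by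
  induction x generalizing r y with
  | nil => simpa using Relation.ReflTransGen.refl
  | cons a x ih =>
    have h1 := UnitShift.mk r (x ++ y) (x ++ s) a (by simp [hy])
    have h2 := ih (r ++ [a]) (y ++ [a]) (by simp)
    refine Relation.ReflTransGen.head h1 ?_
    simpa using h2

theorem ShiftRight.reflTransGen_unitShift {δ ε : Term2 A} (h : ShiftRight δ ε)
    (hδ : δ.tail.length = 1) : Relation.ReflTransGen UnitShift δ ε := by
  unfold ShiftRight at h
  cases h with
  | here r r₁ s s₁ rest h =>
    obtain ⟨r, x, y, s, hx, hy⟩ := h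
    obtain rfl : rest = [] := by simpa using hδ
    exact KappaLG.reflTransGen_unitShift r x y s hy
  | skip ρ π r r₁ s s₁ h =>
    obtain rfl : s = [] := by simpa using hδ
    have := (inContext_shiftInv h).length
    generalize hδ : (⟨r, []⟩ : Term2 A) = δ at h
    cases h with
    | here r r₁ s s₁ rest h =>
      obtain ⟨r, x, y, s, hx, hy⟩ := h
      simp at hδ
    | skip => simp at hδ

theorem reflTransGen_unitShift_of_shiftRight {δ ε : Term2 A}
    (h : Relation.ReflTransGen ShiftRight δ ε) (hδ : δ.tail.length = 1) :
    Relation.ReflTransGen UnitShift δ ε := by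
  induction h with
  | refl => exact Relation.ReflTransGen.refl
  | tail h1 h2 ih =>
    exact ih.trans (h2.reflTransGen_unitShift (by rw [← (reflTransGen_shiftRight_inv h1).length, hδ]))

theorem ShiftEquiv.unitShift {δ ε : Term2 A} (h : ShiftEquiv δ ε) (hδ : δ.tail.length = 1) :
    Relation.ReflTransGen UnitShift δ ε ∨ Relation.ReflTransGen UnitShift ε δ := by
  induction h with
  | rel _ _ h => exact Or.inl (h.reflTransGen_unitShift hδ)
  | refl => exact Or.inl Relation.ReflTransGen.refl
  | symm _ _ h ih => exact (ih (by rw [(shiftEquiv_inv h).length, hδ])).symm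
  | trans _ _ _ h1 h2 ih1 ih2 =>
    rcases ih1 hδ, ih2 (by rw [← (shiftEquiv_inv h1).length, hδ]) with ⟨h3 | h3, h4 | h4⟩
    · exact Or.inl (h3.trans h4)
    · have := Relation.ReflTransGen.total_of_right_unique (r := Function.swap UnitShift)
        (fun _ _ _ h h' => unitShift_leftUnique h h')
        (Relation.reflTransGen_swap.2 h3) (Relation.reflTransGen_swap.2 h4)
      exact this.symm.imp Relation.reflTransGen_swap.1 Relation.reflTransGen_swap.1
    · exact Relation.ReflTransGen.total_of_right_unique unitShift_rightUnique h3 h4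
    · exact Or.inr (h4.trans h3)

/-! ### Shift conditions -/

/-- The factors `π` and `ρ` do not begin with the same factor. -/
def NoShift (π ρ : Term1 A) : Prop := ∀ a x s, π = a :: x → ρ ≠ a :: s

/-- If `ρ` is empty, then `π` and `π'` do not begin with the same letter. -/
def NoExpansion (π ρ π' : Term1 A) : Prop :=
  ρ = [] → ∀ a x s, π = Atom.letter a :: x → π' ≠ Atom.letter a :: s

/-- No shift right and no extended shift right with an empty middle term is possible. -/
def ShiftReduced : List (Term1 A × Term1 A) → Prop
  | [] => True
  | b :: s => NoShift b.1 b.2 ∧ (∀ b' ∈ s.head?, NoExpansion b.1 b.2 b'.1) ∧ ShiftReduced s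

theorem NoShift.not_unitShift {r π ρ : Term1 A} {ε : Term2 A} (h : NoShift π ρ) :
    ¬ UnitShift ⟨r, [(π, ρ)]⟩ ε := by
  generalize hδ : (⟨r, [(π, ρ)]⟩ : Term2 A) = δ
  rintro ⟨r', x, s, a, -⟩
  simp only [Term2.mk.injEq, List.cons.injEq, Prod.mk.injEq, and_true] at hδ
  exact h a x s hδ.2.1 hδ.2.2

theorem shiftRight_singleton {r : Term1 A} {b : Term1 A × Term1 A} {ε : Term2 A}
    (h' : ShiftRight ⟨r, [b]⟩ ε) : ShiftRule ⟨r, [b]⟩ ε := by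
  unfold ShiftRight at h'
  generalize hδ : (⟨r, [b]⟩ : Term2 A) = δ at h'
  cases h' with
  | here r r₁ s s₁ rest h =>
    obtain ⟨r, x, y, s, hx, hy⟩ := h
    simp at hδ
    obtain ⟨rfl, rfl, rfl⟩ := hδ
    exact ⟨_, _, _, _, hx, hy⟩
  | skip ρ π r r₁ s s₁ h =>
    simp at hδ
    obtain ⟨rfl, rfl, rfl⟩ := hδ
    generalize hδ : (⟨_, []⟩ : Term2 A) = δ at h
    cases h with
    | here r r₁ s s₁ rest h =>
      obtain ⟨r, x, y, s, hx, hy⟩ := h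
      simp at hδ
    | skip => simp at hδ

theorem NoShift.not_shiftRight {r π ρ : Term1 A} {ε : Term2 A} (h : NoShift π ρ) :
    ¬ ShiftRight ⟨r, [(π, ρ)]⟩ ε := fun h' => by
  have h1 := shiftRight_singleton h'
  generalize hδ : (⟨r, [(π, ρ)]⟩ : Term2 A) = δ at h1
  obtain ⟨r', x, y, s, hx, hy⟩ := h1
  simp only [Term2.mk.injEq, List.cons.injEq, Prod.mk.injEq, and_true] at hδ
  obtain ⟨a, x, rfl⟩ := List.exists_cons_of_ne_nil hx
  exact h a (x ++ y) (x ++ s) hδ.2.1 hδ.2.2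

theorem eq_of_unitShift_normal {δ ε ζ : Term2 A} (h : Relation.ReflTransGen UnitShift δ ε)
    (h' : Relation.ReflTransGen UnitShift δ ζ) (hε : ∀ ξ, ¬ UnitShift ε ξ) (hζ : ∀ ξ, ¬ UnitShift ζ ξ) :
    ε = ζ := by
  rcases Relation.ReflTransGen.total_of_right_unique unitShift_rightUnique h h' with h1 | h1
  · exact (h1.cases_head).elim id fun ⟨ξ, h2, _⟩ => absurd h2 (hε ξ)
  · exact (h1.cases_head).elim Eq.symm fun ⟨ξ, h2, _⟩ => absurd h2 (hζ ξ)

/-- Normality is tested on the smallest instances: the shift of one factor, and the expansion with a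
one-letter $u'$ and $k=0$. Each of them lengthens the term before the base, so neither can leave the
term unchanged. -/
theorem shiftReduced_of_isNormal {α : Term2 A} (h : IsNormal Step2 α)
    (hα : ∀ b ∈ α.tail, GoodBase b.1) : ShiftReduced α.tail := by
  obtain ⟨r, s⟩ := α
  induction s generalizing r with
  | nil => trivial
  | cons b s ih =>
    obtain ⟨π, ρ⟩ := b
    refine ⟨?_, ?_, ih ρ (fun β hβ => ?_) fun b hb => hα b (by simp [hb])⟩
    · rintro a x s' rfl rfl
      have hx : x ≠ [] := by
        rintro rfl
        simpa using (hα ([a], a :: s') (by simp)).length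
      have := h _ (InContext.here _ _ [_] [_] s
        (ExtendedShiftRule.plain _ _ (ShiftRule.mk r [a] x s' (by simp) hx)))
      simp at this
    · rintro ⟨π', ρ'⟩ hb rfl a x s' rfl hπ'
      cases s with
      | nil => simp at hb
      | cons b s =>
        simp at hb hπ'
        subst hb hπ'
        have := h _ (InContext.here _ _ [_, _] [_, _] s
          (ExtendedShiftRule.expand r [Atom.letter a] x [] s' ρ' [a] 0 (by simp) (by simp [npow])))
        simp at this
    · have := h _ (InContext.skip r π _ _ _ _ hβ)
      simp only [Term2.mk.injEq, List.cons.injEq, Prod.mk.injEq, true_and] at this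
      exact Term2.ext this.1 this.2

/-! ### Shift conditions are preserved by the third step -/

/-- The term after `π₀` is modified only from its limit term `x` on. A new shift would thus need
`w₀` empty and `π₀` beginning with a limit term of base `x`, but then an inner agglutination
applies. -/
theorem Irr.noShift_left {r₀ π₀ w₀ l m m' ρ : Term1 A} {x : List A} {p₁ p₂ p' : ℤ}
    {s : List (Term1 A × Term1 A)}
    (h : Irr ⟨r₀, (π₀, w₀ ++ Atom.pow x p₁ :: m) :: (l ++ Atom.pow x p₂ :: m, ρ) :: s⟩)
    (hl : 2 ≤ (l ++ Atom.pow x p₂ :: m).length) (hS : NoShift π₀ (w₀ ++ Atom.pow x p₁ :: m)) :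
    NoShift π₀ (w₀ ++ Atom.pow x p' :: m') := by
  rintro a w t rfl ht
  rcases w₀ with _ | ⟨b, w₀⟩
  · simp only [List.nil_append, List.cons.injEq] at ht
    obtain ⟨rfl, rfl⟩ := ht
    exact h.false_of_agglutination_inner hl
  · simp only [List.cons_append, List.cons.injEq] at ht
    obtain ⟨rfl, rfl⟩ := ht
    exact hS _ _ _ rfl rfl

theorem noExpansion_of_ne_nil {π ρ π' : Term1 A} (h : ρ ≠ []) : NoExpansion π ρ π' :=
  fun h' => absurd h' h

theorem noExpansion_pow {π ρ : Term1 A} {x : List A} {p : ℤ} {s : Term1 A} :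
    NoExpansion π ρ (Atom.pow x p :: s) := by
  rintro - a x s - h
  simp at h

/-- What is required from a replacement for the preservation of the shift conditions. -/
structure ShiftPreserving (s : List (Term1 A × Term1 A)) (r π ρ : Term1 A) (r₁ π₁ ρ₁ : Term1 A) :
    Prop where
  noShift : NoShift π₁ ρ₁
  noExpansion : ∀ π', NoExpansion π ρ π' → NoExpansion π₁ ρ₁ π'
  noShift_left : ∀ r₀ π₀, Irr ⟨r₀, (π₀, r) :: (π, ρ) :: s⟩ → NoShift π₀ r → NoShift π₀ r₁
  noExpansion_left : ∀ π₀, NoShift π₀ r → NoExpansion π₀ r π → NoExpansion π₀ r₁ π₁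

theorem Shortening1.shiftPreserving {s : List (Term1 A × Term1 A)} {w σ τ t : Term1 A}
    (h : SameOmegaPortions σ τ) (hS : NoShift (τ ++ σ) t) :
    ShiftPreserving s (w ++ σ) (τ ++ σ) t w τ t := by
  obtain ⟨u, z, y, v, ⟨p, R, hσ⟩, ⟨p', R', hτ⟩, -, -⟩ := h
  refine ⟨?_, ?_, ?_, ?_⟩
  · rintro a x s rfl
    exact hS a _ s rfl
  · rintro π' h rfl a x s rfl
    exact h rfl a _ s rfl
  · rintro r₀ π₀ - h a x s h1 rfl
    exact h a x _ h1 rfl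
  · rintro π₀ h - rfl a x s h1 h2
    rw [h2] at hτ
    cases u with
    | nil => simp at hτ
    | cons b u =>
      simp at hτ
      exact h _ _ (word u ++ Atom.pow z p :: R) h1 (by rw [hσ, hτ.1]; simp)

theorem Shortening3.shiftPreserving {s : List (Term1 A × Term1 A)} {r π ρ : Term1 A} {ε : Term2 A}
    (h : Shortening3 ⟨r, [(π, ρ)]⟩ ε) (hi : Irr ⟨r, (π, ρ) :: s⟩) (hπ : 2 ≤ π.length)
    (hS : NoShift π ρ) :
    ∃ r₁ π₁ ρ₁, ε = ⟨r₁, [(π₁, ρ₁)]⟩ ∧ ShiftPreserving s r π ρ r₁ π₁ ρ₁ := by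
  generalize hδ : (⟨r, [(π, ρ)]⟩ : Term2 A) = δ at h
  obtain ⟨r', v, t, w, x, p, q⟩ | ⟨r', v, t, w, x, p, q⟩ := h
  · simp only [Term2.mk.injEq, List.cons.injEq, Prod.mk.injEq, and_true] at hδ
    obtain ⟨rfl, rfl, rfl⟩ := hδ
    refine ⟨_, _, _, rfl, ?_⟩
    -- A non-empty `w` would allow a shift right. So only two leading exponents change, and their
    -- difference stays non-zero.
    cases w with
    | cons b w => exact absurd rfl (hS _ _ _ rfl)
    | nil =>
      have hpq : q ≠ p := by rintro rfl; exact hS _ _ _ rfl rfl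
      refine ⟨?_, ?_, ?_, ?_⟩
      · rintro a y t' h1 h2
        simp at h1 h2
        rw [← h1.1] at h2
        simp at h2
        omega
      · exact fun _ _ => noExpansion_of_ne_nil (by simp)
      · exact fun _ _ _ h => h
      · exact fun _ _ _ => noExpansion_pow
  · simp only [Term2.mk.injEq, List.cons.injEq, Prod.mk.injEq, and_true] at hδ
    obtain ⟨rfl, rfl, rfl⟩ := hδ
    refine ⟨_, _, _, rfl, ?_, ?_, ?_, ?_⟩
    · rintro a y t' h1 rfl
      rcases v with _ | ⟨b, v⟩
      · simp at h1
        obtain ⟨rfl, rfl⟩ := h1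
        exact hi.false_of_elimination (l := []) hπ
      · simp at h1
        exact hS b _ t' rfl (by rw [h1.1])
    · rintro π' h rfl a y t' h1
      rcases v with _ | ⟨b, v⟩
      · simp at h1
      · simp at h1
        exact h rfl a _ t' (by rw [← h1.1]; rfl)
    · exact fun r₀ π₀ h1 h2 => h1.noShift_left hπ h2
    · exact fun _ _ _ => noExpansion_of_ne_nil (by simp)

/-- As no shift right is possible, the given term is the right end of its chain, and the pattern
leads to it by unit shifts. For $q_1\ne q_2$ there are none; for $q_1=q_2$ they pass `z` and a
common prefix `P` of `w₂` and `w₃`. They cannot go beyond `x`, since that would reveal an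
elimination. -/
theorem shiftEquiv_pattern {r π ρ w₀ w₁ w₂ w₃ : Term1 A} {x z : List A} {p₁ p₂ q₁ q₂ : ℤ}
    (h : ShiftEquiv ⟨r, [(π, ρ)]⟩ ⟨w₀ ++ Atom.pow x p₁ :: w₁,
        [(Atom.pow z q₁ :: w₂ ++ Atom.pow x p₂ :: w₁, Atom.pow z q₂ :: w₃)]⟩)
    {s : List (Term1 A × Term1 A)} (hi : Irr ⟨r, (π, ρ) :: s⟩) (hS : NoShift π ρ) :
    (q₁ ≠ q₂ ∧ r = w₀ ++ Atom.pow x p₁ :: w₁ ∧ π = Atom.pow z q₁ :: w₂ ++ Atom.pow x p₂ :: w₁ ∧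
      ρ = Atom.pow z q₂ :: w₃) ∨
    ∃ P Y, q₁ = q₂ ∧ w₂ = P ++ Y ∧ w₃ = P ++ ρ ∧
      r = w₀ ++ Atom.pow x p₁ :: (w₁ ++ Atom.pow z q₁ :: P) ∧
      π = Y ++ Atom.pow x p₂ :: (w₁ ++ Atom.pow z q₁ :: P) := by
  have key : ∀ δ : Term2 A, Relation.ReflTransGen UnitShift ⟨w₀ ++ Atom.pow x p₁ :: w₁,
      [(Atom.pow z q₁ :: w₂ ++ Atom.pow x p₂ :: w₁, Atom.pow z q₂ :: w₃)]⟩ δ →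
      ∃ P Y ρ', P ++ Y = Atom.pow z q₁ :: w₂ ∧ P ++ ρ' = Atom.pow z q₂ :: w₃ ∧
      δ = ⟨w₀ ++ Atom.pow x p₁ :: w₁ ++ P, [(Y ++ Atom.pow x p₂ :: w₁ ++ P, ρ')]⟩ := by
    intro δ hδ
    induction hδ with
    | refl => exact ⟨[], _, _, rfl, rfl, by simp⟩
    | tail _ h1 ih =>
      obtain ⟨P, Y, ρ', h2, h3, rfl⟩ := ih
      generalize hδ : (⟨_, _⟩ : Term2 A) = δ at h1
      obtain ⟨r', y, t, a, -⟩ := h1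
      simp only [Term2.mk.injEq, List.cons.injEq, Prod.mk.injEq, and_true] at hδ
      obtain ⟨rfl, h4, rfl⟩ := hδ
      rcases Y with _ | ⟨b, Y⟩
      · exfalso
        simp only [List.nil_append, List.cons_append, List.cons.injEq] at h4
        obtain ⟨rfl, rfl⟩ := h4
        rw [List.append_nil] at h2
        subst h2
        refine hi.not_elimination w₀ (w₁ ++ Atom.pow z q₁ :: w₂) t x p₁ p₂ p₂ (h.trans ?_)
        rw [← h3]
        simpa using shiftEquiv_cons (x := Atom.pow z q₁ :: w₂) (y := Atom.pow x p₂ :: w₁) (by simp; omega)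
          (w₀ ++ Atom.pow x p₁ :: w₁) (Atom.pow x p₂ :: t) []
      · simp only [List.cons_append, List.cons.injEq] at h4
        obtain ⟨rfl, rfl⟩ := h4
        exact ⟨P ++ [b], Y, t, by simpa using h2, by simpa using h3, by simp⟩
  have h1 : Relation.ReflTransGen UnitShift ⟨w₀ ++ Atom.pow x p₁ :: w₁,
      [(Atom.pow z q₁ :: w₂ ++ Atom.pow x p₂ :: w₁, Atom.pow z q₂ :: w₃)]⟩ ⟨r, [(π, ρ)]⟩ := by
    rcases h.unitShift rfl with h1 | h1
    · rcases h1.cases_head with h2 | ⟨ξ, h2, -⟩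
      · rw [h2]
      · exact absurd h2 hS.not_unitShift
    · exact h1
  obtain ⟨P, Y, ρ', h2, h3, h4⟩ := key _ h1
  simp only [Term2.mk.injEq, List.cons.injEq, Prod.mk.injEq, and_true] at h4
  obtain ⟨rfl, rfl, rfl⟩ := h4
  rcases P with _ | ⟨b, P⟩
  · simp only [List.nil_append] at h2 h3
    subst h2 h3
    refine Or.inl ⟨?_, by simp, by simp, rfl⟩
    rintro rfl
    exact hS _ _ _ rfl rfl
  · simp only [List.cons_append, List.cons.injEq] at h2 h3
    obtain ⟨rfl, rfl⟩ := h2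
    obtain ⟨h3, rfl⟩ := h3
    simp only [Atom.pow.injEq, true_and] at h3
    exact Or.inr ⟨P, Y, h3, rfl, rfl, by simp, by simp⟩

theorem shiftPreserving_pow {w₀ w₁ w₂ w₃ m' m'' : Term1 A} {x z : List A}
    {p₁ p₂ q₁ q₂ p' q₁' q₂' : ℤ} {s : List (Term1 A × Term1 A)} (hq : q₁' ≠ q₂')
    (hl : 2 ≤ (Atom.pow z q₁ :: w₂ ++ Atom.pow x p₂ :: w₁).length) :
    ShiftPreserving s (w₀ ++ Atom.pow x p₁ :: w₁) (Atom.pow z q₁ :: w₂ ++ Atom.pow x p₂ :: w₁)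
      (Atom.pow z q₂ :: w₃) (w₀ ++ Atom.pow x p' :: m') (Atom.pow z q₁' :: m'') (Atom.pow z q₂' :: w₃) := by
  refine ⟨?_, fun _ _ => noExpansion_of_ne_nil (by simp),
    fun r₀ π₀ h1 h2 => Irr.noShift_left (l := Atom.pow z q₁ :: w₂) h1 hl h2, fun _ _ _ => noExpansion_of_ne_nil (by simp)⟩
  rintro a y t' h1 h2
  simp at h1 h2
  rw [← h1.1] at h2
  simp at h2
  omega

theorem shiftPreserving_right {w₀ w₁ w₂ w₃ m'' : Term1 A} {x z : List A}
    {p₁ p₂ q₁ q₂ q₁' q₂' : ℤ} {s : List (Term1 A × Term1 A)} (hq : q₁' ≠ q₂') :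
    ShiftPreserving s (w₀ ++ Atom.pow x p₁ :: w₁) (Atom.pow z q₁ :: w₂ ++ Atom.pow x p₂ :: w₁)
      (Atom.pow z q₂ :: w₃) w₀ (Atom.pow z q₁' :: m'') (Atom.pow z q₂' :: w₃) := by
  refine ⟨?_, fun _ _ => noExpansion_of_ne_nil (by simp), ?_, fun _ _ _ => noExpansion_pow⟩
  · rintro a y t' h1 h2
    simp at h1 h2
    rw [← h1.1] at h2
    simp at h2
    omega
  · rintro r₀ π₀ - h a y t h1 rfl
    exact h a y _ h1 rfl

theorem shiftPreserving_append {w₀ m m' m'' Y ρ : Term1 A} {x : List A}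
    {p₁ p₂ p' : ℤ} {s : List (Term1 A × Term1 A)}
    (hl : 2 ≤ (Y ++ Atom.pow x p₂ :: m).length) (hS : NoShift (Y ++ Atom.pow x p₂ :: m) ρ)
    (hi : Irr ⟨w₀ ++ Atom.pow x p₁ :: m, (Y ++ Atom.pow x p₂ :: m, ρ) :: s⟩) (q : ℤ) :
    ShiftPreserving s (w₀ ++ Atom.pow x p₁ :: m) (Y ++ Atom.pow x p₂ :: m) ρ
      (w₀ ++ Atom.pow x p' :: m') (Y ++ Atom.pow x q :: m'') ρ := by
  refine ⟨?_, ?_, fun r₀ π₀ h1 h2 => h1.noShift_left hl h2, fun _ _ _ => noExpansion_of_ne_nil (by simp)⟩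
  · rintro a y t' h1 rfl
    rcases Y with _ | ⟨b, Y⟩
    · simp at h1
      obtain ⟨rfl, rfl⟩ := h1
      exact hi.false_of_elimination (l := []) hl
    · simp at h1
      exact hS b _ t' rfl (by rw [h1.1])
  · rintro π' h rfl a y t' h1
    rcases Y with _ | ⟨b, Y⟩
    · simp at h1
    · simp at h1
      exact h rfl a _ t' (by rw [← h1.1]; rfl)

/-- A chain has only one right end, so the shifts that conclude the replacement are determined. It
suffices to exhibit a reachable term without shifts and to check the conditions for it. -/
theorem Shortening2.shiftPreserving [LinearOrder A] {s : List (Term1 A × Term1 A)} {r π ρ : Term1 A}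
    {ε : Term2 A} (h : Shortening2 ⟨r, [(π, ρ)]⟩ ε) (hi : Irr ⟨r, (π, ρ) :: s⟩) (hπ : 2 ≤ π.length)
    (hS : NoShift π ρ) :
    ∃ r₁ π₁ ρ₁, ε = ⟨r₁, [(π₁, ρ₁)]⟩ ∧ ShiftPreserving s r π ρ r₁ π₁ ρ₁ := by
  obtain ⟨γ, h1, h2, h3⟩ := h
  have h4 : ∀ ξ, ¬ UnitShift ε ξ := fun ξ hξ => h3 ξ hξ.shiftRight
  have hε : ∀ {r₀ π₀ ρ₀ r₁ π₁ ρ₁ : Term1 A}, γ = ⟨r₀, [(π₀, ρ₀)]⟩ →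
      Relation.ReflTransGen UnitShift γ ⟨r₁, [(π₁, ρ₁)]⟩ →
      ShiftPreserving s r π ρ r₁ π₁ ρ₁ → ∃ r₁ π₁ ρ₁, ε = ⟨r₁, [(π₁, ρ₁)]⟩ ∧
        ShiftPreserving s r π ρ r₁ π₁ ρ₁ := by
    rintro r₀ π₀ ρ₀ r₁ π₁ ρ₁ rfl h5 h6
    have h7 := reflTransGen_unitShift_of_shiftRight h2 rfl
    exact ⟨r₁, π₁, ρ₁, eq_of_unitShift_normal h7 h5 h4 (fun _ => h6.noShift.not_unitShift), h6⟩
  obtain ⟨w₀, w₁, w₂, w₃, x, p₁, p₂, q₁, q₂, h, hq⟩ |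
    ⟨w₀, w₁, w₂, w₃, x, p₁, p₂, q₁, q₂, h, hq, hp⟩ |
    ⟨w₀, w₁, w₂, w₃, x, z, u, p₁, p₂, q₁, q₂, h, hxz, hu⟩ := h1
  · obtain ⟨h5, -⟩ | ⟨P, Y, rfl, rfl, rfl, rfl, rfl⟩ := shiftEquiv_pattern h hi hS
    · exact absurd (by omega) h5
    · refine hε rfl (r₁ := w₀ ++ Atom.pow x (p₁ - p₂) :: P) (π₁ := Y ++ Atom.pow x 0 :: P) (ρ₁ := ρ) ?_
        (shiftPreserving_append hπ hS hi 0)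
      simpa using reflTransGen_unitShift (w₀ ++ [Atom.pow x (p₁ - p₂)]) P (Y ++ [Atom.pow x 0]) ρ (by simp)
  · obtain ⟨h5, rfl, rfl, rfl⟩ | ⟨P, Y, rfl, -⟩ := shiftEquiv_pattern h hi hS
    · exact hε rfl Relation.ReflTransGen.refl (shiftPreserving_right (fun h => hq h.symm))
    · simp at hq
  · obtain ⟨h5, rfl, rfl, rfl⟩ | ⟨P, Y, rfl, rfl, rfl, rfl, rfl⟩ := shiftEquiv_pattern h hi hS
    · exact hε rfl Relation.ReflTransGen.refl (shiftPreserving_pow (by omega) hπ)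
    · refine hε rfl (r₁ := w₀ ++ Atom.pow x (p₁ - p₂) :: (word u ++ Atom.pow z 0 :: P))
        (π₁ := Y ++ Atom.pow x 0 :: (word u ++ Atom.pow z 0 :: P)) (ρ₁ := ρ) ?_
        (shiftPreserving_append hπ hS hi 0)
      have h8 := reflTransGen_unitShift (w₀ ++ Atom.pow x (p₁ - p₂) :: word u) (Atom.pow z 0 :: P)
        (Y ++ Atom.pow x 0 :: word u) ρ (by simp)
      rw [sub_self]
      simpa using h8

theorem Step3.shiftReduced [LinearOrder A] {α β : Term2 A} (h : Step3 α β) (hi : Irr α)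
    (hα : ∀ b ∈ α.tail, GoodBase b.1) (hS : ShiftReduced α.tail) : ShiftReduced β.tail := by
  -- A replacement may alter the term after the preceding base. The shift conditions for that base
  -- are therefore carried along in the induction.
  have key : ∀ α β : Term2 A, InContext (fun δ ε : Term2 A => Shortening1 δ ε ∨ Shortening2 δ ε ∨ Shortening3 δ ε) α β →
      Irr α → (∀ b ∈ α.tail, GoodBase b.1) → ShiftReduced α.tail → ShiftReduced β.tail ∧
      ∀ r₀ π₀, Irr ⟨r₀, (π₀, α.head) :: α.tail⟩ → NoShift π₀ α.head →
        (∀ b ∈ α.tail.head?, NoExpansion π₀ α.head b.1) →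
        NoShift π₀ β.head ∧ ∀ b ∈ β.tail.head?, NoExpansion π₀ β.head b.1 := by
    intro α β h
    induction h with
    | here r r₁ s s₁ rest h =>
      intro hi hα hS
      obtain ⟨π, ρ, rfl⟩ : ∃ π ρ, s = [(π, ρ)] := by
        have : s.length = 1 := by
          rcases h with ⟨w, σ, τ, s, h⟩ | ⟨γ, h, -⟩ | (⟨r, v, s, w, x, p, q⟩ | ⟨r, v, s, w, x, p, q⟩)
          · rfl
          · obtain ⟨w₀, w₁, w₂, w₃, x, p₁, p₂, q₁, q₂, h, hq⟩ |
              ⟨w₀, w₁, w₂, w₃, x, p₁, p₂, q₁, q₂, h, hq, hp⟩ |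
              ⟨w₀, w₁, w₂, w₃, x, z, u, p₁, p₂, q₁, q₂, h, hxz, hu⟩ := h
            · exact (shiftEquiv_inv h).length
            · exact (shiftEquiv_inv h).length
            · exact (shiftEquiv_inv h).length
          · rfl
          · rfl
        obtain ⟨b, rfl⟩ := List.length_eq_one_iff.1 this
        exact ⟨b.1, b.2, rfl⟩
      rw [List.singleton_append] at hi hα hS
      have hπ := (hα (π, ρ) (by simp)).length
      obtain ⟨r₂, π₁, ρ₁, h1, h2⟩ : ∃ r₂ π₁ ρ₁, (⟨r₁, s₁⟩ : Term2 A) = ⟨r₂, [(π₁, ρ₁)]⟩ ∧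
          ShiftPreserving rest r π ρ r₂ π₁ ρ₁ := by
        rcases h with h | h | h
        · generalize hδ : (⟨r, [(π, ρ)]⟩ : Term2 A) = δ at h
          obtain ⟨w, σ, τ, t, h⟩ := h
          simp only [Term2.mk.injEq, List.cons.injEq, Prod.mk.injEq, and_true] at hδ
          obtain ⟨rfl, rfl, rfl⟩ := hδ
          exact ⟨_, _, _, rfl, Shortening1.shiftPreserving h hS.1⟩
        · exact h.shiftPreserving hi hπ hS.1
        · exact h.shiftPreserving hi hπ hS.1
      simp only [Term2.mk.injEq] at h1
      obtain ⟨rfl, rfl⟩ := h1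
      exact ⟨⟨h2.noShift, fun b hb => h2.noExpansion _ (hS.2.1 b hb), hS.2.2⟩,
        fun r₀ π₀ h3 h4 h5 => ⟨h2.noShift_left r₀ π₀ h3 h4, by
          simpa using h2.noExpansion_left π₀ h4 (h5 (π, ρ) (by simp))⟩⟩
    | skip ρ π r r₁ s s₁ h ih =>
      intro hi hα hS
      obtain ⟨h1, h2⟩ := ih hi.tail (fun b hb => hα b (by simp [hb])) hS.2.2
      obtain ⟨h3, h4⟩ := h2 ρ π hi hS.1 hS.2.1
      exact ⟨⟨h3, h4, h1⟩, fun r₀ π₀ _ h5 h6 => ⟨h5, by simpa using h6⟩⟩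
  exact (key α β h hi hα hS).1

end KappaLG

namespace KappaLG

variable {A : Type*}

/-! ### Connectors -/

theorem npow_add {X : Type*} (x : List X) (m n : ℕ) : npow x (m + n) = npow x m ++ npow x n := by
  rw [npow, List.replicate_add, List.flatten_append]; rfl

theorem npow_one {X : Type*} (x : List X) : npow x 1 = x := by simp [npow]

theorem npow_succ {X : Type*} (x : List X) (n : ℕ) : npow x (n + 1) = x ++ npow x n := by
  simp [npow, List.replicate_succ]

theorem length_npow {X : Type*} (x : List X) (n : ℕ) : (npow x n).length = n * x.length := by
  simp [npow]

/-- Commuting words are powers of a common word. -/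
theorem exists_npow_of_comm {X : Type*} {x z : List X} (h : x ++ z = z ++ x) :
    ∃ t m n, x = npow t m ∧ z = npow t n := by
  induction hn : x.length + z.length using Nat.strong_induction_on generalizing x z with
  | _ n ih =>
    rcases eq_or_ne x [] with rfl | hx
    · exact ⟨z, 0, 1, by simp [npow], (npow_one z).symm⟩
    rcases eq_or_ne z [] with rfl | hz
    · exact ⟨x, 1, 0, (npow_one x).symm, by simp [npow]⟩
    have hx' := List.length_pos_iff.2 hx
    have hz' := List.length_pos_iff.2 hz
    rcases List.append_eq_append_iff.1 h with ⟨w, hw, h'⟩ | ⟨w, hw, h'⟩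
    · obtain rfl := hw
      have h1 : x ++ w = w ++ x := by simpa using h
      obtain ⟨t, i, j, h2, h3⟩ := ih (x.length + w.length) (by simp at hn; omega) h1 rfl
      exact ⟨t, i, i + j, h2, by rw [npow_add, ← h2, ← h3]⟩
    · obtain rfl := hw
      have h1 : w ++ z = z ++ w := by simpa using h
      obtain ⟨t, i, j, h2, h3⟩ := ih (w.length + z.length) (by simp at hn; omega) h1 rfl
      exact ⟨t, j + i, j, by rw [npow_add, ← h2, ← h3], h3⟩

theorem IsPrimitive.eq_one {x t : List A} {n : ℕ} (h : IsPrimitive x) (hx : x = npow t n) : x = t := by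
  rcases n with _ | _ | n
  · refine absurd ?_ (h [] 2 (by norm_num))
    rw [npow_nil]
    simpa [npow] using hx
  · rwa [zero_add, npow_one] at hx
  · exact absurd hx (h t _ (by omega))

/-- Both $xz$ and $zx$ are prefixes of one power of $x$, so the two words commute, and commuting
primitive words coincide. -/
theorem eq_of_npow_eq {x z : List A} (hx : IsPrimitive x) (hz : IsPrimitive z) {m n : ℕ}
    (hm : 0 < m) (hn : 0 < n) (h : npow x m = npow z n) : x = z := by
  obtain ⟨m, rfl⟩ := Nat.exists_eq_succ_of_ne_zero hm.ne'
  obtain ⟨n, rfl⟩ := Nat.exists_eq_succ_of_ne_zero hn.ne'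
  have h1 : x ++ z <+: npow x (m + 1) ++ npow x (m + 1) := by
    refine ⟨npow z n ++ npow x m, ?_⟩
    rw [show x ++ z ++ (npow z n ++ npow x m) = x ++ ((z ++ npow z n) ++ npow x m) by simp,
      ← npow_succ, ← h, ← npow_add, ← npow_succ, ← npow_add]
    congr 1
  have h2 : z ++ x <+: npow x (m + 1) ++ npow x (m + 1) := by
    refine ⟨npow x m ++ npow z n, ?_⟩
    rw [show z ++ x ++ (npow x m ++ npow z n) = z ++ ((x ++ npow x m) ++ npow z n) by simp,
      ← npow_succ, h, ← npow_add, ← npow_succ, ← npow_add]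
    congr 1
  have h3 := List.prefix_of_prefix_length_le h1 h2 (by simp; omega)
  have h4 : x ++ z = z ++ x := h3.eq_of_length (by simp; omega)
  obtain ⟨t, i, j, h5, h6⟩ := exists_npow_of_comm h4
  rw [hx.eq_one h5, hz.eq_one h6]

/-- Every single limit term with its two neighbours can be shifted right as far as possible. -/
theorem exists_shiftRight_normal (r π ρ : Term1 A) : ∃ r₁ π₁ ρ₁,
    Relation.ReflTransGen ShiftRight ⟨r, [(π, ρ)]⟩ ⟨r₁, [(π₁, ρ₁)]⟩ ∧
      (∀ ζ, ¬ ShiftRight ⟨r₁, [(π₁, ρ₁)]⟩ ζ) ∧ π₁.length = π.length := by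
  induction hn : ρ.length using Nat.strong_induction_on generalizing r π ρ with
  | _ n ih =>
    by_cases h : ∃ ζ, ShiftRight ⟨r, [(π, ρ)]⟩ ζ
    · obtain ⟨ζ, hζ⟩ := h
      have h1 := shiftRight_singleton hζ
      generalize hδ : (⟨r, [(π, ρ)]⟩ : Term2 A) = δ at h1
      obtain ⟨r', x, y, s, hx, hy⟩ := h1
      simp only [Term2.mk.injEq, List.cons.injEq, Prod.mk.injEq, and_true] at hδ
      obtain ⟨rfl, rfl, rfl⟩ := hδ
      have hx' := List.length_pos_iff.2 hx
      obtain ⟨r₁, π₁, ρ₁, h1, h2, h3⟩ := ih s.length (by simp at hn; omega) (r ++ x) (y ++ x) s rfl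
      exact ⟨r₁, π₁, ρ₁, h1.head hζ, h2, by rw [h3]; simp [add_comm]⟩
    · push Not at h
      exact ⟨r, π, ρ, .refl, h, rfl⟩

section Canonical

variable [LinearOrder A]

theorem isCanonical1_two {x z u : List A} (hx : IsLyndon x) (hz : IsLyndon z) {k l : ℤ}
    (h : GoodJunction x u z) : IsCanonical1 (Atom.pow x k :: (word u ++ [Atom.pow z l])) := by
  refine Canon.isCanonical1 ⟨by simp [Set.insert_subset_iff, hx, hz], ?_⟩
  rw [junctions_pow, junctions_append_pow, junctions_word, ← word_nil, junctions_word, junctions_word]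
  refine ⟨⟨fun h0 h1 => h0 (by simpa using h1), fun h => absurd rfl h⟩, h,
    ⟨fun h => absurd rfl h, fun h0 l h1 => h0 ?_⟩⟩
  rw [npow_nil] at h1
  simpa using h1

/-- Take $k$ maximal with $x^k$ a prefix of a power of $z$, then $l$ minimal with $x^k$ a prefix of
$z^l$, and let $u$ be the remainder. The prefix condition on the junction comes from the choice of
$k$, the suffix condition from that of $l$. -/
theorem exists_isConnector_of_ne {x z : List A} (hx : IsLyndon x) (hz : IsLyndon z) (hxz : x ≠ z) :
    ∃ u, IsConnector x z u := by
  classical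
  have hx0 := List.length_pos_iff.2 hx.ne_nil
  have hz0 := List.length_pos_iff.2 hz.ne_nil
  -- A bound for $k$ exists: if $x^{|z|}$ were a prefix of a power of $z$, then $x^{|z|}=z^{|x|}$ by
  -- length, against $x\ne z$.
  have hbound : ∀ k, (∃ l, npow x k <+: npow z l) → k < z.length := by
    rintro k ⟨l, hl⟩
    by_contra! hk
    refine hxz (eq_of_npow_eq hx.1 hz.1 (m := z.length) (n := x.length) hz0 hx0 ?_)
    have h1 : npow x z.length <+: npow z (l + x.length) := by
      obtain ⟨k', rfl⟩ := Nat.exists_eq_add_of_le hk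
      rw [npow_add] at hl ⊢
      exact (List.prefix_append _ _).trans (hl.trans (List.prefix_append _ _))
    have h2 : npow z x.length <+: npow z (l + x.length) := by
      rw [add_comm, npow_add]; exact List.prefix_append _ _
    exact (List.prefix_of_prefix_length_le h1 h2
      (by rw [length_npow, length_npow, mul_comm])).eq_of_length
      (by rw [length_npow, length_npow, mul_comm])
  set k := Nat.findGreatest (fun k => ∃ l, npow x k <+: npow z l) z.length
  have hk : ∃ l, npow x k <+: npow z l :=
    Nat.findGreatest_spec (P := fun k => ∃ l, npow x k <+: npow z l) (Nat.zero_le z.length)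
      ⟨0, by simp [npow]⟩
  have hk' : ¬ ∃ l, npow x (k + 1) <+: npow z l := fun h => by
    have := Nat.le_findGreatest (P := fun k => ∃ l, npow x k <+: npow z l) (hbound _ h).le h
    omega
  obtain ⟨u, hu⟩ := Nat.find_spec hk
  refine ⟨u, Or.inr ⟨hxz, k, Nat.find hk, hu, isCanonical1_two hx hz ⟨fun _ ⟨u', h⟩ => ?_,
    fun _ l ⟨w, h⟩ => hk' ⟨Nat.find hk + l, w, ?_⟩⟩⟩⟩
  · rcases hl : Nat.find hk with _ | l
    · rw [hl] at hu
      simp [npow, ← h] at hu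
      exact hz.ne_nil hu.2.2
    · refine Nat.find_min hk (m := l) (by omega) ⟨u', ?_⟩
      rw [hl, npow_succ, ← npow_comm, ← h, ← List.append_assoc] at hu
      exact List.append_cancel_right hu
  · rw [npow_add z, ← hu, npow_add, npow_one, List.append_assoc, List.append_assoc, h]

/-- With a smaller $k$, $x$ would be a prefix of some $uz^{l'}$; for equal $k$, the word with the
larger $l$ would have $z$ as a suffix. So the junction conditions determine $k$, then $l$, and hence
$u$. -/
theorem IsConnector.unique {x z u u' : List A} (h : IsConnector x z u) (h' : IsConnector x z u')
    (hx : IsLyndon x) (hz : IsLyndon z) : u = u' := by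
  have hg := h.good hx
  have hg' := h'.good hx
  rcases h with ⟨rfl, a, rfl, ha⟩ | ⟨hne, k, l, h, -⟩
  · rcases h' with ⟨-, b, rfl, hb⟩ | ⟨hne, -⟩
    · rw [ha.unique hb]
    · exact absurd rfl hne
  rcases h' with ⟨rfl, -⟩ | ⟨-, k', l', h', -⟩
  · exact absurd rfl hne
  have key : ∀ {k l k' l' : ℕ} {u u' : List A}, npow x k ++ u = npow z l →
      npow x k' ++ u' = npow z l' → GoodJunction x u z → k' ≤ k := by
    intro k l k' l' u u' h h' hg
    by_contra! hk
    obtain ⟨j, rfl⟩ := Nat.exists_eq_add_of_lt hk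
    refine hg.2 hx.ne_nil l' ?_
    have h1 : npow x k ++ x <+: npow z (l + l') := by
      rw [add_comm, npow_add, ← h', show k + j + 1 = k + (j + 1) by ring, npow_add, npow_succ]
      exact ⟨npow x j ++ u' ++ npow z l, by simp⟩
    rw [npow_add, ← h, List.append_assoc, List.prefix_append_right_inj] at h1
    exact h1
  obtain rfl : k = k' := le_antisymm (key h' h hg') (key h h' hg)
  have key' : ∀ {l l' : ℕ} {u u' : List A}, npow x k ++ u = npow z l →
      npow x k ++ u' = npow z l' → GoodJunction x u' z → l' ≤ l := by
    intro l l' u u' h h' hg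
    by_contra! hl
    obtain ⟨j, rfl⟩ := Nat.exists_eq_add_of_lt hl
    refine hg.1 hz.ne_nil ?_
    rw [show l + j + 1 = l + (j + 1) by ring, npow_add, ← h, List.append_assoc,
      List.append_right_inj] at h'
    rw [h', npow_succ, ← npow_comm, ← List.append_assoc]
    exact List.suffix_append _ _
  obtain rfl : l = l' := le_antisymm (key' h' h hg) (key' h h' hg')
  exact List.append_cancel_left (h.trans h'.symm)

/-- Over a one-letter alphabet $x$ would be a prefix of $vz^{|x|}$, so another letter exists;
finiteness provides the least one. -/
theorem exists_isConnector_self [Finite A] {x v z : List A} (hx : IsLyndon x) (hz : z ≠ [])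
    (h : GoodJunction x v z) : ∃ u, IsConnector x x u := by
  obtain ⟨a, x', rfl⟩ := List.exists_cons_of_ne_nil hx.ne_nil
  have hne : {b : A | (a :: x').head? ≠ some b}.Nonempty := by
    by_contra! hall
    have hall' : ∀ b, b = a := fun b => by
      have : b ∉ {b : A | (a :: x').head? ≠ some b} := by rw [hall]; simp
      simpa [eq_comm] using this
    have hrep : ∀ w : List A, w = List.replicate w.length a := fun w =>
      List.eq_replicate_iff.2 ⟨rfl, fun b _ => hall' b⟩
    refine h.2 (by simp) (a :: x').length ?_
    have hz0 := List.length_pos_iff.2 hz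
    rw [hrep (a :: x'), hrep (v ++ npow z _), List.prefix_replicate_iff]
    simp only [List.length_replicate, List.length_append, length_npow, and_true]
    nlinarith
  obtain ⟨b, hb, hmin⟩ := (Set.toFinite {b : A | (a :: x').head? ≠ some b}).exists_minimalFor id _ hne
  refine ⟨[b], Or.inl ⟨rfl, b, rfl, hb, fun c hc => ?_⟩⟩
  rcases le_total b c with h | h
  · exact h
  · exact hmin hc h

/-! ### Reduced limit terms of rank two -/

/-- The properties of a limit term `π^{ω-1}` of rank two, preceded by `r` and followed by `ρ`, to
which no rule is applicable. -/
structure BlockReduced (r π ρ : Term1 A) : Prop where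
  good : GoodBase π
  noShift : NoShift π ρ
  not_elimination : ∀ l' l m r₁ z p p₁ p₂, r = l' ++ Atom.pow z p₂ :: m → π = l ++ Atom.pow z p :: m →
    ρ ≠ l ++ Atom.pow z p₁ :: r₁
  not_shortening1 : ∀ w σ τ, SameOmegaPortions σ τ → r = w ++ σ → π ≠ τ ++ σ
  exp_right : ∀ x q v p s, π = Atom.pow x q :: v → ρ = Atom.pow x p :: s → q = 0
  exp_left : ∀ r' x p w v q, r = r' ++ Atom.pow x p :: word w → π = v ++ Atom.pow x q :: word w → q = 0
  connector : ∀ w₀ x p₁ w₁ z q₁ w₂ p₂ q₂ w₃, r = w₀ ++ Atom.pow x p₁ :: w₁ →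
    π = Atom.pow z q₁ :: w₂ ++ Atom.pow x p₂ :: w₁ → ρ = Atom.pow z q₂ :: w₃ →
    ∃ u, w₁ = word u ∧ IsConnector x z u ∧ (x ≠ z ∨ p₁ ≠ p₂)
  connector_shift : ∀ w₀ x p₁ w₁ z q₁ w₂ w₂' p₂, r = w₀ ++ Atom.pow x p₁ :: (w₁ ++ Atom.pow z q₁ :: w₂') →
    π = w₂ ++ Atom.pow x p₂ :: (w₁ ++ Atom.pow z q₁ :: w₂') →
    x ≠ z ∧ p₂ = 0 ∧ ∃ u, w₁ = word u ∧ IsConnector x z u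

/-- Each shortening must leave the term unchanged. For type 3 this makes exponents zero. The first
two variants of type 2 would shorten the base, so they never apply; the third forces the stretch
between the two limit terms to be the connector. -/
theorem blockReduced_of_normal [Finite A] {r π ρ : Term1 A} {s : List (Term1 A × Term1 A)}
    (hi : Irr ⟨r, (π, ρ) :: s⟩) (hπ : GoodBase π) (hS : NoShift π ρ)
    (hn : ∀ ε : Term2 A, Shortening1 ⟨r, [(π, ρ)]⟩ ε ∨ Shortening2 ⟨r, [(π, ρ)]⟩ ε ∨
      Shortening3 ⟨r, [(π, ρ)]⟩ ε → ε = ⟨r, [(π, ρ)]⟩)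
    (hl : ∀ x ∈ bases r ∪ bases π, IsLyndon x)
    (hg : ∀ x ∈ bases π, ∃ v z, z ≠ [] ∧ GoodJunction x v z) : BlockReduced r π ρ := by
  have hconn : ∀ {x z}, x ∈ bases π → z ∈ bases r ∪ bases π → ∃ u, IsConnector x z u := by
    intro x z hx hz
    by_cases hxz : x = z
    · obtain ⟨v, z', h1, h2⟩ := hg x hx
      rw [← hxz]
      exact exists_isConnector_self (hl x (Or.inr hx)) h1 h2
    · exact exists_isConnector_of_ne (hl x (Or.inr hx)) (hl z hz) hxz
  -- The concluding shifts preserve the number of factors of the base, so a replacement with a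
  -- different number is a genuine change.
  have hshift : ∀ {r₁ π₁ ρ₁ : Term1 A}, Shortening2Core ⟨r, [(π, ρ)]⟩ ⟨r₁, [(π₁, ρ₁)]⟩ →
      π₁.length = π.length := by
    intro r₁ π₁ ρ₁ h
    obtain ⟨r₂, π₂, ρ₂, h1, h2, h3⟩ := exists_shiftRight_normal r₁ π₁ ρ₁
    have h4 := hn _ (Or.inr (Or.inl ⟨_, h, h1, h2⟩))
    simp only [Term2.mk.injEq, List.cons.injEq, Prod.mk.injEq, and_true] at h4
    rw [← h3, h4.2.1]
  have hright : ∀ x q v p s, π = Atom.pow x q :: v → ρ = Atom.pow x p :: s → q = 0 := by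
    rintro x q v p s rfl rfl
    have := hn _ (Or.inr (Or.inr (Shortening3.right r v s [] x p q)))
    simp at this
    exact this.1.symm
  refine ⟨hπ, hS, ?_, ?_, hright, ?_, ?_, ?_⟩
  · rintro l' l m r₁ z p p₁ p₂ rfl rfl rfl
    exact hi.false_of_elimination hπ.length
  · rintro w σ τ h rfl rfl
    have h1 := hn _ (Or.inl (Shortening1.mk w σ τ ρ h))
    simp at h1
    obtain ⟨u, x, y, v, ⟨p, R, h2⟩, -⟩ := h
    rw [h1] at h2
    simp at h2
  · rintro r' x p w v q rfl rfl
    have := hn _ (Or.inr (Or.inr (Shortening3.left r' v ρ w x p q)))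
    simp at this
    exact this.2.symm
  · rintro w₀ x p₁ w₁ z q₁ w₂ p₂ q₂ w₃ rfl rfl rfl
    have hq : q₁ ≠ q₂ := by rintro rfl; exact hS _ _ _ rfl rfl
    by_cases hxz : x = z ∧ p₁ = p₂
    · obtain ⟨rfl, rfl⟩ := hxz
      have := hshift (Shortening2Core.right _ w₀ w₁ w₂ w₃ x p₁ p₁ q₁ q₂ (ShiftEquiv.refl _)
        (by omega) (by omega))
      simp at this
    · obtain ⟨u, hu⟩ := @hconn x z (by simp) (by simp)
      have h1 := Shortening2Core.generic _ w₀ w₁ w₂ w₃ x z u p₁ p₂ q₁ q₂ (ShiftEquiv.refl _)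
        (by
          by_cases hx : x = z
          · exact Or.inr ⟨by omega, fun h => hxz ⟨hx, by omega⟩⟩
          · exact Or.inl hx) hu
      have h2 : NoShift (Atom.pow z 0 :: w₂ ++ Atom.pow x 0 :: word u) (Atom.pow z (q₂ - q₁) :: w₃) := by
        rintro a y t h3 h4
        simp at h3 h4
        rw [← h3.1] at h4
        simp at h4
        omega
      have h5 := hn _ (Or.inr (Or.inl ⟨_, h1, .refl, fun _ => h2.not_shiftRight⟩))
      simp only [Term2.mk.injEq, List.append_cancel_left_eq, List.cons.injEq] at h5
      exact ⟨u, h5.1.2.symm, hu, by tauto⟩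
  · rintro w₀ x p₁ w₁ z q₁ w₂ w₂' p₂ rfl rfl
    have h0 : ShiftEquiv ⟨w₀ ++ Atom.pow x p₁ :: (w₁ ++ Atom.pow z q₁ :: w₂'),
        [(w₂ ++ Atom.pow x p₂ :: (w₁ ++ Atom.pow z q₁ :: w₂'), ρ)]⟩ ⟨w₀ ++ Atom.pow x p₁ :: w₁,
        [(Atom.pow z q₁ :: (w₂' ++ w₂) ++ Atom.pow x p₂ :: w₁, Atom.pow z q₁ :: (w₂' ++ ρ))]⟩ := by
      have := (shiftEquiv_cons (x := Atom.pow z q₁ :: w₂') (y := w₂ ++ Atom.pow x p₂ :: w₁) (by simp; omega)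
        (w₀ ++ Atom.pow x p₁ :: w₁) ρ []).symm
      simpa using this
    have hxz : x ≠ z := by
      rintro rfl
      have := hshift (Shortening2Core.left _ w₀ w₁ (w₂' ++ w₂) (w₂' ++ ρ) x p₁ p₂ q₁ q₁ h0 (by omega))
      simp at this
      omega
    obtain ⟨u, hu⟩ := @hconn x z (by simp) (by simp)
    have h1 := Shortening2Core.generic _ w₀ w₁ (w₂' ++ w₂) (w₂' ++ ρ) x z u p₁ p₂ q₁ q₁ h0 (Or.inl hxz) hu
    have h2 : NoShift (w₂ ++ Atom.pow x 0 :: (word u ++ Atom.pow z 0 :: w₂')) ρ := by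
      rintro a y t h3 rfl
      rcases w₂ with _ | ⟨b, w₂⟩
      · simp at h3
        obtain ⟨rfl, -⟩ := h3
        -- By the type 3 condition $p_2=0$, so the shift was already possible before the
        -- replacement.
        have := hright x p₂ _ 0 t rfl rfl
        rw [this] at hS
        exact hS _ _ _ rfl rfl
      · simp at h3
        exact hS b _ t rfl (by rw [h3.1])
    have h3 : Relation.ReflTransGen ShiftRight
        ⟨w₀ ++ Atom.pow x (p₁ - p₂) :: word u, [(Atom.pow z 0 :: (w₂' ++ w₂) ++ Atom.pow x 0 :: word u,
          Atom.pow z (q₁ - q₁) :: (w₂' ++ ρ))]⟩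
        ⟨w₀ ++ Atom.pow x (p₁ - p₂) :: (word u ++ Atom.pow z 0 :: w₂'),
          [(w₂ ++ Atom.pow x 0 :: (word u ++ Atom.pow z 0 :: w₂'), ρ)]⟩ := by
      have := shiftRight_cons (x := Atom.pow z 0 :: w₂') (y := w₂ ++ Atom.pow x 0 :: word u) (by simp)
        (by simp) (w₀ ++ Atom.pow x (p₁ - p₂) :: word u) ρ []
      rw [sub_self]
      exact .single (by simpa using this)
    have h5 := hn _ (Or.inr (Or.inl ⟨_, h1, h3, fun _ => h2.not_shiftRight⟩))
    simp only [Term2.mk.injEq, List.append_cancel_left_eq, List.cons.injEq, Atom.pow.injEq, true_and] at h5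
    obtain ⟨⟨h6, h7⟩, -⟩ := h5
    have h8 : word u ++ [Atom.pow z 0] = w₁ ++ [Atom.pow z q₁] := by
      have h9 : (word u ++ [Atom.pow z 0]) ++ w₂' = (w₁ ++ [Atom.pow z q₁]) ++ w₂' := by simpa using h7
      exact List.append_cancel_right h9
    exact ⟨hxz, by omega, u, (List.append_inj_left' h8 rfl).symm, hu⟩

/-- No rule is applicable to a limit term of rank two. -/
def Reduced : Term1 A → List (Term1 A × Term1 A) → Prop
  | _, [] => True
  | r, b :: s => BlockReduced r b.1 b.2 ∧ (∀ b' ∈ s.head?, NoExpansion b.1 b.2 b'.1) ∧ Reduced b.2 s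

/-- In the square of a base each limit term of the first copy is followed by another limit term.
This junction is what guarantees a second letter in the alphabet, as required for $u_{x,x}$. -/
theorem SemiCanon.exists_junction {α : Term2 A} (h : SemiCanon α) {b : Term1 A × Term1 A}
    (hb : b ∈ α.tail) {x : List A} (hx : x ∈ bases b.1) : ∃ v z, z ≠ [] ∧ GoodJunction x v z := by
  obtain ⟨π, ρ⟩ := b
  obtain ⟨p, hp⟩ := hx
  obtain ⟨l, m, rfl : π = _⟩ := List.append_of_mem hp
  obtain ⟨s, t, hst⟩ := List.append_of_mem hb
  have h3 : α.twoExpansion = (α.head ++ (s.map fun s => s.1 ++ s.1 ++ s.2).flatten ++ l) ++ Atom.pow x p ::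
      (m ++ (l ++ Atom.pow x p :: (m ++ ρ ++ (t.map fun s => s.1 ++ s.1 ++ s.2).flatten))) := by
    simp [Term2.twoExpansion, hst]
  have h4 := h.2.2
  rw [h3, junctions_append_pow, junctions_append₂] at h4
  have h5 := h4.2.1
  rcases word_or_pow (m ++ l) with ⟨v, hv⟩ | ⟨v, z, p', t', hv⟩
  · rw [hv, junctions_word] at h5
    exact ⟨v, x, ((bases_subset_of_mem hb).1.trans h.2.1 ⟨p, hp⟩ : IsLyndon x).ne_nil, h5⟩
  · rw [hv, junctions_append_pow, junctions_word] at h5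
    refine ⟨v, z, ?_, h5.1⟩
    have h6 : Atom.pow z p' ∈ l ++ Atom.pow x p :: m := by
      have : Atom.pow z p' ∈ m ++ l := by rw [hv]; simp
      simp only [List.mem_append, List.mem_cons] at this ⊢
      tauto
    exact ((bases_subset_of_mem hb).1.trans h.2.1 ⟨p', h6⟩ : IsLyndon z).ne_nil

theorem reduced_of_normal [Finite A] {α : Term2 A} (hi : Irr α) (hα : SemiCanon α)
    (hS : ShiftReduced α.tail) (hn : IsNormal Step3 α) : Reduced α.head α.tail := by
  have key : ∀ (r : Term1 A) (s : List (Term1 A × Term1 A)), Irr ⟨r, s⟩ →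
      (∀ x ∈ bases r, IsLyndon x) →
      (∀ b ∈ s, GoodBase b.1 ∧ (∀ x ∈ bases b.1 ∪ bases b.2, IsLyndon x) ∧
        ∀ x ∈ bases b.1, ∃ v z, z ≠ [] ∧ GoodJunction x v z) → ShiftReduced s →
      IsNormal Step3 (⟨r, s⟩ : Term2 A) → Reduced r s := by
    intro r s
    induction s generalizing r with
    | nil => intros; trivial
    | cons b s ih =>
      obtain ⟨π, ρ⟩ := b
      intro hi hr hs hS hn
      have hb := hs (π, ρ) (by simp)
      refine ⟨blockReduced_of_normal hi hb.1 hS.1 (fun ε hε => ?_) ?_ hb.2.2, hS.2.1,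
        ih ρ hi.tail (fun x hx => hb.2.1 x (Or.inr hx)) (fun b hb => hs b (by simp [hb])) hS.2.2
          fun β hβ => ?_⟩
      · have := hn _ (InContext.here r ε.head [(π, ρ)] ε.tail s hε)
        simp only [Term2.mk.injEq] at this
        exact Term2.ext this.1 (List.append_cancel_right (this.2 : ε.tail ++ s = [(π, ρ)] ++ s))
      · rintro x (hx | hx)
        · exact hr x hx
        · exact hb.2.1 x (Or.inl hx)
      · have := hn _ (InContext.skip r π _ _ _ _ hβ)
        simp only [Term2.mk.injEq, List.cons.injEq, Prod.mk.injEq, true_and] at this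
        exact Term2.ext this.1 this.2
  refine key _ _ hi (fun x hx => hα.2.1 ?_) (fun b hb => ⟨hα.goodBase hb, ?_, fun x hx => hα.exists_junction hb hx⟩) hS hn
  · simp [Term2.twoExpansion, hx]
  · rintro x (hx | hx)
    · exact hα.2.1 ((bases_subset_of_mem hb).1 hx)
    · exact hα.2.1 ((bases_subset_of_mem hb).2 hx)

/-- The properties of canonical forms of rank two. -/
theorem Term2.IsLGCanonical.reduced [Finite A] {γ : Term2 A} (h : γ.IsLGCanonical) :
    SemiCanon γ ∧ Irr γ ∧ Reduced γ.head γ.tail := by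
  obtain ⟨-, α, α₁, α₂, h0, ⟨h1, h1'⟩, ⟨h2, h2'⟩, ⟨h3, h3'⟩⟩ := h
  have hα : SemiCanon α := ⟨h0.base_rank, h0.expansion.canon⟩
  have hα₁ : SemiCanon α₁ := by
    clear h1' h2 h2'
    induction h1 with
    | refl => exact hα
    | tail _ h ih => exact h.semiCanon ih
  have hi₁ := irr_of_isNormal h1'
  obtain ⟨hα₂, hi₂⟩ : SemiCanon α₂ ∧ Irr α₂ := by
    clear h2' h3
    induction h2 with
    | refl => exact ⟨hα₁, hi₁⟩
    | tail _ h ih => exact ⟨h.semiCanon ih.1, h.irr ih.1 ih.2⟩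
  have hS₂ := shiftReduced_of_isNormal h2' fun b hb => hα₂.goodBase hb
  obtain ⟨hγ, hi, hS⟩ : SemiCanon γ ∧ Irr γ ∧ ShiftReduced γ.tail := by
    clear h3'
    induction h3 with
    | refl => exact ⟨hα₂, hi₂, hS₂⟩
    | tail _ h ih =>
      exact ⟨h.semiCanon ih.1, h.irr ih.1 ih.2.1, h.shiftReduced ih.2.1 (fun b hb => ih.1.goodBase hb) ih.2.2⟩
  exact ⟨hγ, hi, reduced_of_normal hi hγ hS h3'⟩

end Canonical

end KappaLG

namespace KappaLG

variable {A : Type*}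

/-! ### Uniqueness of common prefixes and suffixes -/

theorem common_prefix_unique {X : Type*} {R R' s t s' t' : List X} (h : R ++ s = R' ++ s')
    (h' : R ++ t = R' ++ t')
    (hne : s.head? ≠ t.head?) (hne' : s'.head? ≠ t'.head?) : R = R' := by
  induction R generalizing R' with
  | nil =>
    cases R' with
    | nil => rfl
    | cons b R' => simp at h h'; simp [h, h'] at hne
  | cons a R ih =>
    cases R' with
    | nil => simp at h h'; simp [← h, ← h'] at hne'
    | cons b R' =>
      simp only [List.cons_append, List.cons.injEq] at h h'
      rw [h.1, ih h.2 h'.2]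

theorem common_suffix_unique {X : Type*} {S S' s t s' t' : List X} (h : s ++ S = s' ++ S')
    (h' : t ++ S = t' ++ S')
    (hne : s.getLast? ≠ t.getLast?) (hne' : s'.getLast? ≠ t'.getLast?) :
    S = S' ∧ s = s' ∧ t = t' := by
  have h1 := common_prefix_unique (R := S.reverse) (R' := S'.reverse) (s := s.reverse)
    (t := t.reverse) (s' := s'.reverse) (t' := t'.reverse)
    (by rw [← List.reverse_append, ← List.reverse_append, h])
    (by rw [← List.reverse_append, ← List.reverse_append, h'])
    (by simpa) (by simpa)
  obtain rfl := List.reverse_injective h1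
  exact ⟨rfl, List.append_cancel_right h, List.append_cancel_right h'⟩

/-! ### The two ends of a negative factor -/

/-- The words do not begin with the same letter. -/
def NoCommonHead (u e : List A) : Prop := ∀ b u₁ u₂, u = b :: u₁ → e ≠ b :: u₂

/-- Here `v` is the longest common prefix of `v ++ u` and `v ++ e`. -/
theorem NoCommonHead.eq_prefix {v u e v' u' e' : List A} (h : NoCommonHead u e)
    (h' : NoCommonHead u' e') (h1 : v ++ u = v' ++ u') (h2 : v ++ e = v' ++ e') : v = v' := by
  have key : ∀ {v u e v' u' e' : List A}, NoCommonHead u e → v ++ u = v' ++ u' → v ++ e = v' ++ e' →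
      v'.length ≤ v.length := by
    intro v u e v' u' e' h h1 h2
    by_contra! hl
    obtain ⟨d, rfl⟩ : v <+: v' := List.prefix_of_prefix_length_le ⟨u, h1⟩ ⟨u', rfl⟩ hl.le
    rw [List.append_assoc, List.append_right_inj] at h1 h2
    rcases d with _ | ⟨b, d⟩
    · simp at hl
    · exact h b (d ++ u') (d ++ e') (by simpa using h1) (by simpa using h2)
  exact List.append_inj_left h1 (le_antisymm (key h' h1.symm h2.symm) (key h h1 h2))

/-- The prefix of a negative factor that cancels with the positive factor after it. -/
theorem BlockReduced.prefix_cases [LinearOrder A] {q : ℕ} {r π ρ : Term1 A}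
    {s : List (Term1 A × Term1 A)}
    (h : BlockReduced r π ρ) (hs : ∀ b ∈ s.head?, NoExpansion π ρ b.1) (hs' : ∀ b ∈ s.head?, HasRankOne b.1)
    (hq : ExpPos q ρ) {R n a : List (Var A)} (hn : baseWord q π = R ++ n)
    (ha : altHead q (finBase π) (word (finWord π) ++ ρ) s = R ++ a) (ha0 : a ≠ [])
    (hne : n.head? ≠ a.head?) :
    (R = [] ∧ ∃ e z, n.head? = some (Var.cru (finBase π) (finWord π ++ iniWord π) (iniBase π)) ∧
      a.head? = some (Var.cru (finBase π) (finWord π ++ e) z) ∧ NoCommonHead (iniWord π) e) ∨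
    ∃ x w p t k j, π = Atom.pow x 0 :: w ∧ ρ = Atom.pow x p :: t ∧ k + j = q ∧
      R = Var.cru (finBase π) (finWord π) x :: List.replicate k (Var.base x) ∧
      n = List.replicate j (Var.base x) ++ body q x w x ∧
      ((j = 0 ∧ a.head? = some (Var.base x)) ∨ (j ≠ 0 ∧ a.head? ≠ some (Var.base x))) := by
  obtain ⟨p₀, π₀, hπ⟩ := h.good.rank.exists_ini
  have hS := h.noShift
  have hn' : baseWord q π = Var.cru (finBase π) (finWord π ++ iniWord π) (iniBase π) ::
      (List.replicate ((q : ℤ) + p₀).toNat (Var.base (iniBase π)) ++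
        body q (iniBase π) (π₀ ++ word (iniWord π)) (iniBase π)) := by
    rw [baseWord]
    have h1 : word (finWord π) ++ (π ++ word (iniWord π)) = word (finWord π ++ iniWord π) ++
        Atom.pow (iniBase π) p₀ :: (π₀ ++ word (iniWord π)) := by
      conv_lhs => arg 2; arg 1; rw [hπ]
      simp
    rw [h1, body_word_pow]
  have key : ∀ (e z : List A) (B : List (Var A)), altHead q (finBase π) (word (finWord π) ++ ρ) s =
      Var.cru (finBase π) (finWord π ++ e) z :: B → NoCommonHead (iniWord π) e →
      (B = [] ∨ (iniWord π ++ [] , iniBase π) ≠ (e, z)) → R = [] ∧ ∃ e z, n.head? =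
      some (Var.cru (finBase π) (finWord π ++ iniWord π) (iniBase π)) ∧
      a.head? = some (Var.cru (finBase π) (finWord π ++ e) z) ∧ NoCommonHead (iniWord π) e := by
    intro e z B h1 h2 h3
    have hR : R = [] := by
      rcases R with _ | ⟨b, R⟩
      · rfl
      · exfalso
        rw [hn] at hn'
        rw [ha] at h1
        simp only [List.cons_append, List.cons.injEq] at hn' h1
        rcases h3 with rfl | h3
        · exact ha0 (List.append_eq_nil_iff.1 h1.2).2
        · have h4 := hn'.1.symm.trans h1.1
          simp only [Var.cru.injEq, List.append_cancel_left_eq, true_and] at h4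
          exact h3 (by rw [List.append_nil, h4.1, h4.2])
    subst hR
    rw [List.nil_append] at hn ha
    exact ⟨rfl, e, z, by rw [← hn, hn']; rfl, by rw [← ha, h1]; rfl, h2⟩
  have hcommon : ∀ (e : List A) (t : Term1 A), ρ = word e ++ t → e ≠ [] → NoCommonHead (iniWord π) e := by
    rintro e t he - b u₁ u₂ hu rfl
    refine hS (Atom.letter b) (word u₁ ++ Atom.pow (iniBase π) p₀ :: π₀) (word u₂ ++ t) ?_ (by rw [he]; rfl)
    rw [hu] at hπ
    exact hπ
  rcases word_or_pow ρ with ⟨e, rfl⟩ | ⟨e, z, p, t, rfl⟩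
  · left
    rcases s with _ | ⟨⟨π', ρ'⟩, s⟩
    · refine key e [] [] ?_ ?_ (Or.inl rfl)
      · rw [altHead, ← word_append, body_word]
      · rcases eq_or_ne e [] with rfl | he
        · rintro b u₁ u₂ -; simp
        · exact hcommon e [] (by simp) he
    · refine key (e ++ iniWord π') (iniBase π') [] ?_ ?_ (Or.inl rfl)
      · rw [altHead, ← word_append, ← word_append, body_word, List.append_assoc]
      · rcases eq_or_ne e [] with rfl | he
        · rintro b u₁ u₂ hu hu'
          rw [List.nil_append] at hu'
          obtain ⟨p', π₁, hπ'⟩ := (hs' (π', ρ') (by simp)).exists_ini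
          dsimp only at hπ'
          rw [hu] at hπ
          rw [hu'] at hπ'
          exact hs (π', ρ') (by simp) rfl b _ _ hπ hπ'
        · rintro b u₁ u₂ hu hu'
          obtain ⟨b', e', rfl⟩ := List.exists_cons_of_ne_nil he
          simp only [List.cons_append, List.cons.injEq] at hu'
          exact hcommon _ [] (by simp) he b u₁ e' hu (by rw [hu'.1])
  · have hcom : NoCommonHead (iniWord π) e := by
      rcases eq_or_ne e [] with rfl | he
      · rintro b u₁ u₂ -; simp
      · exact hcommon e _ rfl he
    obtain ⟨B, hB, hB'⟩ : ∃ B, altHead q (finBase π) (word (finWord π) ++ (word e ++ Atom.pow z p :: t)) s =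
        Var.cru (finBase π) (finWord π ++ e) z :: (List.replicate ((q : ℤ) + p).toNat (Var.base z) ++ B) ∧
          B.head? ≠ some (Var.base z) ∧ B ≠ [] := by
      rcases s with _ | ⟨⟨π', ρ'⟩, s⟩
      · exact ⟨body q z t [], by rw [altHead, ← List.append_assoc, ← word_append, body_word_pow],
          body_head?_ne _ _ _ _ _, body_ne_nil _ _ _ _⟩
      · exact ⟨body q z (t ++ word (iniWord π')) (iniBase π'), by
          rw [altHead, ← List.append_assoc, ← word_append, List.append_assoc, List.cons_append,
            body_word_pow], body_head?_ne _ _ _ _ _, body_ne_nil _ _ _ _⟩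
    -- Cancellation needs equal first variables, so `e` is the initial word of `π`. Equal words
    -- without a common first letter are empty: both `π` and `ρ` start with a limit term of base
    -- `z`. By `exp_right` the multiplicities are $q$ and $q+p$ with $p\ne0$, and the smaller one
    -- cancels.
    by_cases heq : (iniWord π ++ [], iniBase π) = (e, z)
    · right
      simp only [List.append_nil, Prod.mk.injEq] at heq
      obtain ⟨h1, h2⟩ := heq
      rw [h1] at hπ hn' hcom
      rw [h2] at hπ hn'
      obtain rfl : e = [] := by
        rcases e with _ | ⟨b, e⟩
        · rfl
        · exact absurd rfl (hcom b e e rfl)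
      simp only [word_nil, List.nil_append, List.append_nil] at hπ hn' hB ha hq
      obtain rfl := h.exp_right z p₀ π₀ p t hπ rfl
      have hp : p ≠ 0 := by
        rintro rfl
        exact hS _ _ _ hπ rfl
      rw [hn] at hn'
      rw [ha] at hB
      simp only [expPos_cons_pow] at hq
      rw [add_zero, Int.toNat_natCast] at hn'
      have hbh := body_head?_ne q z π₀ z z
      rcases lt_or_gt_of_ne hp with hp' | hp'
      · obtain ⟨k, hk⟩ : ∃ k : ℕ, ((q : ℤ) + p).toNat = k := ⟨_, rfl⟩
        obtain ⟨j, hj⟩ : ∃ j, q = k + j := ⟨q - k, by omega⟩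
        obtain ⟨j', hj'⟩ : ∃ j', j = j' + 1 := ⟨j - 1, by omega⟩
        have hrep : List.replicate q (Var.base z) =
            List.replicate k (Var.base z) ++ List.replicate j (Var.base z) := by
          rw [hj, List.replicate_add]
        rw [hrep, List.append_assoc] at hn'
        have hR := common_prefix_unique (R := R) (R' := Var.cru (finBase π) (finWord π) z ::
          List.replicate k (Var.base z)) (s := n) (t := a)
          (s' := List.replicate j (Var.base z) ++ body q z π₀ z) (t' := B)
          (by rw [hn']; rfl) (by rw [hB, hk]; rfl) hne
          (by rw [hj', List.replicate_succ]; simpa [eq_comm] using hB'.1)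
        subst hR
        refine ⟨z, π₀, p, t, k, j, hπ, rfl, hj.symm, rfl, ?_, Or.inr ⟨by omega, ?_⟩⟩
        · simpa using hn'
        · rw [hk] at hB
          have : a = B := by simpa using hB
          rw [this]; exact hB'.1
      · obtain ⟨k, hk⟩ : ∃ k : ℕ, ((q : ℤ) + p).toNat = q + (k + 1) := ⟨((q : ℤ) + p).toNat - q - 1, by omega⟩
        rw [hk, List.replicate_add, List.append_assoc] at hB
        have hR := common_prefix_unique (R := R) (R' := Var.cru (finBase π) (finWord π) z ::
          List.replicate q (Var.base z)) (s := n) (t := a)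
          (s' := body q z π₀ z) (t' := List.replicate (k + 1) (Var.base z) ++ B)
          (by rw [hn']; rfl) (by rw [hB]; rfl) hne
          (by rw [List.replicate_succ]; simpa using hbh)
        subst hR
        refine ⟨z, π₀, p, t, q, 0, hπ, rfl, rfl, rfl, ?_, Or.inl ⟨rfl, ?_⟩⟩
        · simpa using hn'
        · have : a = List.replicate (k + 1) (Var.base z) ++ B := by simpa using hB
          rw [this, List.replicate_succ]; rfl
    · left
      exact key e z _ hB hcom (Or.inr heq)

end KappaLG

/-! ### Cancellation at the end of a negative factor. -/

namespace KappaLG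

variable {A : Type*}

/-- The last letters of two positive words that have a common suffix through equal limit terms. -/
theorem suffix_level {q : ℕ} {y y' : List A} {l l₂ m : Term1 A} {z x : List A} {p : ℤ}
    {a n S : List (Var A)} (ha : body q y (l ++ Atom.pow z p :: m) x = a ++ S)
    (hn : body q y' (l₂ ++ Atom.pow z 0 :: m) x = n ++ S) (ha0 : a ≠ []) (hn0 : n ≠ [])
    (hne : a.getLast? ≠ n.getLast?) (hq : 0 < (q : ℤ) + p) :
    (∃ j k, k + j = q ∧ S = List.replicate k (Var.base z) ++ body q z m x ∧
      n = body q y' l₂ z ++ List.replicate j (Var.base z) ∧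
      ((0 < p ∧ j = 0 ∧ a.getLast? = some (Var.base z)) ∨ (p ≤ 0 ∧ a = body q y l z ∧ (p = 0 ↔ j = 0)))) ∨
    (p = 0 ∧ ∃ l' l₂' z' w p' p₂', l = l' ++ Atom.pow z' p' :: word w ∧
      l₂ = l₂' ++ Atom.pow z' p₂' :: word w) := by
  rw [body_append_pow] at ha hn
  rw [add_zero, Int.toNat_natCast] at hn
  have hz := body_getLast?_ne q y' l₂ z z
  have hz' := body_getLast?_ne q y l z z
  rcases lt_trichotomy p 0 with hp | rfl | hp
  -- The positive factor has fewer base variables; the cancellation stops there and leaves $-p$ of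
  -- them in the negative factor.
  · left
    obtain ⟨k, hk⟩ : ∃ k : ℕ, ((q : ℤ) + p).toNat = k := ⟨_, rfl⟩
    obtain ⟨j, hj⟩ : ∃ j, q = k + (j + 1) := ⟨q - k - 1, by omega⟩
    have hrep : List.replicate q (Var.base z) =
        List.replicate (j + 1) (Var.base z) ++ List.replicate k (Var.base z) := by
      rw [← List.replicate_add]; congr 1; omega
    rw [hk] at ha
    rw [hrep, List.append_assoc, ← List.append_assoc] at hn
    obtain ⟨rfl, rfl, rfl⟩ := common_suffix_unique ha hn (by
      rw [List.replicate_succ', ← List.append_assoc]; simpa using hz') hne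
    exact ⟨j + 1, k, hj.symm, rfl, rfl, Or.inr ⟨hp.le, rfl, by omega⟩⟩
  · rw [add_zero, Int.toNat_natCast] at ha
    by_cases h : (body q y l z).getLast? = (body q y' l₂ z).getLast?
    -- Equal multiplicities and equal crucial variables before `z`: the overlap continues. As
    -- neither remainder is empty, this crucial variable opens neither word, so a further common
    -- limit term precedes it.
    · right
      refine ⟨rfl, ?_⟩
      have key : ∀ {c : Var A} {B B' : List (Var A)}, body q y l z = B ++ [c] → body q y' l₂ z = B' ++ [c] →
          B ≠ [] ∧ B' ≠ [] := by
        intro c B B' hB hB'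
        rw [hB, List.append_assoc] at ha
        rw [hB', List.append_assoc] at hn
        have h3 : ∀ {a' n' : List (Var A)}, a' ++ ([c] ++ (List.replicate q (Var.base z) ++ body q z m x)) = a ++ S →
            n' ++ ([c] ++ (List.replicate q (Var.base z) ++ body q z m x)) = n ++ S → a' ≠ [] ∧ n' ≠ [] := by
          intro a' n' h1 h2
          have hlen : ([c] ++ (List.replicate q (Var.base z) ++ body q z m x)).length ≤ S.length := by
            by_contra! hl
            obtain ⟨E, hE⟩ : S <:+ [c] ++ (List.replicate q (Var.base z) ++ body q z m x) :=
              List.suffix_of_suffix_length_le ⟨a, h1.symm⟩ ⟨a', rfl⟩ hl.le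
            have hE0 : E ≠ [] := by rintro rfl; simp [← hE] at hl
            rw [← hE, ← List.append_assoc] at h1 h2
            rw [← List.append_cancel_right h1, ← List.append_cancel_right h2,
              List.getLast?_append_of_ne_nil _ hE0, List.getLast?_append_of_ne_nil _ hE0] at hne
            exact hne rfl
          constructor
          · rintro rfl
            have := congrArg List.length h1
            have := List.length_pos_iff.2 ha0
            simp at *; omega
          · rintro rfl
            have := congrArg List.length h2
            have := List.length_pos_iff.2 hn0
            simp at *; omega
        exact h3 ha hn
      rcases word_or_pow_last l with ⟨w, rfl⟩ | ⟨w, z', p', l', rfl⟩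
      · rw [body_word] at h key
        obtain ⟨v, z₁, B, hB⟩ := body_eq_append_cru q y' l₂ z
        rw [hB] at h
        simp at h
        have := (key (c := Var.cru y w z) (B := []) rfl (by rw [hB, h.1, h.2])).1
        exact absurd rfl this
      rcases word_or_pow_last l₂ with ⟨w₂, rfl⟩ | ⟨w₂, z₂, p₂, l₂', rfl⟩
      · rw [body_word] at h key
        obtain ⟨v, z₁, B, hB⟩ := body_eq_append_cru q y (l' ++ Atom.pow z' p' :: word w) z
        rw [hB] at h
        simp at h
        have := (key (c := Var.cru y' w₂ z) (B' := []) (by rw [hB, h.1, h.2]) rfl).2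
        exact absurd rfl this
      · simp only [body_append_pow, body_word, ← List.append_assoc, List.getLast?_append,
          List.getLast?_singleton, Option.some_or, Option.some.injEq, Var.cru.injEq, and_true] at h
        obtain ⟨rfl, rfl⟩ := h
        exact ⟨_, _, _, _, _, _, rfl, rfl⟩
    · left
      obtain ⟨rfl, rfl, rfl⟩ := common_suffix_unique ha hn h hne
      exact ⟨0, q, rfl, rfl, by simp, Or.inr ⟨le_rfl, rfl, by simp⟩⟩
  · left
    obtain ⟨j, hj⟩ : ∃ j : ℕ, ((q : ℤ) + p).toNat = (j + 1) + q := ⟨((q : ℤ) + p).toNat - q - 1, by omega⟩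
    rw [hj, List.replicate_add, List.append_assoc, ← List.append_assoc] at ha
    obtain ⟨rfl, rfl, rfl⟩ := common_suffix_unique ha hn (by
      rw [List.replicate_succ', ← List.append_assoc]; simpa [eq_comm] using hz) hne
    exact ⟨0, q, rfl, rfl, by simp, Or.inl ⟨hp, rfl, by
      rw [List.replicate_succ', ← List.append_assoc]; simp⟩⟩

/-- The end of a negative factor from the last limit term with base `z` involved in a cancellation. -/
def CommonTail [LinearOrder A] (q : ℕ) (y : List A) (c : Var A) (z : List A) (D : List (Var A)) : Prop :=
  (z = y ∧ D = [c]) ∨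
    (z ≠ y ∧ ∃ w, IsConnector z y w ∧ D = Var.cru z w y :: (List.replicate q (Var.base y) ++ [c]))

/-- The suffix of a negative factor that cancels with the positive factor before it. -/
theorem BlockReduced.suffix_cases [LinearOrder A] {q : ℕ} {r π ρ : Term1 A} (h : BlockReduced r π ρ)
    {y₀ v₀ : List A} (hr : ExpPos q r) {a n S : List (Var A)}
    (ha : body q y₀ (word v₀ ++ (r ++ word (iniWord π))) (iniBase π) = a ++ S)
    (hn : baseWord q π = n ++ S) (ha0 : a ≠ []) (hn0 : n ≠ []) (hne : a.getLast? ≠ n.getLast?) :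
    (S = [] ∧ (∃ y v, a.getLast? = some (Var.cru y v (iniBase π))) ∧
      n.getLast? = some (Var.cru (finBase π) (finWord π ++ iniWord π) (iniBase π))) ∨
    ∃ z D l l₂ m p j k, CommonTail q (finBase π)
        (Var.cru (finBase π) (finWord π ++ iniWord π) (iniBase π)) z D ∧
      r = l ++ Atom.pow z p :: m ∧ π = l₂ ++ Atom.pow z 0 :: m ∧
      (z = finBase π ∧ m = word (finWord π) ∨
        z ≠ finBase π ∧ ∃ w, m = word w ++ Atom.pow (finBase π) 0 :: word (finWord π)) ∧
      k + j = q ∧ S = List.replicate k (Var.base z) ++ D ∧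
      n = body q (finBase π) (word (finWord π) ++ l₂) z ++ List.replicate j (Var.base z) ∧
      ((0 < p ∧ j = 0 ∧ a.getLast? = some (Var.base z)) ∨
        (p ≤ 0 ∧ a = body q y₀ (word v₀ ++ l) z ∧ (p = 0 ↔ j = 0))) := by
  obtain ⟨p₀, l₀, hπ₀⟩ := h.good.rank.exists_fin
  have hlast : (n ++ S).getLast? = some (Var.cru (finBase π) (finWord π ++ iniWord π) (iniBase π)) := by
    rw [← hn, baseWord]
    have h1 : word (finWord π) ++ (π ++ word (iniWord π)) = (word (finWord π) ++ l₀) ++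
        Atom.pow (finBase π) p₀ :: word (finWord π ++ iniWord π) := by
      conv_lhs => arg 2; arg 1; rw [hπ₀]
      simp
    rw [h1, body_append_pow, body_word]
    simp
  rcases eq_or_ne S [] with rfl | hS
  · refine Or.inl ⟨rfl, ?_, by simpa using hlast⟩
    obtain ⟨v, z, B, hB⟩ := body_eq_append_cru q y₀ (word v₀ ++ (r ++ word (iniWord π))) (iniBase π)
    exact ⟨z, v, by rw [List.append_nil] at ha; rw [← ha, hB]; simp⟩
  right
  have hSl : S.getLast? = some (Var.cru (finBase π) (finWord π ++ iniWord π) (iniBase π)) := by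
    rwa [List.getLast?_append_of_ne_nil _ hS] at hlast
  -- the last limit term before `π^{ω-1}`
  obtain ⟨l, p, rfl⟩ : ∃ l p, r = l ++ Atom.pow (finBase π) p :: word (finWord π) := by
    rcases word_or_pow_last r with ⟨w, rfl⟩ | ⟨w, z, p, l, rfl⟩
    · exfalso
      rw [← word_append, ← word_append, body_word] at ha
      rcases a with _ | ⟨b, a⟩
      · exact ha0 rfl
      · simp at ha
        exact hS ha.2.2
    · have h1 : (a ++ S).getLast? = some (Var.cru z (w ++ iniWord π) (iniBase π)) := by
        rw [← ha, List.append_assoc, List.cons_append, ← List.append_assoc, ← word_append,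
          body_append_pow, body_word]
        simp
      rw [List.getLast?_append_of_ne_nil _ hS, hSl] at h1
      simp at h1
      exact ⟨l, p, by rw [h1.1, h1.2]⟩
  -- The term before the base ends with the final $\omega$-portion of the base, up to the exponent,
  -- so the type 3 condition applies to the exponent in the base.
  obtain rfl := h.exp_left l _ p _ l₀ p₀ rfl hπ₀
  have hlev : ∀ {l l₂ m : Term1 A} {z : List A} {p : ℤ}, π = l₂ ++ Atom.pow z 0 :: m →
      body q y₀ (word v₀ ++ (l ++ Atom.pow z p :: m ++ word (iniWord π))) (iniBase π) = a ++ S →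
      0 < (q : ℤ) + p → (∃ j k, k + j = q ∧ S = List.replicate k (Var.base z) ++
        body q z (m ++ word (iniWord π)) (iniBase π) ∧
      n = body q (finBase π) (word (finWord π) ++ l₂) z ++ List.replicate j (Var.base z) ∧
      ((0 < p ∧ j = 0 ∧ a.getLast? = some (Var.base z)) ∨
        (p ≤ 0 ∧ a = body q y₀ (word v₀ ++ l) z ∧ (p = 0 ↔ j = 0)))) ∨
      (p = 0 ∧ ∃ l' l₂' z' w p' p₂', l = l' ++ Atom.pow z' p' :: word w ∧
        l₂ = l₂' ++ Atom.pow z' p₂' :: word w) := by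
    intro l l₂ m z p h1 h2 h3
    have h4 : baseWord q π = body q (finBase π) ((word (finWord π) ++ l₂) ++ Atom.pow z 0 ::
        (m ++ word (iniWord π))) (iniBase π) := by
      rw [baseWord]
      conv_lhs => arg 3; arg 2; arg 1; rw [h1]
      simp
    rw [hn] at h4
    rcases suffix_level (l := word v₀ ++ l) (m := m ++ word (iniWord π)) (by simpa using h2) h4.symm ha0
      hn0 hne h3 with h5 | ⟨h5, l', l₂', z', w, p', p₂', h6, h7⟩
    · exact Or.inl h5
    · obtain ⟨l', -, h6⟩ := word_append_eq h6
      obtain ⟨l₂', -, h7⟩ := word_append_eq h7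
      exact Or.inr ⟨h5, l', l₂', z', w, p', p₂', h6, h7⟩
  simp only [expPos_append, expPos_cons_pow] at hr
  rcases hlev hπ₀ ha hr.2.1 with ⟨j, k, h1, h2, h3, h4⟩ | ⟨rfl, l', l₂, z, w, p', p₂, rfl, rfl⟩
  · refine ⟨finBase π, _, l, l₀, _, p, j, k, Or.inl ⟨rfl, rfl⟩, rfl, hπ₀, Or.inl ⟨rfl, rfl⟩, h1, ?_, h3, h4⟩
    rw [h2, ← word_append, body_word]
  · -- the second level
    have hπ₁ : π = l₂ ++ Atom.pow z p₂ :: (word w ++ Atom.pow (finBase π) 0 :: word (finWord π)) := by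
      simpa using hπ₀
    -- Two common limit terms form the pattern of a type 2 shortening after shifts: the bases
    -- differ, the exponent is $0$ and the word between is the connector.
    obtain ⟨hz, rfl, w', hw, hcon⟩ := h.connector_shift l' z p' (word w) (finBase π) 0 l₂
      (word (finWord π)) p₂ (by simp) hπ₁
    obtain rfl := word_injective hw
    simp only [expPos_append, expPos_cons_pow] at hr
    rcases hlev (l := l') (p := p') hπ₁ (by simpa using ha) hr.1.2.1 with
      ⟨j, k, h1, h2, h3, h4⟩ | ⟨rfl, l'', l₂', z', w', p'', p₂', rfl, rfl⟩
    · refine ⟨z, _, l', l₂, _, p', j, k, Or.inr ⟨hz, w, hcon, rfl⟩, by simp, hπ₁, Or.inr ⟨hz, w, rfl⟩, h1, ?_, h3, h4⟩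
      rw [h2, List.append_assoc, List.cons_append, ← word_append, body_word_pow, body_word]
      simp
    -- With a third common limit term, the stretch up to the last one would have to be a connector,
    -- although it contains the limit term `z`.
    · exfalso
      obtain ⟨-, -, u, hu, -⟩ := h.connector_shift l'' z' p'' (word w' ++ Atom.pow z 0 :: word w) (finBase π) 0 l₂'
        (word (finWord π)) p₂' (by simp) (by simpa using hπ₁)
      exact pow_not_mem_word z 0 u (by rw [← hu]; simp)

end KappaLG

namespace KappaLG

variable {A : Type*}

/-! ### Recovering a term from its reduced alternating product -/

/-- A crucial variable names its right base. Hence `z` can be read from the last letter even if no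
base variable follows. -/
theorem append_replicate_base_unique {E E' : List (Var A)} {y v z y' v' z' : List A} {j j' : ℕ}
    (hE : E.getLast? = some (Var.cru y v z)) (hE' : E'.getLast? = some (Var.cru y' v' z'))
    (h : E ++ List.replicate j (Var.base z) = E' ++ List.replicate j' (Var.base z')) :
    z = z' ∧ j = j' := by
  have hz : z = z' := by
    have := congrArg List.getLast? h
    rcases j with _ | j <;> rcases j' with _ | j' <;>
      simp [List.getLast?_append, hE, hE', List.getLast?_replicate] at this
    · exact this.2.2
    · exact this
  subst hz
  exact ⟨rfl, (append_replicate_inj h (by simp [hE]) (by simp [hE'])).1⟩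

theorem getLast?_body_append (q : ℕ) (y : List A) (t : Term1 A) (z : List A) (E : List (Var A)) :
    ∃ y' v, (E ++ body q y t z).getLast? = some (Var.cru y' v z) := by
  obtain ⟨v, y', B, hB⟩ := body_eq_append_cru q y t z
  exact ⟨y', v, by rw [hB]; simp⟩

theorem iniWord_append_word {π : Term1 A} (h : HasRankOne π) (u : List A) :
    iniWord (π ++ word u) = iniWord π := by
  obtain ⟨p, r, hr⟩ := h.exists_ini
  rw [hr]; simp

theorem HasRankOne.finBase_mem {π : Term1 A} (h : HasRankOne π) : finBase π ∈ bases π := by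
  obtain ⟨p, l, hl⟩ := h.exists_fin
  generalize finBase π = y at *
  rw [hl]; simp

section Canonical

variable [LinearOrder A]

theorem CommonTail.unique {q : ℕ} {y : List A} {c : Var A} {z : List A} {D D' : List (Var A)}
    (h : CommonTail q y c z D) (h' : CommonTail q y c z D') (hz : IsLyndon z) (hy : IsLyndon y) :
    D = D' := by
  rcases h with ⟨h1, rfl⟩ | ⟨h1, w, hw, rfl⟩ <;> rcases h' with ⟨h2, rfl⟩ | ⟨h2, w', hw', rfl⟩
  · rfl
  · exact absurd h1 h2
  · exact absurd h2 h1
  · rw [hw.unique hw' hz hy]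

/-- A limit term of rank two with its neighbours `r` and `ρ`, together with the cancellations of the
corresponding factors of the alternating product. -/
structure TrimmedBlock (q : ℕ) (y₀ v₀ : List A) (r π ρ : Term1 A) (R P S R₁ N P₁ : List (Var A)) :
    Prop where
  reduced : BlockReduced r π ρ
  exp_left : ExpPos q r
  exp_base : ExpPos q π
  lyndon : ∀ x ∈ bases π, IsLyndon x
  pos_eq : body q y₀ (word v₀ ++ (r ++ word (iniWord π))) (iniBase π) = R ++ (P ++ S)
  neg_eq : baseWord q π = R₁ ++ (N ++ S)
  pos_ne : P ≠ []
  neg_ne : N ≠ []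
  last_ne : P.getLast? ≠ N.getLast?
  prefix_cases : (R₁ = [] ∧ ∃ e z,
      N.head? = some (Var.cru (finBase π) (finWord π ++ iniWord π) (iniBase π)) ∧
      P₁.head? = some (Var.cru (finBase π) (finWord π ++ e) z) ∧ NoCommonHead (iniWord π) e) ∨
    ∃ x w p t k j, π = Atom.pow x 0 :: w ∧ ρ = Atom.pow x p :: t ∧ k + j = q ∧
      R₁ = Var.cru (finBase π) (finWord π) x :: List.replicate k (Var.base x) ∧
      N ++ S = List.replicate j (Var.base x) ++ body q x w x ∧
      ((j = 0 ∧ P₁.head? = some (Var.base x)) ∨ (j ≠ 0 ∧ P₁.head? ≠ some (Var.base x)))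

namespace TrimmedBlock

variable {q : ℕ} {y₀ v₀ : List A} {r π ρ r' π' ρ' : Term1 A} {R P S R₁ N P₁ S' R₁' : List (Var A)}

theorem suffix_cases (h : TrimmedBlock q y₀ v₀ r π ρ R P S R₁ N P₁) :
    (S = [] ∧ (∃ y v, P.getLast? = some (Var.cru y v (iniBase π))) ∧
      N.getLast? = some (Var.cru (finBase π) (finWord π ++ iniWord π) (iniBase π))) ∨
    ∃ z D l l₂ m p j k, CommonTail q (finBase π)
        (Var.cru (finBase π) (finWord π ++ iniWord π) (iniBase π)) z D ∧
      r = l ++ Atom.pow z p :: m ∧ π = l₂ ++ Atom.pow z 0 :: m ∧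
      (z = finBase π ∧ m = word (finWord π) ∨
        z ≠ finBase π ∧ ∃ w, m = word w ++ Atom.pow (finBase π) 0 :: word (finWord π)) ∧
      k + j = q ∧ S = List.replicate k (Var.base z) ++ D ∧
      R₁ ++ N = body q (finBase π) (word (finWord π) ++ l₂) z ++ List.replicate j (Var.base z) ∧
      ((0 < p ∧ j = 0 ∧ P.getLast? = some (Var.base z)) ∨
        (p ≤ 0 ∧ R ++ P = body q y₀ (word v₀ ++ l) z ∧ (p = 0 ↔ j = 0))) := by
  have h1 := h.reduced.suffix_cases h.exp_left (a := R ++ P) (n := R₁ ++ N) (S := S)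
    (by rw [List.append_assoc]; exact h.pos_eq) (by rw [List.append_assoc]; exact h.neg_eq)
    (by simp [h.pos_ne]) (by simp [h.neg_ne])
    (by rw [List.getLast?_append_of_ne_nil _ h.pos_ne, List.getLast?_append_of_ne_nil _ h.neg_ne]
        exact h.last_ne)
  rwa [List.getLast?_append_of_ne_nil _ h.pos_ne, List.getLast?_append_of_ne_nil _ h.neg_ne] at h1

/-- The negative factor determines `π` with words attached at both ends. The left word is given by
`hv`, and the initial word of the remainder is the right word, so both can be stripped; the positive
factor then gives `r`. -/
theorem eq_of_eq (h : TrimmedBlock q y₀ v₀ r π ρ R P S R₁ N P₁)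
    (h' : TrimmedBlock q y₀ v₀ r' π' ρ' R P S R₁ N P₁) (hv : finWord π = finWord π') :
    r = r' ∧ π = π' := by
  have h1 := h.neg_eq.trans h'.neg_eq.symm
  rw [baseWord, baseWord, hv] at h1
  obtain ⟨-, h2, -⟩ := body_injective h1 (by simp [h.exp_base]) (by simp [h'.exp_base])
  rw [List.append_right_inj] at h2
  have hu : iniWord π = iniWord π' := by
    rw [← iniWord_append_word h.reduced.good.rank (iniWord π), h2,
      iniWord_append_word h'.reduced.good.rank]
  rw [hu, List.append_left_inj] at h2
  subst h2
  obtain ⟨-, h3, -⟩ := body_injective (h.pos_eq.trans h'.pos_eq.symm) (by simp [h.exp_left])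
    (by simp [h'.exp_left])
  rw [List.append_right_inj, List.append_left_inj] at h3
  exact ⟨h3, rfl⟩

/-- If there is no cancellation on the left, then the cancellation on the right is determined. -/
theorem suffix_eq_nil (h : TrimmedBlock q y₀ v₀ r π ρ R P S [] N P₁)
    (h' : TrimmedBlock q y₀ v₀ r' π' ρ' R P [] [] N P₁)
    (hy : finBase π = finBase π') (hv : finWord π = finWord π') : S = [] := by
  rcases h.suffix_cases with ⟨rfl, -⟩ | ⟨z, D, l, l₂, m, p, j, k, -, hr, hπ, hm, -, -, h1, h2⟩
  · rfl
  exfalso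
  have hE' : ∃ y v, P.getLast? = some (Var.cru y v (iniBase π')) := by
    obtain ⟨y, v, h3⟩ := getLast?_body_append q y₀ (word v₀ ++ (r' ++ word (iniWord π'))) (iniBase π') []
    rw [List.nil_append, h'.pos_eq, List.append_nil, List.getLast?_append_of_ne_nil _ h'.pos_ne] at h3
    exact ⟨y, v, h3⟩
  have hN : body q (finBase π') (word (finWord π') ++ (π' ++ word (iniWord π'))) (iniBase π') = N := by
    have := h'.neg_eq
    rwa [List.append_nil] at this
  rw [List.nil_append] at h1
  obtain ⟨y₁, v₁, h3⟩ := getLast?_body_append q (finBase π) (word (finWord π) ++ l₂) z []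
  obtain ⟨y₂, v₂, h4⟩ := getLast?_body_append q (finBase π')
    (word (finWord π') ++ (π' ++ word (iniWord π'))) (iniBase π') []
  rw [List.nil_append] at h3 h4
  obtain ⟨rfl, rfl⟩ := append_replicate_base_unique (j' := 0) h3 h4 (by rw [← h1, hN]; simp)
  obtain ⟨y₃, v₃, h5⟩ := hE'
  rcases h2 with ⟨-, -, h2⟩ | ⟨-, h2, hp⟩
  · rw [h2] at h5; simp at h5
  obtain rfl : p = 0 := by simpa using hp
  have h6 := h'.pos_eq
  rw [List.append_nil, h2] at h6
  rw [hr] at h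
  obtain ⟨-, h7, -⟩ := body_injective h6 (by simp [h'.exp_left])
    (by have := h.exp_left; simp at this; simp [this.1])
  rw [List.append_right_inj] at h7
  rw [List.replicate_zero, List.append_nil, ← hN] at h1
  obtain ⟨-, h8, -⟩ := body_injective h1 (by simp [h'.exp_base])
    (by have := h.exp_base; rw [hπ] at this; simp at this; simp [this.1])
  rw [hv, List.append_right_inj] at h8
  obtain ⟨p', t, h9⟩ := h'.reduced.good.rank.exists_ini
  obtain ⟨p'', t', h10⟩ := h'.reduced.good.rank.exists_fin
  -- The comparison gives $r=r'\sigma$ and $\pi=\pi'\sigma$, where $\sigma$ and $\pi'$ have the same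
  -- $\omega$-portions. A type 1 shortening would have removed $\sigma$.
  refine h.reduced.not_shortening1 r' (word (iniWord π') ++ Atom.pow (iniBase π') 0 :: m) π'
    ⟨iniWord π', iniBase π', finBase π', finWord π', ⟨0, m, rfl⟩, ⟨p', t, h9⟩, ?_, ⟨p'', t', h10⟩⟩
    (by rw [← h7]; simp) (by rw [hπ, ← h8]; simp)
  rw [hy, hv] at hm
  rcases hm with ⟨h11, rfl⟩ | ⟨-, w, rfl⟩
  · exact ⟨0, word (iniWord π'), by rw [h11]⟩
  · exact ⟨0, word (iniWord π') ++ Atom.pow (iniBase π') 0 :: word w, by simp⟩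

/-- `N` shows the limit base where the cancellation stopped and how many of its $q$ base variables
survived; uniqueness of connectors determines the rest of the suffix. An empty suffix on one side
only is excluded by `suffix_eq_nil`. -/
theorem eq_left (h : TrimmedBlock q y₀ v₀ r π ρ R P S [] N P₁)
    (h' : TrimmedBlock q y₀ v₀ r' π' ρ' R P S' [] N P₁)
    (hu : iniWord π = iniWord π') (hx : iniBase π = iniBase π') (hy : finBase π = finBase π')
    (hv : finWord π = finWord π') : S = S' := by
  rcases h.suffix_cases with ⟨rfl, -⟩ | ⟨z, D, l, l₂, m, p, j, k, hD, -, hπ, -, hk, rfl, h1, -⟩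
  · exact (h'.suffix_eq_nil h hy.symm hv.symm).symm
  rcases h'.suffix_cases with ⟨rfl, -⟩ | ⟨z', D', l', l₂', m', p', j', k', hD', -, hπ', -, hk', rfl, h1', -⟩
  · exact h.suffix_eq_nil h' hy hv
  obtain ⟨y₁, v₁, h3⟩ := getLast?_body_append q (finBase π) (word (finWord π) ++ l₂) z []
  obtain ⟨y₂, v₂, h4⟩ := getLast?_body_append q (finBase π') (word (finWord π') ++ l₂') z' []
  rw [List.nil_append] at h1 h1' h3 h4
  obtain ⟨rfl, rfl⟩ := append_replicate_base_unique h3 h4 (by rw [← h1, ← h1'])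
  rw [← hu, ← hx, ← hy, ← hv] at hD'
  rw [hD.unique hD' (h.lyndon _ (by rw [hπ]; simp)) (h.lyndon _ h.reduced.good.rank.finBase_mem)]
  congr 2; omega

/-- The cancellation on the right when there is a cancellation on the left. -/
theorem suffix_cases_right (h : TrimmedBlock q y₀ v₀ r π ρ R P S R₁ N P₁) {x : List A} {w t : Term1 A}
    {p : ℤ} {k j : ℕ} (hπ : π = Atom.pow x 0 :: w) (hρ : ρ = Atom.pow x p :: t) (hk : k + j = q)
    (hR : R₁ = Var.cru (finBase π) (finWord π) x :: List.replicate k (Var.base x)) :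
    (S = [] ∧ (∃ y v, P.getLast? = some (Var.cru y v x)) ∧
      N.getLast? = some (Var.cru (finBase π) (finWord π) x)) ∨
    ∃ j' k' E y v, k' + j' = q ∧ IsConnector (finBase π) x (finWord π) ∧
      S = List.replicate k' (Var.base (finBase π)) ++ [Var.cru (finBase π) (finWord π) x] ∧
      N = E ++ List.replicate j' (Var.base (finBase π)) ∧
      E.getLast? = some (Var.cru y v (finBase π)) ∧
      (finBase π = x → j' = 0 → P.getLast? = some (Var.base x)) := by
  have hu : iniWord π = [] := by rw [hπ]; rfl
  have hx : iniBase π = x := by rw [hπ]; rfl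
  rcases h.suffix_cases with h1 | ⟨z, D, l, l₂, m, p', j', k', hD, hr, hπ', hm, hk', hS, h1, h2⟩
  · left
    rwa [hu, hx, List.append_nil] at h1
  right
  -- A cancellation that reached the first limit term of the base would permit an elimination with
  -- `ρ`.
  obtain ⟨l₃, rfl⟩ : ∃ l₃, l₂ = Atom.pow x 0 :: l₃ := by
    rcases l₂ with _ | ⟨b, l₃⟩
    · rw [hπ'] at hπ
      simp only [List.nil_append, List.cons.injEq, Atom.pow.injEq] at hπ
      obtain ⟨⟨rfl, -⟩, rfl⟩ := hπ
      exact absurd hρ (h.reduced.not_elimination l [] m t z 0 p p' hr hπ')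
    · rw [hπ'] at hπ
      simp only [List.cons_append, List.cons.injEq] at hπ
      exact ⟨l₃, by rw [hπ.1]⟩
  -- Now `r`, `π` and `ρ` form the pattern of a type 2 shortening without shifts. The end `m` of the
  -- base must be a word, which leaves only the last limit term of the base.
  obtain ⟨u, hmu, hcon, hne⟩ := h.reduced.connector l z p' m x 0 l₃ 0 p t hr hπ' hρ
  obtain ⟨rfl, hm'⟩ : z = finBase π ∧ m = word (finWord π) := by
    rcases hm with hm | ⟨-, w', hm⟩
    · exact hm
    · exact absurd (hmu ▸ hm ▸ (by simp : Atom.pow (finBase π) 0 ∈ word w' ++ Atom.pow (finBase π) 0 ::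
        word (finWord π))) (pow_not_mem_word _ _ _)
  obtain rfl : finWord π = u := word_injective (hm'.symm.trans hmu)
  rw [hu, hx, List.append_nil] at hD
  obtain ⟨-, rfl⟩ | ⟨h3, -⟩ := hD
  swap
  · exact absurd rfl h3
  obtain ⟨y, v, h4⟩ := getLast?_body_append q x l₃ (finBase π) (List.replicate j (Var.base x))
  refine ⟨j', k', List.replicate j (Var.base x) ++ body q x l₃ (finBase π), y, v, hk', hcon, hS, ?_, h4, ?_⟩
  · rw [body_word_pow, add_zero, Int.toNat_natCast, hR] at h1
    have h5 : List.replicate q (Var.base x) =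
        List.replicate k (Var.base x) ++ List.replicate j (Var.base x) := by
      rw [← List.replicate_add, hk]
    rw [h5, List.append_assoc, List.cons_append, List.cons_append, List.append_assoc] at h1
    exact List.append_cancel_left (List.cons.inj h1).2
  · intro h5 h6
    rcases h2 with ⟨-, -, h2⟩ | ⟨-, -, h2⟩
    · rw [h2, h5]
    -- Here $p'=0$, whereas for equal bases the connector condition requires $p'\ne0$.
    · have := h2.2 h6
      tauto

/-- The block is determined by its trimmed factors. -/
theorem unique (h : TrimmedBlock q y₀ v₀ r π ρ R P S R₁ N P₁)
    (h' : TrimmedBlock q y₀ v₀ r' π' ρ' R P S' R₁' N P₁) : r = r' ∧ π = π' ∧ R₁ = R₁' := by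
  -- The first letters of `N` and `P₁` separate the two cases: without cancellation both are crucial
  -- variables, otherwise at least one of them is a base variable.
  have mixed : ∀ {r π ρ r' π' ρ' S S' R₁ R₁'}, TrimmedBlock q y₀ v₀ r π ρ R P S R₁ N P₁ →
      TrimmedBlock q y₀ v₀ r' π' ρ' R P S' R₁' N P₁ →
      (R₁ = [] ∧ ∃ e z, N.head? = some (Var.cru (finBase π) (finWord π ++ iniWord π) (iniBase π)) ∧
        P₁.head? = some (Var.cru (finBase π) (finWord π ++ e) z) ∧ NoCommonHead (iniWord π) e) →
      (∃ x w p t k j, π' = Atom.pow x 0 :: w ∧ ρ' = Atom.pow x p :: t ∧ k + j = q ∧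
      R₁' = Var.cru (finBase π') (finWord π') x :: List.replicate k (Var.base x) ∧
      N ++ S' = List.replicate j (Var.base x) ++ body q x w x ∧
      ((j = 0 ∧ P₁.head? = some (Var.base x)) ∨ (j ≠ 0 ∧ P₁.head? ≠ some (Var.base x)))) → False := by
    rintro r π ρ r' π' ρ' S S' R₁ R₁' h h' ⟨-, e, z, h1, h2, -⟩
      ⟨x, w, p, t, k, j, -, -, -, -, h3, ⟨-, h4⟩ | ⟨h4, -⟩⟩
    · rw [h4] at h2; simp at h2
    · obtain ⟨j, rfl⟩ := Nat.exists_eq_succ_of_ne_zero h4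
      have := congrArg List.head? h3
      rw [List.head?_append_of_ne_nil _ h.neg_ne, h1, List.replicate_succ] at this
      simp at this
  rcases h.prefix_cases with h1 | h1 <;> rcases h'.prefix_cases with h2 | h2
  · obtain ⟨rfl, e, z, h3, h4, h5⟩ := h1
    obtain ⟨rfl, e', z', h3', h4', h5'⟩ := h2
    rw [h3] at h3'
    rw [h4] at h4'
    simp only [Option.some.injEq, Var.cru.injEq] at h3' h4'
    obtain ⟨hy, hvu, hx⟩ := h3'
    have hv := h5.eq_prefix h5' hvu h4'.2.1
    have hu := hvu
    rw [hv, List.append_right_inj] at hu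
    obtain rfl := h.eq_left h' hu hx hy hv
    obtain ⟨h6, h7⟩ := h.eq_of_eq h' hv
    exact ⟨h6, h7, rfl⟩
  · exact (mixed h h' h1 h2).elim
  · exact (mixed h' h h2 h1).elim
  · obtain ⟨x, w, p, t, k, j, hπ, hρ, hk, hR, h3, h4⟩ := h1
    obtain ⟨x', w', p', t', k', j', hπ', hρ', hk', hR', h3', h4'⟩ := h2
    have hhead : ∀ {j : ℕ} {x : List A} {w : Term1 A} {S}, j ≠ 0 →
        N ++ S = List.replicate j (Var.base x) ++ body q x w x → N.head? = some (Var.base x) := by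
      intro j x w S hj hN
      obtain ⟨j, rfl⟩ := Nat.exists_eq_succ_of_ne_zero hj
      have := congrArg List.head? hN
      rwa [List.head?_append_of_ne_nil _ h.neg_ne, List.replicate_succ] at this
    have hhead' : ∀ {j : ℕ} {x z : List A} {w : Term1 A} {S}, j = 0 →
        N ++ S = List.replicate j (Var.base x) ++ body q x w x → N.head? ≠ some (Var.base z) := by
      rintro j x z w S rfl hN
      have := congrArg List.head? hN
      rw [List.head?_append_of_ne_nil _ h.neg_ne] at this
      rw [this]
      exact body_head?_ne _ _ _ _ _
    -- The base $x$ is named by whichever of `P₁` and `N` begins with $\mathsf b_x$.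
    obtain rfl : x = x' := by
      rcases h4 with ⟨h5, h6⟩ | ⟨h5, h6⟩ <;> rcases h4' with ⟨h5', h6'⟩ | ⟨h5', h6'⟩
      · rw [h6] at h6'; simpa using h6'
      · exact absurd (hhead h5' h3') (hhead' h5 h3)
      · exact absurd (hhead h5 h3) (hhead' h5' h3')
      · have := (hhead h5 h3).symm.trans (hhead h5' h3')
        simpa using this
    have key : finWord π = finWord π' ∧ finBase π = finBase π' ∧ S = S' := by
      rcases h.suffix_cases_right hπ hρ hk hR with ⟨rfl, ⟨y₁, v₁, h7⟩, h8⟩ |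
          ⟨i, n, E, y₁, v₁, hn, hc, hS, hN, hE, h7⟩ <;>
        rcases h'.suffix_cases_right hπ' hρ' hk' hR' with ⟨rfl, ⟨y₂, v₂, h7'⟩, h8'⟩ |
          ⟨i', n', E', y₂, v₂, hn', hc', hS', hN', hE', h7'⟩
      · rw [h8] at h8'
        simp only [Option.some.injEq, Var.cru.injEq] at h8'
        exact ⟨h8'.2.1, h8'.1, rfl⟩
      · obtain ⟨h9, h10⟩ := append_replicate_base_unique (j' := 0) hE' h8 (by rw [← hN']; simp)
        rw [h7' h9 h10] at h7
        simp at h7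
      · obtain ⟨h9, h10⟩ := append_replicate_base_unique (j' := 0) hE h8' (by rw [← hN]; simp)
        rw [h7 h9 h10] at h7'
        simp at h7'
      · obtain ⟨h9, rfl⟩ := append_replicate_base_unique hE hE' (by rw [← hN, ← hN'])
        have hy := h.lyndon _ h.reduced.good.rank.finBase_mem
        have hx := h.lyndon x (by rw [hπ]; simp)
        rw [← h9] at hc'
        have h10 := hc.unique hc' hy hx
        refine ⟨h10, h9, ?_⟩
        rw [hS, hS', ← h9, h10]
        congr 2; omega
    obtain ⟨hv, hy, rfl⟩ := key
    -- With the suffix known, $j$ is the number of leading copies of $\mathsf b_x$, and $k=q-j$.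
    rw [h3] at h3'
    obtain ⟨rfl, -⟩ := replicate_append_inj h3' (body_head?_ne _ _ _ _ _) (body_head?_ne _ _ _ _ _)
    obtain rfl : k = k' := by omega
    obtain rfl : R₁ = R₁' := by rw [hR, hR', hv, hy]
    obtain ⟨h6, h7⟩ := h.eq_of_eq h' hv
    exact ⟨h6, h7, rfl⟩

end TrimmedBlock

end Canonical

end KappaLG

/-! ### Reconstruction of the whole term. -/

namespace KappaLG

variable {A : Type*}

theorem Trim.exists_append {V : Type*} {R a P : List V} {t t' : List (List V × List V)}
    (h : Trim R a t P t') : ∃ S, a = R ++ (P ++ S) := by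
  cases h with
  | nil => exact ⟨[], by simp⟩
  | cons _ _ S => exact ⟨S, rfl⟩

section Canonical

variable [LinearOrder A]

theorem BlockReduced.trimmedBlock {q : ℕ} {y v : List A} {r π ρ : Term1 A}
    {s : List (Term1 A × Term1 A)} {R P S R₁ N P₁ : List (Var A)} {t : List (List (Var A) × List (Var A))}
    (h : BlockReduced r π ρ) (hs : ∀ b ∈ s.head?, NoExpansion π ρ b.1)
    (hs' : ∀ b ∈ s.head?, HasRankOne b.1) (hr : ExpPos q r) (hπ : ExpPos q π) (hρ : ExpPos q ρ)
    (hx : ∀ x ∈ bases π, IsLyndon x) (hP : P ≠ []) (hN : N ≠ []) (hl : P.getLast? ≠ N.getLast?)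
    (hn : N.head? ≠ P₁.head?) (h1 : altHead q y (word v ++ r) ((π, ρ) :: s) = R ++ (P ++ S))
    (h2 : baseWord q π = R₁ ++ (N ++ S))
    (h3 : Trim R₁ (altHead q (finBase π) (word (finWord π) ++ ρ) s) (altTail q s) P₁ t) :
    TrimmedBlock q y v r π ρ R P S R₁ N P₁ := by
  obtain ⟨S₁, h4⟩ := h3.exists_append
  have h5 := h.prefix_cases hs hs' hρ h2 h4 (by simp [h3.ne_nil.1])
    (by rwa [List.head?_append_of_ne_nil _ hN, List.head?_append_of_ne_nil _ h3.ne_nil.1])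
  rw [List.head?_append_of_ne_nil _ hN, List.head?_append_of_ne_nil _ h3.ne_nil.1] at h5
  exact ⟨h, hr, hπ, hx, by rw [← List.append_assoc]; exact h1, h2, hP, hN, hl, h5⟩

/-- A reduced term is determined by its trimmed alternating product. -/
theorem Reduced.unique {q : ℕ} {y v : List A} {r r' : Term1 A} {s s' : List (Term1 A × Term1 A)}
    {R P : List (Var A)} {t : List (List (Var A) × List (Var A))} (h : Reduced r s) (h' : Reduced r' s')
    (hq : (⟨r, s⟩ : Term2 A).All (ExpPos q)) (hq' : (⟨r', s'⟩ : Term2 A).All (ExpPos q))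
    (hx : ∀ b ∈ s, ∀ x ∈ bases b.1, IsLyndon x) (hx' : ∀ b ∈ s', ∀ x ∈ bases b.1, IsLyndon x)
    (ht : Trim R (altHead q y (word v ++ r) s) (altTail q s) P t)
    (ht' : Trim R (altHead q y (word v ++ r') s') (altTail q s') P t) : r = r' ∧ s = s' := by
  have hlen : s.length = s'.length := by
    rw [← altTail_length q s, ← altTail_length q s', ← ht.ne_nil.2.2, ← ht'.ne_nil.2.2]
  have rank : ∀ {r : Term1 A} {s : List (Term1 A × Term1 A)}, Reduced r s →
      ∀ b ∈ s.head?, HasRankOne b.1 := by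
    rintro r (_ | ⟨b, s⟩) h b' hb'
    · simp at hb'
    · obtain rfl : b = b' := by simpa using hb'
      exact h.1.good.rank
  induction s generalizing y v r r' s' R P t with
  | nil =>
    obtain rfl : s' = [] := by simpa using hlen.symm
    generalize h1 : altHead q y (word v ++ r) [] = a at ht
    generalize h2 : altHead q y (word v ++ r') [] = a' at ht'
    cases ht
    cases ht'
    obtain ⟨-, h3, -⟩ := body_injective (h1.trans h2.symm) (by simpa using hq.1) (by simpa using hq'.1)
    exact ⟨List.append_cancel_left h3, rfl⟩
  | cons b s ih =>
    obtain ⟨π, ρ⟩ := b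
    obtain _ | ⟨⟨π', ρ'⟩, s'⟩ := s'
    · simp at hlen
    generalize h1 : altHead q y (word v ++ r) ((π, ρ) :: s) = a at ht
    generalize h2 : altHead q y (word v ++ r') ((π', ρ') :: s') = a' at ht'
    generalize h3 : altTail q ((π, ρ) :: s) = c at ht
    generalize h4 : altTail q ((π', ρ') :: s') = c' at ht'
    cases ht with
    | nil => simp [altTail] at h3
    | cons _ _ S R₁ N a₁ P₁ t₁ t₂ hP hN hl hh ht =>
    cases ht' with
    | cons _ _ S' R₁' _ a₁' _ t₁' _ _ _ _ _ ht' =>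
    simp only [altTail, List.cons.injEq, Prod.mk.injEq] at h3 h4
    obtain ⟨⟨h3, rfl⟩, rfl⟩ := h3
    obtain ⟨⟨h4, rfl⟩, rfl⟩ := h4
    have hb := hq.2 _ List.mem_cons_self
    have hb' := hq'.2 _ List.mem_cons_self
    -- Besides `r` and `π` this recovers `R₁`, the prefix deleted from the next positive factor,
    -- which is the datum with which the induction continues.
    obtain ⟨rfl, rfl, rfl⟩ := (h.1.trimmedBlock h.2.1 (rank h.2.2) hq.1 hb.1 hb.2
        (hx _ List.mem_cons_self) hP hN hl hh h1 h3 ht).unique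
      (h'.1.trimmedBlock h'.2.1 (rank h'.2.2) hq'.1 hb'.1 hb'.2
        (hx' _ List.mem_cons_self) hP hN hl hh h2 h4 ht')
    obtain ⟨rfl, rfl⟩ := ih h.2.2 h'.2.2 ⟨hb.2, fun c hc => hq.2 c (List.mem_cons_of_mem _ hc)⟩
      ⟨hb'.2, fun c hc => hq'.2 c (List.mem_cons_of_mem _ hc)⟩
      (fun c hc => hx c (List.mem_cons_of_mem _ hc)) (fun c hc => hx' c (List.mem_cons_of_mem _ hc))
      ht ht' (by simpa using hlen)
    exact ⟨rfl, rfl⟩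

end Canonical

end KappaLG

theorem mainTheorem6 {A : Type*} [Finite A] [LinearOrder A] (α β : KappaLG.Term2 A)
    (hα : α.IsLGCanonical) (hβ : β.IsLGCanonical) (hlen : α.twoLength = β.twoLength)
    (q : ℕ) (hq : max α.qBound β.qBound ≤ q) (hroot : α.root q = β.root q) :
    α = β := by
  obtain ⟨hSα, hIα, hRα⟩ := hα.reduced
  obtain ⟨hSβ, hIβ, hRβ⟩ := hβ.reduced
  have hqα := KappaLG.all_expPos_of_qBound_le ((le_max_left _ _).trans hq)
  have hqβ := KappaLG.all_expPos_of_qBound_le ((le_max_right _ _).trans hq)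
  obtain ⟨P, t, hP⟩ := hIα.exists_trim hSα hqα
  obtain ⟨P', t', hP'⟩ := hIβ.exists_trim hSβ hqβ
  -- Equal roots give equal elements of the free group. Their images under `closeVar` are the
  -- alternating products, in which empty bases mark the two ends of the term.
  have hg := congrArg (FreeGroup.map KappaLG.closeVar) (FreeGroup.reduce.exact hroot)
  rw [KappaLG.map_closeVar_outline q α hα.1 hSα.1, KappaLG.map_closeVar_outline q β hβ.1 hSβ.1] at hg
  obtain ⟨rfl, rfl⟩ := hP.unique hP' hg
  obtain ⟨h1, h2⟩ := hRα.unique (y := []) (v := []) hRβ hqα hqβ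
    (fun b hb x hx => hSα.2.1 ((KappaLG.bases_subset_of_mem hb).1 hx))
    (fun b hb x hx => hSβ.2.1 ((KappaLG.bases_subset_of_mem hb).1 hx)) hP hP'
  cases α
  cases β
  congr
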